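/- Let $n\ge 2$, $L>0$, and let $h:[0,L]\to\mathbb R$ be smooth and increasing with $h(0)=0$, $h'(0)=1$. Let $M$ be the hypersurface of revolution with pole $p$ and metric $g=dr^2+h(r)^2 g_{S^{n-1}}$, $r\in[0,L]$, where $r$ is the distance to $p$, and write $B_R$ for the geodesic ball of radius $R$ about $p$. Let $\rho:S^{n-1}=U_pM\to(0,L]$ be smooth and let $\tilde\Omega_{\rm out}=\{\exp_p(tu): u\in U_pM,\ 0\le t<\rho(u)\}$ be the corresponding smooth domain that is star-shaped with respect to $p$. Put $R_m=\min\rho$, $R_M=\max\rho$, let $0<R_1<R_m$, and $\tilde\Omega=\tilde\Omega_{\rm out}\setminus\overline{B_{R_1}}$. Let $\theta$ be the angle between the unit outward normal $\nu$ of $\partial\tilde\Omega_{\rm out}$ and $\partial_r$, and let $\alpha<\pi/2$ be such that $\theta\le\alpha$ on all of $\partial\tilde\Omega_{\rm out}$. For a domain $\Omega=\Omega_{\rm out}\setminus\overline{B_{R_1}}$ of this kind let $$\mu_1(\Omega)=\inf\left\{\frac{\int_\Omega\|\nabla u\|^2\,dV}{\int_{\partial\Omega_{\rm out}}u^2\,dS}:\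 u\in H^1(\Omega),\ \int_{\partial\Omega_{\rm out}}u\,dS=0,\ u|_{\partial\Omega_{\rm out}}\ne0\right\}$$ be the first non-zero eigenvalue of the Steklov--Neumann problem $\Delta u=0$ in $\Omega$, $\partial_\nu u=0$ on $\partial B_{R_1}$, $\partial_\nu u=\mu u$ on $\partial\Omega_{\rm out}$. Then $$C_1\,\mu_1\big(B_{R_m}\setminus\overline{B_{R_1}}\big)\ \le\ \mu_1(\tilde\Omega)\ \le\ C_2\,\mu_1\big(B_{R_M}\setminus\overline{B_{R_1}}\big)$$ with the positive constants $$C_1=\frac{h^{n-1}(R_m)}{\sqrt{1+\tan^2\alpha}\;h^{n-1}(R_M)}\left(1+\frac{\sqrt{n-1}\,(R_M-R_m)}{h(R_m)}\right)^{-1},\qquad C_2=\frac{h^{n-1}(R_M)}{h^{n-1}(R_m)}.$$ -/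

import Mathlib

open MeasureTheory Filter Topology
open scoped ContDiff

noncomputable section

namespace SteklovNeumann

/-- The coordinate space. The geodesic ball of radius `L` about the pole `p` of the manifold
`dr² + h(r)² g_{S^{n-1}}` is written in geodesic normal coordinates at `p`: the pole is `0`, the map
`exp_p` is the identity, the distance to `p` is `‖x‖`, and geodesic balls about `p` are Euclidean
balls about `0`. -/
abbrev E (n : ℕ) : Type := EuclideanSpace ℝ (Fin n)

/-- The unit sphere `U_p M = S^{n-1}`. -/
abbrev S (n : ℕ) : Type := Metric.sphere (0 : E n) 1

variable {n : ℕ}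

/-- The radial unit vector field `∂_r` (used away from the pole only). -/
def radial (x : E n) : E n := ‖x‖⁻¹ • x

/-- The Riemannian metric `g = dr² + h(r)² g_{S^{n-1}}` at a point `x ≠ 0`: a vector orthogonal to
`x` of Euclidean length `ℓ` has angular length `ℓ / ‖x‖` and hence `g`-length `h(‖x‖) ℓ / ‖x‖`. -/
def metric (h : ℝ → ℝ) (x v w : E n) : ℝ :=
  inner ℝ (radial x) v * inner ℝ (radial x) w +
    (h ‖x‖ / ‖x‖) ^ 2 *
      (inner ℝ v w - inner ℝ (radial x) v * inner ℝ (radial x) w)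

/-- The Riemannian gradient at `x` of a function whose Euclidean gradient at `x` is `G`; see
`metric_riemGrad`. -/
def riemGrad (h : ℝ → ℝ) (x G : E n) : E n :=
  inner ℝ (radial x) G • radial x +
    (‖x‖ / h ‖x‖) ^ 2 • (G - inner ℝ (radial x) G • radial x)

/-- The squared Riemannian norm `‖∇u‖²` of the gradient. -/
def gradNormSq (h : ℝ → ℝ) (x G : E n) : ℝ :=
  metric h x (riemGrad h x G) (riemGrad h x G)

theorem radial_inner_self {x : E n} (hx : x ≠ 0) : inner ℝ (radial x) (radial x) = 1 := by
  have : ‖x‖ ≠ 0 := norm_ne_zero_iff.mpr hx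
  rw [real_inner_self_eq_norm_sq, radial, norm_smul, norm_inv, norm_norm, inv_mul_cancel₀ this,
    one_pow]

/-- `riemGrad h x G` is the gradient: its `g`-product with `v` is the derivative along `v`. -/
theorem metric_riemGrad (h : ℝ → ℝ) {x : E n} (hx : x ≠ 0) (hh : h ‖x‖ ≠ 0) (G v : E n) :
    metric h x (riemGrad h x G) v = inner ℝ G v := by
  have hx' : ‖x‖ ≠ 0 := norm_ne_zero_iff.mpr hx
  have h1 := radial_inner_self hx
  have e : (h ‖x‖ / ‖x‖) ^ 2 * (‖x‖ / h ‖x‖) ^ 2 = 1 := by field_simp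
  simp only [metric, riemGrad, inner_add_right, inner_add_left, inner_smul_left, inner_smul_right,
    inner_sub_left, inner_sub_right, h1, RCLike.conj_to_real]
  linear_combination (inner ℝ G v - inner ℝ (radial x) G * inner ℝ (radial x) v) * e

/-- `‖∇u‖² = (∂_r u)² + h(r)⁻² ‖∇̄u‖²`, where `∇̄` is the gradient along the unit sphere, that is
`‖x‖` times the part of the Euclidean gradient orthogonal to `x`. -/
theorem gradNormSq_eq (h : ℝ → ℝ) {x : E n} (hx : x ≠ 0) (hh : h ‖x‖ ≠ 0) (G : E n) :
    gradNormSq h x G = inner ℝ (radial x) G ^ 2 +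
      (‖x‖ / h ‖x‖) ^ 2 * (‖G‖ ^ 2 - inner ℝ (radial x) G ^ 2) := by
  rw [gradNormSq, metric_riemGrad h hx hh, riemGrad, inner_add_right, inner_smul_right,
    inner_smul_right, inner_sub_right, inner_smul_right, real_inner_self_eq_norm_sq,
    real_inner_comm G (radial x)]
  ring

/-- `ρ` is the radial function `u ↦ r_u` of a smooth domain that is star-shaped about the pole,
extended from the unit sphere as a function homogeneous of degree zero. The domain is
`Ω_out = {exp_p (t u) : u ∈ S^{n-1}, 0 ≤ t < r_u}`. -/
structure IsRadialFunction (ρ : E n → ℝ) : Prop where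
  pos : ∀ x, x ≠ 0 → 0 < ρ x
  homogeneous : ∀ (t : ℝ) (x : E n), 0 < t → ρ (t • x) = ρ x
  smooth : ContDiffOn ℝ ∞ ρ {0}ᶜ

/-- The perforated domain `Ω_out ∖ closure B_{R₁}`. For the constant function `ρ = R` it is the
concentric annulus `B_R ∖ closure B_{R₁}`. -/
def perforated (ρ : E n → ℝ) (R₁ : ℝ) : Set (E n) := {x | R₁ < ‖x‖ ∧ ‖x‖ < ρ x}

/-- The Riemannian volume `dV` on the perforated domain. The Gram matrix of `g` at `x` has the
eigenvalues `1` and, `n - 1` times, `(h(‖x‖) / ‖x‖)²`. -/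
def vol (h : ℝ → ℝ) (ρ : E n → ℝ) (R₁ : ℝ) : Measure (E n) :=
  (volume.restrict (perforated ρ R₁)).withDensity
    fun x => ENNReal.ofReal ((h ‖x‖ / ‖x‖) ^ (n - 1))

/-- The point `exp_p (r_u u)` of the outer boundary. -/
def bdry (ρ : E n → ℝ) (u : S n) : E n := ρ u • (u : E n)

/-- The gradient `∇̄ r_u` along the unit sphere. (The Euclidean gradient of a function homogeneous
of degree zero is tangent to the sphere.) -/
def sphGrad (ρ : E n → ℝ) (u : S n) : E n := gradient ρ (u : E n)

/-- An outward normal vector at `bdry ρ u`: the Riemannian gradient of `x ↦ ‖x‖ - ρ x`. The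
Euclidean gradient of that function at `bdry ρ u` is `u - (ρ u)⁻¹ ∇̄ r_u`. -/
def normalVec (h : ℝ → ℝ) (ρ : E n → ℝ) (u : S n) : E n :=
  riemGrad h (bdry ρ u) (gradient (fun x : E n => ‖x‖ - ρ x) (bdry ρ u))

/-- The unit outward normal `ν` of the outer boundary. -/
def unitNormal (h : ℝ → ℝ) (ρ : E n → ℝ) (u : S n) : E n :=
  (√(metric h (bdry ρ u) (normalVec h ρ u) (normalVec h ρ u)))⁻¹ • normalVec h ρ u

/-- The angle between `ν` and `∂_r` at the boundary point over `u`. -/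
def angle (h : ℝ → ℝ) (ρ : E n → ℝ) (u : S n) : ℝ :=
  Real.arccos (metric h (bdry ρ u) (unitNormal h ρ u) (radial (bdry ρ u)))

/-- `cos θ = (1 + ‖∇̄r_u‖² / h(r_u)²)^{-1/2}`, that is `tan² θ = ‖∇̄r_u‖² / h(r_u)²`. -/
theorem angle_eq (h : ℝ → ℝ) {ρ : E n → ℝ} (hρ : IsRadialFunction ρ) (u : S n)
    (hh : h (ρ u) ≠ 0) :
    angle h ρ u = Real.arccos (√(1 + ‖sphGrad ρ u‖ ^ 2 / h (ρ u) ^ 2))⁻¹ := by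
  have hu1 : ‖(u : E n)‖ = 1 := by simp
  have hu0 : (u : E n) ≠ 0 := by
    intro h0; rw [h0, norm_zero] at hu1; exact zero_ne_one hu1
  have hr : 0 < ρ u := hρ.pos _ hu0
  have hq0 : bdry ρ u ≠ 0 := smul_ne_zero hr.ne' hu0
  have hqn : ‖bdry ρ u‖ = ρ u := by
    rw [bdry, norm_smul, hu1, mul_one, Real.norm_of_nonneg hr.le]
  have hrad : radial (bdry ρ u) = (u : E n) := by
    rw [radial, hqn, bdry, smul_smul, inv_mul_cancel₀ hr.ne', one_smul]
  have hdiff : ∀ x : E n, x ≠ 0 → DifferentiableAt ℝ ρ x := fun x hx =>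
    (hρ.smooth.differentiableOn (by simp)).differentiableAt
      (isOpen_compl_singleton.mem_nhds hx)
  -- the derivative of `ρ` at the boundary point
  have hgr : gradient ρ (bdry ρ u) = (ρ u)⁻¹ • sphGrad ρ u := by
    have h1 : HasGradientAt ρ (gradient ρ (bdry ρ u)) (bdry ρ u) := (hdiff _ hq0).hasGradientAt
    have h2 : HasFDerivAt (fun x : E n => ρ (ρ u • x))
        ((InnerProductSpace.toDual ℝ (E n) (gradient ρ (bdry ρ u))).comp
          (ρ u • ContinuousLinearMap.id ℝ (E n))) (u : E n) :=
      HasFDerivAt.comp (u : E n) (f := fun x : E n => ρ u • x) h1.hasFDerivAt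
        ((hasFDerivAt_id (u : E n)).const_smul (ρ u))
    have h3 : (fun x : E n => ρ (ρ u • x)) = ρ := by
      funext x; exact hρ.homogeneous _ _ hr
    rw [h3] at h2
    have h4 : HasGradientAt ρ (ρ u • gradient ρ (bdry ρ u)) (u : E n) := by
      rw [hasGradientAt_iff_hasFDerivAt]
      refine h2.congr_fderiv ?_
      refine ContinuousLinearMap.ext fun v => ?_
      simp only [ContinuousLinearMap.comp_apply, _root_.smul_apply,
        ContinuousLinearMap.id_apply, InnerProductSpace.toDual_apply_apply, inner_smul_left,
        inner_smul_right, RCLike.conj_to_real]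
    rw [sphGrad, h4.gradient, smul_smul, inv_mul_cancel₀ hr.ne', one_smul]
  have htan : inner ℝ (u : E n) (sphGrad ρ u) = 0 := by
    have h1 : HasFDerivAt ρ (InnerProductSpace.toDual ℝ (E n) (sphGrad ρ u)) ((1 : ℝ) • (u : E n)) := by
      rw [one_smul]; exact (hdiff _ hu0).hasGradientAt.hasFDerivAt
    have h2 : HasDerivAt (fun t : ℝ => ρ (t • (u : E n)))
        ((InnerProductSpace.toDual ℝ (E n) (sphGrad ρ u)) ((1 : ℝ) • (u : E n))) 1 :=
      HasFDerivAt.comp_hasDerivAt (1 : ℝ) (f := fun t : ℝ => t • (u : E n)) h1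
        ((hasDerivAt_id (1 : ℝ)).smul_const (u : E n))
    have h3 : HasDerivAt (fun t : ℝ => ρ (t • (u : E n))) 0 1 := by
      refine (hasDerivAt_const (1 : ℝ) (ρ u)).congr_of_eventuallyEq ?_
      filter_upwards [lt_mem_nhds (zero_lt_one (α := ℝ))] with t ht
      exact hρ.homogeneous t _ ht
    have h4 := h2.unique h3
    rw [one_smul, InnerProductSpace.toDual_apply_apply] at h4
    rw [real_inner_comm]; exact h4
  have hnorm : HasGradientAt (fun x : E n => ‖x‖) (u : E n) (bdry ρ u) := by
    rw [hasGradientAt_iff_hasFDerivAt]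
    have h1 : HasFDerivAt (fun x : E n => √(‖x‖ ^ 2)) _ (bdry ρ u) :=
      ((hasStrictFDerivAt_norm_sq (bdry ρ u)).hasFDerivAt).sqrt
        (by rw [hqn]; positivity)
    have h2 : (fun x : E n => √(‖x‖ ^ 2)) = fun x => ‖x‖ := by
      funext x; exact Real.sqrt_sq (norm_nonneg x)
    rw [h2] at h1
    refine h1.congr_fderiv ?_
    refine ContinuousLinearMap.ext fun v => ?_
    rw [hqn, Real.sqrt_sq hr.le]
    simp only [_root_.smul_apply, InnerProductSpace.toDual_apply_apply,
      innerSL_apply_apply, bdry, inner_smul_left, RCLike.conj_to_real, smul_eq_mul, nsmul_eq_mul]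
    field_simp
    try norm_num
  have hG : gradient (fun x : E n => ‖x‖ - ρ x) (bdry ρ u) =
      (u : E n) - (ρ u)⁻¹ • sphGrad ρ u := by
    rw [← hgr]
    refine HasGradientAt.gradient ?_
    rw [hasGradientAt_iff_hasFDerivAt, map_sub]
    exact hnorm.hasFDerivAt.sub (hdiff _ hq0).hasGradientAt.hasFDerivAt
  have hh' : h ‖bdry ρ u‖ ≠ 0 := by rw [hqn]; exact hh
  have huu : inner ℝ (u : E n) (u : E n) = (1 : ℝ) := by
    rw [real_inner_self_eq_norm_sq, hu1, one_pow]
  have htan' : inner ℝ (sphGrad ρ u) (u : E n) = 0 := by rw [real_inner_comm]; exact htan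
  have hNN : metric h (bdry ρ u) (normalVec h ρ u) (normalVec h ρ u) =
      1 + ‖sphGrad ρ u‖ ^ 2 / h (ρ u) ^ 2 := by
    change gradNormSq h (bdry ρ u) _ = _
    rw [gradNormSq_eq h hq0 hh', hG, hrad, hqn, ← real_inner_self_eq_norm_sq (_ - _)]
    simp only [inner_sub_left, inner_sub_right, inner_smul_left, inner_smul_right, huu, htan,
      htan', real_inner_self_eq_norm_sq, RCLike.conj_to_real]
    field_simp
    ring
  have hNr : metric h (bdry ρ u) (normalVec h ρ u) (u : E n) = 1 := by
    rw [normalVec, metric_riemGrad h hq0 hh', hG, inner_sub_left, inner_smul_left, huu, htan']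
    simp
  have hsmul : ∀ (c : ℝ) (v w : E n), metric h (bdry ρ u) (c • v) w =
      c * metric h (bdry ρ u) v w := by
    intro c v w
    simp only [metric, inner_smul_left, inner_smul_right, RCLike.conj_to_real]; ring
  rw [angle, hrad, unitNormal, hsmul, hNr, hNN, mul_one]

/-- The Riemannian surface measure `dS` of the outer boundary `r = r_u`, carried to the unit sphere
by `u ↦ exp_p (r_u u)`: `dS = h(r_u)^{n-1} √(1 + ‖∇̄r_u‖² / h(r_u)²) du`, with `du` the standard
surface measure of the unit sphere. -/
def surf (h : ℝ → ℝ) (ρ : E n → ℝ) : Measure (S n) :=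
  (volume : Measure (E n)).toSphere.withDensity fun u =>
    ENNReal.ofReal (h (ρ u) ^ (n - 1) * √(1 + ‖sphGrad ρ u‖ ^ 2 / h (ρ u) ^ 2))

/-- `u` belongs to `H¹` of the perforated domain, with (coordinate) weak gradient `G` and with trace
`φ` on the outer boundary: `u` is the limit in `H¹` of functions that are `C¹` up to the boundary,
and `φ` is the limit in `L²` of their boundary values. -/
structure IsH1 (h : ℝ → ℝ) (ρ : E n → ℝ) (R₁ : ℝ) (u : E n → ℝ) (G : E n → E n)
    (φ : S n → ℝ) : Prop where
  memLp : MemLp u 2 (vol h ρ R₁)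
  memLp_grad : MemLp G 2 (vol h ρ R₁)
  memLp_trace : MemLp φ 2 (surf h ρ)
  approx : ∃ w : ℕ → E n → ℝ, (∀ k, ContDiff ℝ 1 (w k)) ∧
    Tendsto (fun k => eLpNorm (fun x => w k x - u x) 2 (vol h ρ R₁)) atTop (𝓝 0) ∧
    Tendsto (fun k => eLpNorm (fun x => gradient (w k) x - G x) 2 (vol h ρ R₁)) atTop (𝓝 0) ∧
    Tendsto (fun k => eLpNorm (fun θ => w k (bdry ρ θ) - φ θ) 2 (surf h ρ)) atTop (𝓝 0)

/-- The first non-zero Steklov-Neumann eigenvalue of the perforated domain, with the Neumann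
condition on `∂B_{R₁}` and the Steklov condition on the outer boundary:
`μ₁ = inf {∫ ‖∇u‖² dV / ∫ u² dS : u ∈ H¹, ∫ u dS = 0, u ≠ 0 on the outer boundary}`. -/
def mu1 (h : ℝ → ℝ) (ρ : E n → ℝ) (R₁ : ℝ) : ℝ :=
  sInf {q | ∃ u G φ, IsH1 h ρ R₁ u G φ ∧ ∫ θ, φ θ ∂(surf h ρ) = 0 ∧
    0 < ∫ θ, φ θ ^ 2 ∂(surf h ρ) ∧
    q = (∫ x, gradNormSq h x (G x) ∂(vol h ρ R₁)) / ∫ θ, φ θ ^ 2 ∂(surf h ρ)}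

/-- The constant of the lower bound. -/
def lowerConst (n : ℕ) (h : ℝ → ℝ) (Rm RM α : ℝ) : ℝ :=
  h Rm ^ (n - 1) / (√(1 + Real.tan α ^ 2) * h RM ^ (n - 1)) *
    (1 + √((n : ℝ) - 1) * (RM - Rm) / h Rm)⁻¹

/-- The constant of the upper bound. -/
def upperConst (n : ℕ) (h : ℝ → ℝ) (Rm RM : ℝ) : ℝ := h RM ^ (n - 1) / h Rm ^ (n - 1)

end SteklovNeumann

end

open MeasureTheory Filter Topology
open scoped ContDiff

noncomputable section

namespace SteklovNeumann

variable {n : ℕ}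


/-! The common yardstick of both bounds is the Riccati equation F' = (n-1) h^{n-3} - F²/h^{n-1},
F(R₁) = 0. If h^{n-1} a' = F a, then a(r) x_i/|x| is harmonic, satisfies the Neumann condition on
the inner sphere, and has Steklov quotient F(R)/h^{n-1}(R) on the sphere of radius R. Since h
increases, 0 ≤ F ≤ √(n-1) h^{n-2}, and hence F is monotone (`exists_isRiccati`).

For an annulus, `riccati_div_le_mu1` gives F(R)/h^{n-1}(R) ≤ μ₁. The product of F with the variance
of w on the sphere of radius r vanishes at R₁, and its derivative is at most the energy of the
slice, by the sharp Poincaré inequality on the sphere (`sphere_poincare`) and a completed square.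
The Poincaré inequality is obtained by averaging over the orthogonal group a one-dimensional
estimate along great circles, which is read off from Fourier coefficients.

For the upper bound the n functions a(r) x_i/|x| are tested together on the star-shaped domain.
Their energies add up to ∫ a(ρ)² F(ρ) dθ, and F(ρ) ≤ F(R_M). Their boundary means need not vanish,
so constants c_i are subtracted; what is needed is that this costs nothing, namely h^{n-1}(R_m) ∫
a(ρ)² dθ ≤ ∫ |a(ρ)θ - c|² dS for every vector c. Because a'/a = F/h^{n-1} ≤ √(n-1)/h, this follows
from an inequality on the sphere for y = a∘ρ (`sphere_key`): ∫ y² ≤ ∫ |yθ - c|² √(1 +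
|∇y|²/((n-1)y²)). Thus μ₁ ≤ F(R_M)/h^{n-1}(R_m), which is C₂ times the lower bound
F(R_M)/h^{n-1}(R_M) for the outer annulus.

The inequality `sphere_key` is proved by calibration. After scaling, c is a unit vector e. An
explicit field in the variables Y and α = ⟨e, θ⟩ is dominated by the integrand on the right
(`field_le`, Cauchy-Schwarz), and its divergence is at most that of the field behind ∫ y²
(`field_divergence_le`). Replacing y by μy and using the divergence theorem on the sphere, the
calibrated difference is antitone in μ; as μ → ∞ its lower limit is at least a nonnegative multiple
of (n-2)(n-3), so it is nonnegative at μ = 1.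

For the lower bound, boundary values of w at radius ρ(θ) are carried along rays to radius R_m. The
increment is paid by the radial energy between the two radii, the rest by the eigenvalue m of the
inner annulus (`le_mu1_of_annulus`). This gives the factor 1 + m(R_M - R_m), and m ≤ √(n-1)/h(R_m)
is the upper estimate applied to that annulus itself. -/

/-! ### Integrals depending on a parameter and the divergence theorem on the unit sphere -/

/-- Differentiation under the integral sign over a compact space. -/
theorem hasDerivAt_integral_of_compact {X : Type*} [TopologicalSpace X] [CompactSpace X]
    [MeasurableSpace X] [OpensMeasurableSpace X] {μ : Measure X} [IsFiniteMeasure μ]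
    {U : Set ℝ} (hU : IsOpen U) {f f' : ℝ → X → ℝ}
    (hf : ∀ t ∈ U, Continuous (f t))
    (hf' : ContinuousOn (fun p : ℝ × X => f' p.1 p.2) (U ×ˢ Set.univ))
    (hd : ∀ t ∈ U, ∀ x, HasDerivAt (fun s => f s x) (f' t x) t) {t₀ : ℝ} (ht₀ : t₀ ∈ U) :
    HasDerivAt (fun t => ∫ x, f t x ∂μ) (∫ x, f' t₀ x ∂μ) t₀ := by
  obtain ⟨ε, hε, hεU⟩ := Metric.nhds_basis_closedBall.mem_iff.1 (hU.mem_nhds ht₀)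
  have hK : IsCompact (Metric.closedBall t₀ ε ×ˢ (Set.univ : Set X)) :=
    (isCompact_closedBall _ _).prod isCompact_univ
  obtain ⟨C, hC⟩ := hK.exists_bound_of_continuousOn
    (hf'.mono (Set.prod_mono hεU subset_rfl))
  have hint : ∀ t ∈ U, Integrable (f t) μ := fun t ht => by
    have h1 := (hf t ht).stronglyMeasurable_of_hasCompactSupport (HasCompactSupport.of_compactSpace _)
    obtain ⟨B, hB⟩ := isCompact_univ.exists_bound_of_continuousOn (hf t ht).continuousOn
    exact Integrable.of_bound h1.aestronglyMeasurable B
      (Eventually.of_forall fun x => hB x trivial)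
  have hcont' : Continuous (f' t₀) := by
    rw [← continuousOn_univ]
    exact hf'.comp (f := fun x => (t₀, x)) (by fun_prop) fun x _ => ⟨ht₀, trivial⟩
  refine (hasDerivAt_integral_of_dominated_loc_of_deriv_le (bound := fun _ => C)
    (Metric.closedBall_mem_nhds t₀ hε) ?_ (hint t₀ ht₀) ?_ ?_ (integrable_const _) ?_).2
  · filter_upwards [hU.mem_nhds ht₀] with t ht using (hint t ht).aestronglyMeasurable
  · exact (hcont'.stronglyMeasurable_of_hasCompactSupport
      (HasCompactSupport.of_compactSpace _)).aestronglyMeasurable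
  · exact Eventually.of_forall fun x t ht => hC (t, x) ⟨ht, trivial⟩
  · exact Eventually.of_forall fun x t ht => hd t (hεU ht) x

/-- A continuous function on a compact space is integrable for a finite measure. -/
theorem integrable_of_compact {X : Type*} [TopologicalSpace X] [CompactSpace X]
    [MeasurableSpace X] [OpensMeasurableSpace X] {μ : Measure X} [IsFiniteMeasure μ]
    {f : X → ℝ} (hf : Continuous f) : Integrable f μ := by
  have h1 := hf.stronglyMeasurable_of_hasCompactSupport (HasCompactSupport.of_compactSpace _)
  obtain ⟨B, hB⟩ := isCompact_univ.exists_bound_of_continuousOn hf.continuousOn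
  exact Integrable.of_bound h1.aestronglyMeasurable B (Eventually.of_forall fun x => hB x trivial)

/-- The standard surface measure of the unit sphere. -/
abbrev sph (n : ℕ) : Measure (S n) := (volume : Measure (E n)).toSphere

theorem sph_norm (θ : S n) : ‖(θ : E n)‖ = 1 := by simp

theorem sph_ne_zero (θ : S n) : (θ : E n) ≠ 0 := by
  intro h; have := sph_norm θ; rw [h, norm_zero] at this; exact zero_ne_one this

open scoped Pointwise in
/-- Linear isometries preserve integrals over the unit sphere. -/
theorem integral_sphere_comp_isometry (R : E n ≃ₗᵢ[ℝ] E n) (f : E n → ℝ) :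
    ∫ θ : S n, f (R θ) ∂(sph n) = ∫ θ : S n, f θ ∂(sph n) := by
  let g : S n → S n := fun θ => ⟨R θ, by simp⟩
  have hg : Continuous g := by fun_prop
  have hinj : Function.Injective g := fun x y hxy => by
    have h1 : R x = R y := congrArg Subtype.val hxy
    exact Subtype.ext (R.injective h1)
  have hmp : MeasurePreserving g (sph n) (sph n) := by
    refine ⟨hg.measurable, ?_⟩
    ext s hs
    -- The spherical measure of a set is a multiple of the volume of the cone over it, and a linear
    -- isometry carries cones to cones.
    rw [Measure.map_apply hg.measurable hs, Measure.toSphere_apply' _ hs,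
      Measure.toSphere_apply' _ (hg.measurable hs)]
    congr 1
    have h1 : MeasurePreserving R.toMeasurableEquiv (volume : Measure (E n)) volume :=
      R.measurePreserving
    rw [← h1.measure_preimage_equiv (Set.Ioo (0 : ℝ) 1 • (Subtype.val '' s))]
    congr 1
    ext x
    simp only [Set.mem_smul, Set.mem_image, Set.mem_preimage]
    constructor
    · rintro ⟨r, hr, _, ⟨θ, hθ, rfl⟩, rfl⟩
      exact ⟨r, hr, _, ⟨g θ, hθ, rfl⟩, (map_smul R r (θ : E n)).symm⟩
    · rintro ⟨r, hr, _, ⟨θ, hθ, rfl⟩, h⟩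
      refine ⟨r, hr, _, ⟨⟨R.symm θ, by simp⟩, ?_, rfl⟩, ?_⟩
      · convert hθ
        exact Subtype.ext (by simp [g])
      · apply R.injective
        rw [map_smul]
        simpa using h
  exact hmp.integral_comp (hg.isClosedEmbedding hinj).measurableEmbedding (fun θ => f θ)

/-- The rotation by the angle `t` in the plane of the orthonormal vectors `a`, `b`. -/
def rotFun (a b : E n) (t : ℝ) (x : E n) : E n :=
  x + (Real.cos t - 1) • (inner ℝ a x • a + inner ℝ b x • b) +
    Real.sin t • (inner ℝ a x • b - inner ℝ b x • a)

theorem norm_rotFun {a b : E n} (ha : ‖a‖ = 1) (hb : ‖b‖ = 1) (hab : inner ℝ a b = 0) (t : ℝ)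
    (x : E n) : ‖rotFun a b t x‖ = ‖x‖ := by
  have h : ‖rotFun a b t x‖ ^ 2 = ‖x‖ ^ 2 := by
    have hba : inner ℝ b a = 0 := by rw [real_inner_comm]; exact hab
    rw [← real_inner_self_eq_norm_sq, ← real_inner_self_eq_norm_sq]
    simp only [rotFun, inner_add_left, inner_add_right, inner_smul_left, inner_smul_right,
      inner_sub_left, inner_sub_right, RCLike.conj_to_real, hab, hba, real_inner_self_eq_norm_sq,
      ha, hb, real_inner_comm a x, real_inner_comm b x]
    have := Real.sin_sq_add_cos_sq t
    linear_combination (inner ℝ a x ^ 2 + inner ℝ b x ^ 2) * this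
  exact (pow_left_inj₀ (norm_nonneg _) (norm_nonneg _) two_ne_zero).1 h

/-- The rotation as a linear isometry. -/
def rot {a b : E n} (ha : ‖a‖ = 1) (hb : ‖b‖ = 1) (hab : inner ℝ a b = 0) (t : ℝ) :
    E n ≃ₗᵢ[ℝ] E n :=
  LinearIsometry.toLinearIsometryEquiv
    { toFun := rotFun a b t
      map_add' := fun x y => by
        simp only [rotFun, inner_add_right, add_smul, smul_add, smul_sub, sub_smul]; abel
      map_smul' := fun c x => by
        simp only [rotFun, inner_smul_right, RingHom.id_apply]; module
      norm_map' := norm_rotFun ha hb hab t } rfl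

theorem hasDerivAt_rotFun (a b x : E n) :
    ∀ t, HasDerivAt (fun t => rotFun a b t x)
      (-Real.sin t • (inner ℝ a x • a + inner ℝ b x • b) +
        Real.cos t • (inner ℝ a x • b - inner ℝ b x • a)) t := by
  intro t
  have h1 := (((Real.hasDerivAt_cos t).sub_const 1).smul_const
    (inner ℝ a x • a + inner ℝ b x • b)).const_add x
  have h2 := (Real.hasDerivAt_sin t).smul_const (inner ℝ a x • b - inner ℝ b x • a)
  exact h1.add h2

/-- The integral over the sphere of the derivative along an infinitesimal rotation vanishes. -/
theorem integral_sphere_rotation {U : Set (E n)} (hU : IsOpen U) (hS : ∀ θ : S n, (θ : E n) ∈ U)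
    {f : E n → ℝ} (hf : ContDiffOn ℝ 1 f U) {a b : E n} (ha : ‖a‖ = 1) (hb : ‖b‖ = 1) (hab : inner ℝ a b = 0) :
    ∫ θ : S n, fderiv ℝ f θ (inner ℝ a θ • b - inner ℝ b θ • a) ∂(sph n) = 0 := by
  have hfd : ∀ x ∈ U, DifferentiableAt ℝ f x := fun x hx =>
    (hf.differentiableOn (by simp)).differentiableAt (hU.mem_nhds hx)
  have hfc : ContinuousOn (fderiv ℝ f) U := hf.continuousOn_fderiv_of_isOpen hU le_rfl
  have hne : ∀ t, ∀ θ : S n, rotFun a b t θ ∈ U := fun t θ =>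
    hS ⟨rotFun a b t θ, by rw [mem_sphere_zero_iff_norm, norm_rotFun ha hb hab, sph_norm]⟩
  have hrc : Continuous (fun p : ℝ × S n => rotFun a b p.1 p.2) := by
    unfold rotFun; fun_prop
  have key := hasDerivAt_integral_of_compact (μ := sph n) (U := Set.univ) isOpen_univ
    (f := fun t θ => f (rotFun a b t θ))
    (f' := fun t θ => fderiv ℝ f (rotFun a b t θ)
      (-Real.sin t • (inner ℝ a (θ : E n) • a + inner ℝ b (θ : E n) • b) +
        Real.cos t • (inner ℝ a (θ : E n) • b - inner ℝ b (θ : E n) • a)))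
    (fun t _ => hf.continuousOn.comp_continuous (by unfold rotFun; fun_prop) (fun θ => hne t θ))
    (by
      refine Continuous.continuousOn ?_
      refine Continuous.clm_apply ?_ (by fun_prop)
      exact hfc.comp_continuous hrc (fun p => hne p.1 p.2))
    (fun t _ θ => by
      have h1 := (hfd _ (hne t θ)).hasFDerivAt
      exact h1.comp_hasDerivAt t (hasDerivAt_rotFun a b θ t))
    (t₀ := 0) trivial
  -- By invariance the integral is constant in `t`, so the derivative computed above at `0` must
  -- vanish.
  have h2 : (fun t => ∫ θ : S n, f (rotFun a b t θ) ∂(sph n)) =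
      fun _ => ∫ θ : S n, f θ ∂(sph n) := by
    funext t
    exact integral_sphere_comp_isometry (rot ha hb hab t) f
  rw [h2] at key
  have h3 := key.unique (hasDerivAt_const _ _)
  rw [← h3]
  refine integral_congr_ae (Eventually.of_forall fun θ => ?_)
  have : rotFun a b 0 (θ : E n) = θ := by simp [rotFun]
  simp [this]

theorem inner_single_left' (i : Fin n) (x : E n) :
    inner ℝ (EuclideanSpace.single i (1 : ℝ)) x = x i := by
  simp [EuclideanSpace.inner_single_left]

theorem sum_coord_smul_single (x : E n) :
    ∑ i, x i • EuclideanSpace.single i (1 : ℝ) = x := by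
  ext j
  simp [Finset.sum_apply, Pi.single_apply]

theorem continuous_sphere_of_contDiffOn {U : Set (E n)} (hS : ∀ θ : S n, (θ : E n) ∈ U)
    {ψ : E n → ℝ} (hψ : ContDiffOn ℝ 1 ψ U) : Continuous fun θ : S n => ψ θ :=
  hψ.continuousOn.comp_continuous continuous_subtype_val hS

theorem continuous_sphere_fderiv {U : Set (E n)} (hU : IsOpen U)
    (hS : ∀ θ : S n, (θ : E n) ∈ U) {ψ : E n → ℝ} (hψ : ContDiffOn ℝ 1 ψ U) :
    Continuous fun θ : S n => fderiv ℝ ψ (θ : E n) :=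
  (hψ.continuousOn_fderiv_of_isOpen hU le_rfl).comp_continuous continuous_subtype_val hS

/-- The divergence theorem on the unit sphere for the field `ψ v^⊤`, coordinate directions. -/
theorem integral_sphere_tangent_single {U : Set (E n)} (hU : IsOpen U) (hS : ∀ θ : S n, (θ : E n) ∈ U)
    {ψ : E n → ℝ} (hψ : ContDiffOn ℝ 1 ψ U) (i : Fin n) :
    ∫ θ : S n, fderiv ℝ ψ θ (EuclideanSpace.single i (1 : ℝ) - (θ : E n) i • (θ : E n)) ∂(sph n) =
      ((n : ℝ) - 1) * ∫ θ : S n, (θ : E n) i * ψ θ ∂(sph n) := by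
  let e : Fin n → E n := fun j => EuclideanSpace.single j (1 : ℝ)
  have he : ∀ j (x : E n), inner ℝ (e j) x = x j := fun j x => inner_single_left' j x
  have hen : ∀ j, ‖e j‖ = 1 := fun j => by simp [e]
  have hψc := continuous_sphere_of_contDiffOn hS hψ
  have hDc := continuous_sphere_fderiv hU hS hψ
  have hci : ∀ j, Continuous fun θ : S n => (θ : E n) j := fun j => by fun_prop
  -- Rotation in the plane of `e i`, `e j` applied to `ψ x_j`. Summing over `j ≠ i` and using `∑
  -- x_j² = 1` recovers the tangential derivative of `ψ`, with `n - 1` copies of `x_i ψ`.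
  have hj : ∀ j, j ≠ i →
      ∫ θ : S n, ((θ : E n) j * fderiv ℝ ψ θ ((θ : E n) i • e j - (θ : E n) j • e i) +
        (θ : E n) i * ψ θ) ∂(sph n) = 0 := by
    intro j hji
    have h1 : ContDiffOn ℝ 1 (fun x : E n => ψ x * inner ℝ (e j) x) U :=
      hψ.mul (innerSL ℝ (e j)).contDiff.contDiffOn
    have h2 := integral_sphere_rotation hU hS h1 (hen i) (hen j)
      (by rw [he]; simp [e, hji.symm])
    rw [← h2]
    refine integral_congr_ae (Eventually.of_forall fun θ => ?_)
    have h3 : HasFDerivAt (fun x : E n => ψ x * inner ℝ (e j) x) _ (θ : E n) :=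
      ((hψ.differentiableOn (by simp)).differentiableAt (hU.mem_nhds (hS θ))).hasFDerivAt.mul
        (innerSL ℝ (e j)).hasFDerivAt
    simp only [h3.fderiv]
    simp only [_root_.add_apply, _root_.smul_apply, innerSL_apply_apply, he, smul_eq_mul]
    have h4 : (e j).ofLp j = 1 := by simp [e]
    have h5 : (e i).ofLp j = 0 := by simp [e, hji]
    simp only [PiLp.sub_apply, PiLp.smul_apply, smul_eq_mul, h4, h5]
    ring
  have hint : ∀ j, Integrable (fun θ : S n =>
      ((θ : E n) j * fderiv ℝ ψ θ ((θ : E n) i • e j - (θ : E n) j • e i) +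
        (θ : E n) i * ψ θ)) (sph n) := fun j =>
    integrable_of_compact (((hci j).mul (hDc.clm_apply
      (((hci i).smul continuous_const).sub ((hci j).smul continuous_const)))).add
      ((hci i).mul hψc))
  have hsum : ∫ θ : S n, ∑ j ∈ Finset.univ.erase i,
      ((θ : E n) j * fderiv ℝ ψ θ ((θ : E n) i • e j - (θ : E n) j • e i) +
        (θ : E n) i * ψ θ) ∂(sph n) = 0 := by
    rw [integral_finsetSum _ fun j _ => hint j]
    exact Finset.sum_eq_zero fun j hj' => hj j (Finset.ne_of_mem_erase hj')
  have hpt : ∀ θ : S n, ∑ j ∈ Finset.univ.erase i,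
      ((θ : E n) j * fderiv ℝ ψ θ ((θ : E n) i • e j - (θ : E n) j • e i) +
        (θ : E n) i * ψ θ) =
      ((n : ℝ) - 1) * ((θ : E n) i * ψ θ) -
        fderiv ℝ ψ θ (e i - (θ : E n) i • (θ : E n)) := by
    intro θ
    have hcard : ((Finset.univ.erase i).card : ℝ) = (n : ℝ) - 1 := by
      rw [Finset.card_erase_of_mem (Finset.mem_univ i), Finset.card_univ, Fintype.card_fin,
        Nat.cast_sub (Nat.one_le_iff_ne_zero.2 (Fin.pos i).ne')]; simp
    have h1 : ∑ j ∈ Finset.univ.erase i,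
        (θ : E n) j * fderiv ℝ ψ θ ((θ : E n) i • e j - (θ : E n) j • e i) =
        ∑ j, (θ : E n) j * fderiv ℝ ψ θ ((θ : E n) i • e j - (θ : E n) j • e i) := by
      refine Finset.sum_subset (Finset.erase_subset _ _) fun j _ hj' => ?_
      have : j = i := by simpa using hj'
      simp [this]
    have h2 : ∑ j, (θ : E n) j * fderiv ℝ ψ θ ((θ : E n) i • e j - (θ : E n) j • e i) =
        fderiv ℝ ψ θ ((θ : E n) i • ∑ j, (θ : E n) j • e j - (∑ j, (θ : E n) j ^ 2) • e i) := by
      rw [Finset.smul_sum, Finset.sum_smul, ← Finset.sum_sub_distrib, map_sum]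
      refine Finset.sum_congr rfl fun j _ => ?_
      rw [← smul_eq_mul, ← map_smul]
      congr 1
      module
    have h3 : ∑ j, (θ : E n) j ^ 2 = 1 := by
      have := EuclideanSpace.real_norm_sq_eq (θ : E n)
      rw [← this, sph_norm, one_pow]
    rw [Finset.sum_add_distrib, h1, h2, h3, sum_coord_smul_single, Finset.sum_const, nsmul_eq_mul,
      hcard, one_smul]
    simp only [map_sub]
    ring
  simp only [hpt] at hsum
  rw [integral_sub, integral_const_mul] at hsum
  · linarith
  · exact (integrable_of_compact ((hci i).mul hψc)).const_mul _
  · exact integrable_of_compact (hDc.clm_apply (by fun_prop))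

/-- The divergence theorem on the unit sphere for the tangential part of a constant vector. -/
theorem integral_sphere_tangent {U : Set (E n)} (hU : IsOpen U) (hS : ∀ θ : S n, (θ : E n) ∈ U)
    {ψ : E n → ℝ} (hψ : ContDiffOn ℝ 1 ψ U) (v : E n) :
    ∫ θ : S n, fderiv ℝ ψ θ (v - inner ℝ v (θ : E n) • (θ : E n)) ∂(sph n) =
      ((n : ℝ) - 1) * ∫ θ : S n, inner ℝ v (θ : E n) * ψ θ ∂(sph n) := by
  have hψc := continuous_sphere_of_contDiffOn hS hψ
  have hDc := continuous_sphere_fderiv hU hS hψ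
  have hin : ∀ θ : S n, inner ℝ v (θ : E n) = ∑ i, v i * (θ : E n) i := fun θ => by
    rw [PiLp.inner_apply]; simp [mul_comm]
  have h1 : ∀ θ : S n, fderiv ℝ ψ θ (v - inner ℝ v (θ : E n) • (θ : E n)) =
      ∑ i, v i * fderiv ℝ ψ θ (EuclideanSpace.single i (1 : ℝ) - (θ : E n) i • (θ : E n)) := by
    intro θ
    have : v - inner ℝ v (θ : E n) • (θ : E n) =
        ∑ i, v i • (EuclideanSpace.single i (1 : ℝ) - (θ : E n) i • (θ : E n)) := by
      simp only [smul_sub, Finset.sum_sub_distrib, sum_coord_smul_single, smul_smul,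
        ← Finset.sum_smul, hin]
    rw [this, map_sum]
    simp only [map_smul, smul_eq_mul]
  have h2 : ∀ θ : S n, inner ℝ v (θ : E n) * ψ θ = ∑ i, v i * ((θ : E n) i * ψ θ) := by
    intro θ
    rw [hin, Finset.sum_mul]
    exact Finset.sum_congr rfl fun i _ => by ring
  simp only [h1, h2]
  rw [integral_finsetSum, integral_finsetSum, Finset.mul_sum]
  · refine Finset.sum_congr rfl fun i _ => ?_
    rw [integral_const_mul, integral_const_mul, integral_sphere_tangent_single hU hS hψ]
    ring
  · intro i _
    exact integrable_of_compact (continuous_const.mul ((by fun_prop : Continuous fun θ : S n =>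
      (θ : E n) i).mul hψc))
  · intro i _
    exact integrable_of_compact (continuous_const.mul (hDc.clm_apply (by fun_prop)))

/-- `∫ ⟨v, θ⟩² = |v|² |S| / n`. -/
theorem integral_sphere_inner_sq (v : E n) :
    (n : ℝ) * ∫ θ : S n, inner ℝ v (θ : E n) ^ 2 ∂(sph n) = ‖v‖ ^ 2 * (sph n).real Set.univ := by
  have h := integral_sphere_tangent (U := Set.univ) isOpen_univ (fun _ => trivial) (ψ := fun x : E n => inner ℝ v x)
    (innerSL ℝ v).contDiff.contDiffOn v
  have h1 : ∀ θ : S n, fderiv ℝ (fun x : E n => inner ℝ v x) θ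
      (v - inner ℝ v (θ : E n) • (θ : E n)) = ‖v‖ ^ 2 - inner ℝ v (θ : E n) ^ 2 := by
    intro θ
    have : HasFDerivAt (fun x : E n => inner ℝ v x) (innerSL ℝ v) (θ : E n) :=
      (innerSL ℝ v).hasFDerivAt
    rw [this.fderiv, innerSL_apply_apply, inner_sub_right, inner_smul_right,
      real_inner_self_eq_norm_sq]
    ring
  simp only [h1] at h
  rw [integral_sub (integrable_const _) (integrable_of_compact (by fun_prop)), integral_const,
    smul_eq_mul] at h
  have h2 : ∫ θ : S n, inner ℝ v (θ : E n) * inner ℝ v (θ : E n) ∂(sph n) =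
      ∫ θ : S n, inner ℝ v (θ : E n) ^ 2 ∂(sph n) := by
    simp only [sq]
  rw [h2] at h
  linarith

/-! ### The functions cos √X and sin √X / √X -/

/-- `cos √X`, continued to negative `X` as a `C¹` function. -/
def cosRoot (X : ℝ) : ℝ := Real.cos (√X) - min X 0 / 2 + min X 0 ^ 2 / 24

/-- `sin √X / √X`, continued to negative `X` as a `C¹` function. -/
def sincRoot (X : ℝ) : ℝ := Real.sinc (√X) - min X 0 / 6

/-- The derivative of `sincRoot`. -/
def sincRootDeriv (X : ℝ) : ℝ := if X ≤ 0 then -1 / 6 else (cosRoot X - sincRoot X) / (2 * X)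

theorem continuous_cosRoot : Continuous cosRoot := by
  unfold cosRoot; fun_prop

theorem continuous_sincRoot : Continuous sincRoot := by
  unfold sincRoot
  exact (Real.continuous_sinc.comp Real.continuous_sqrt).sub (by fun_prop)

theorem cosRoot_of_nonneg {X : ℝ} (hX : 0 ≤ X) : cosRoot X = Real.cos (√X) := by
  simp [cosRoot, min_eq_right hX]

theorem sincRoot_of_pos {X : ℝ} (hX : 0 < X) : sincRoot X = Real.sin (√X) / √X := by
  simp [sincRoot, min_eq_right hX.le, Real.sinc_of_ne_zero (Real.sqrt_pos.2 hX).ne']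

theorem sincRoot_of_nonneg {X : ℝ} (hX : 0 ≤ X) : sincRoot X = Real.sinc (√X) := by
  simp [sincRoot, min_eq_right hX]

theorem cosRoot_sq_add {X : ℝ} (hX : 0 ≤ X) : cosRoot X ^ 2 + X * sincRoot X ^ 2 = 1 := by
  rcases hX.eq_or_lt with rfl | hX'
  · simp [cosRoot]
  · rw [cosRoot_of_nonneg hX, sincRoot_of_pos hX', div_pow, Real.sq_sqrt hX,
      mul_div_cancel₀ _ hX'.ne', Real.cos_sq_add_sin_sq]

theorem sincRoot_le_one {X : ℝ} (hX : 0 ≤ X) : sincRoot X ≤ 1 := by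
  rw [sincRoot_of_nonneg hX]; exact Real.sinc_le_one _

theorem abs_sincRoot_le_one {X : ℝ} (hX : 0 ≤ X) : |sincRoot X| ≤ 1 := by
  rw [sincRoot_of_nonneg hX]; exact Real.abs_sinc_le_one _

theorem abs_cosRoot_le_one {X : ℝ} (hX : 0 ≤ X) : |cosRoot X| ≤ 1 := by
  rw [cosRoot_of_nonneg hX]; exact Real.abs_cos_le_one _

theorem one_sub_le_cosRoot {X : ℝ} (hX : 0 ≤ X) : 1 - X / 2 ≤ cosRoot X := by
  rw [cosRoot_of_nonneg hX]
  have := Real.one_sub_sq_div_two_le_cos (x := √X)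
  rwa [Real.sq_sqrt hX] at this

theorem one_sub_le_sincRoot {X : ℝ} (hX : 0 ≤ X) : 1 - X / 6 ≤ sincRoot X := by
  rcases hX.eq_or_lt with rfl | hX'
  · simp [sincRoot]
  · have hs := Real.sqrt_pos.2 hX'
    have h := Real.sin_ge_sub_cube hs.le
    rw [sincRoot_of_pos hX', le_div_iff₀ hs]
    have h2 : √X ^ 3 = X * √X := by rw [pow_succ, Real.sq_sqrt hX]
    rw [h2] at h
    linarith

theorem two_mul_sincRootDeriv {X : ℝ} (hX : 0 ≤ X) :
    2 * X * sincRootDeriv X = cosRoot X - sincRoot X := by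
  rcases hX.eq_or_lt with rfl | hX'
  · simp [cosRoot, sincRoot]
  · rw [sincRootDeriv, if_neg (not_le.2 hX')]
    field_simp

/-- With `X = r²` the Taylor bounds for cosine and sine make the numerator `O(r⁴)` over the
denominator `2r³`. This gives continuity of the derivative at the gluing point. -/
theorem abs_sincRootDeriv_add_le {X : ℝ} (hX : |X| ≤ 1) :
    |sincRootDeriv X - (-1 / 6)| ≤ √|X| := by
  rcases le_or_gt X 0 with h0 | h0
  · simp [sincRootDeriv, h0]
  · rw [sincRootDeriv, if_neg (not_le.2 h0), cosRoot_of_nonneg h0.le, sincRoot_of_pos h0,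
      abs_of_pos h0]
    rw [abs_of_pos h0] at hX
    set r := √X with hr
    have hr0 : 0 < r := Real.sqrt_pos.2 h0
    have hX2 : X = r ^ 2 := (Real.sq_sqrt h0.le).symm
    have hr1 : r ≤ 1 := Real.sqrt_le_one.2 hX
    have hc := abs_le.1 (Real.cos_bound (x := r) (by rwa [abs_of_pos hr0]))
    have hs := abs_le.1 (Real.sin_bound (x := r) (by rwa [abs_of_pos hr0]))
    rw [abs_of_pos hr0] at hc hs
    have e : (Real.cos r - Real.sin r / r) / (2 * X) - -1 / 6 =
        (r * (Real.cos r - (1 - r ^ 2 / 2)) - (Real.sin r - (r - r ^ 3 / 6))) / (2 * r ^ 3) := by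
      rw [hX2]; field_simp; ring
    rw [e, abs_div, abs_of_pos (by positivity : 0 < 2 * r ^ 3), div_le_iff₀ (by positivity), abs_le]
    have h1 : r * r ^ 4 ≤ r ^ 4 := by nlinarith [pow_pos hr0 4]
    have h2 := mul_le_mul_of_nonneg_left hc.1 hr0.le
    have h3 := mul_le_mul_of_nonneg_left hc.2 hr0.le
    have h4 : r * (2 * r ^ 3) = 2 * r ^ 4 := by ring
    have h5 := pow_pos hr0 4
    rw [h4]
    constructor <;> nlinarith

theorem continuous_sincRootDeriv : Continuous sincRootDeriv := by
  rw [continuous_iff_continuousAt]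
  intro X
  rcases lt_trichotomy X 0 with h | rfl | h
  · refine (continuousAt_const (y := (-1 / 6 : ℝ))).congr ?_
    filter_upwards [gt_mem_nhds h] with Z hZ
    simp [sincRootDeriv, hZ.le]
  · have h0 : sincRootDeriv 0 = -1 / 6 := by simp [sincRootDeriv]
    rw [ContinuousAt, h0, tendsto_iff_norm_sub_tendsto_zero]
    have h1 : Tendsto (fun X : ℝ => √|X|) (𝓝 0) (𝓝 0) := by
      have : Continuous fun X : ℝ => √|X| := by fun_prop
      simpa using this.tendsto 0
    refine tendsto_of_tendsto_of_tendsto_of_le_of_le' tendsto_const_nhds h1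
      (Eventually.of_forall fun _ => norm_nonneg _) ?_
    filter_upwards [Metric.closedBall_mem_nhds (0 : ℝ) one_pos] with Z hZ
    exact abs_sincRootDeriv_add_le (by simpa using hZ)
  · have h1 : ContinuousAt (fun Z => (cosRoot Z - sincRoot Z) / (2 * Z)) X :=
      (continuous_cosRoot.continuousAt.sub continuous_sincRoot.continuousAt).div
        (by fun_prop) (by positivity)
    refine h1.congr ?_
    filter_upwards [lt_mem_nhds h] with Z hZ
    simp [sincRootDeriv, not_le.2 hZ]

/-- At the gluing point `0` the derivative is the limit of the derivatives at nearby points. -/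
theorem hasDerivAt_sincRoot (X : ℝ) : HasDerivAt sincRoot (sincRootDeriv X) X := by
  have hne : ∀ Z : ℝ, Z ≠ 0 → HasDerivAt sincRoot (sincRootDeriv Z) Z := by
    intro Z hZ
    rcases lt_or_gt_of_ne hZ with h | h
    · have h1 : HasDerivAt (fun Z : ℝ => 1 - Z / 6) (-(1 / 6)) Z :=
        ((hasDerivAt_id Z).div_const 6).const_sub 1
      rw [sincRootDeriv, if_pos h.le, neg_div]
      refine h1.congr_of_eventuallyEq ?_
      filter_upwards [gt_mem_nhds h] with W hW
      simp [sincRoot, Real.sqrt_eq_zero_of_nonpos hW.le, min_eq_left hW.le]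
    · have hs := Real.sqrt_pos.2 h
      have h0 := Real.hasDerivAt_sqrt h.ne'
      have h1 := (h0.sin).div h0 hs.ne'
      have h2 : HasDerivAt sincRoot _ Z := h1.congr_of_eventuallyEq (by
        filter_upwards [lt_mem_nhds h] with W hW
        exact sincRoot_of_pos hW)
      convert h2 using 1
      rw [sincRootDeriv, if_neg (not_le.2 h), cosRoot_of_nonneg h.le, sincRoot_of_pos h]
      have : Z = √Z ^ 2 := (Real.sq_sqrt h.le).symm
      set r := √Z
      rw [this]
      field_simp
  by_cases hX : X = 0
  · subst hX
    exact hasDerivAt_of_hasDerivAt_of_ne (fun y hy => hne y hy) continuous_sincRoot.continuousAt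
      continuous_sincRootDeriv.continuousAt
  · exact hne X hX

/-- The quadratic term in the continuation of `cosRoot` is chosen so that this one formula holds on
both sides of `0`. -/
theorem hasDerivAt_cosRoot (X : ℝ) : HasDerivAt cosRoot (-(1 / 2) * sincRoot X) X := by
  have hne : ∀ Z : ℝ, Z ≠ 0 → HasDerivAt cosRoot (-(1 / 2) * sincRoot Z) Z := by
    intro Z hZ
    rcases lt_or_gt_of_ne hZ with h | h
    · have h1 : HasDerivAt (fun Z : ℝ => 1 - Z / 2 + Z ^ 2 / 24) (-(1 / 2) + 2 * Z / 24) Z := by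
        have := (((hasDerivAt_id Z).div_const 2).const_sub 1).add
          (((hasDerivAt_pow 2 Z)).div_const 24)
        refine this.congr_deriv ?_
        push_cast; ring
      have e : -(1 / 2) * sincRoot Z = -(1 / 2) + 2 * Z / 24 := by
        simp [sincRoot, Real.sqrt_eq_zero_of_nonpos h.le, min_eq_left h.le]; ring
      rw [e]
      refine h1.congr_of_eventuallyEq ?_
      filter_upwards [gt_mem_nhds h] with W hW
      rw [cosRoot, Real.sqrt_eq_zero_of_nonpos hW.le, min_eq_left hW.le, Real.cos_zero]
    · have hs := Real.sqrt_pos.2 h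
      have h1 := (Real.hasDerivAt_sqrt h.ne').cos
      have h2 : HasDerivAt cosRoot _ Z := h1.congr_of_eventuallyEq (by
        filter_upwards [lt_mem_nhds h] with W hW
        exact cosRoot_of_nonneg (le_of_lt hW))
      convert h2 using 1
      rw [sincRoot_of_pos h]
      field_simp
  by_cases hX : X = 0
  · subst hX
    exact hasDerivAt_of_hasDerivAt_of_ne (g := fun X => -(1 / 2) * sincRoot X)
      (fun y hy => hne y hy) continuous_cosRoot.continuousAt
      (continuous_const.mul continuous_sincRoot).continuousAt
  · exact hne X hX

theorem contDiff_sincRoot : ContDiff ℝ 1 sincRoot := by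
  rw [contDiff_one_iff_deriv]
  refine ⟨fun X => (hasDerivAt_sincRoot X).differentiableAt, ?_⟩
  have : deriv sincRoot = sincRootDeriv := funext fun X => (hasDerivAt_sincRoot X).deriv
  rw [this]
  exact continuous_sincRootDeriv

/-! ### The calibrating field and its pointwise inequalities -/

/-- The squared distance from `e` to the point at distance `Y` from the origin in a direction `θ`
with `⟨e, θ⟩ = α`, where `|e| = 1`. -/
def distSq (Y α : ℝ) : ℝ := Y ^ 2 - 2 * Y * α + 1

/-- The square of the turning angle of the calibrating field. -/
def turnSq (Y α : ℝ) : ℝ := 4 * Y ^ 2 * (1 - α ^ 2) / distSq Y α ^ 2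

/-- The derivative of `turnSq` in the first variable. -/
def turnSqY (Y α : ℝ) : ℝ :=
  8 * Y * (1 - α ^ 2) / distSq Y α ^ 2 - 16 * Y ^ 2 * (1 - α ^ 2) * (Y - α) / distSq Y α ^ 3

/-- The derivative of `turnSq` in the second variable. -/
def turnSqA (Y α : ℝ) : ℝ :=
  -8 * Y ^ 2 * α / distSq Y α ^ 2 + 16 * Y ^ 3 * (1 - α ^ 2) / distSq Y α ^ 3

/-- The tangential part of the calibrating field. -/
def fieldTan (Y α : ℝ) : ℝ := Y * sincRoot (turnSq Y α)

/-- The derivative of `fieldTan` in the first variable. -/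
def fieldTanY (Y α : ℝ) : ℝ :=
  sincRoot (turnSq Y α) + Y * (sincRootDeriv (turnSq Y α) * turnSqY Y α)

/-- The derivative of `fieldTan` in the second variable. -/
def fieldTanA (Y α : ℝ) : ℝ := Y * (sincRootDeriv (turnSq Y α) * turnSqA Y α)

/-- The radial part of the calibrating field; `l = 1 / (n - 1)`. -/
def fieldRad (l Y α : ℝ) : ℝ :=
  (1 - l) * (distSq Y α - 2 / 3 * (Y / (1 + Y))) + l * (distSq Y α * cosRoot (turnSq Y α))

/-- The derivative of `fieldRad` in `Y`. -/
def fieldRadY (l Y α : ℝ) : ℝ :=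
  (1 - l) * (2 * (Y - α) - 2 / 3 * (1 / (1 + Y) ^ 2)) +
    l * (2 * (Y - α) * cosRoot (turnSq Y α) +
      distSq Y α * (-(1 / 2) * sincRoot (turnSq Y α) * turnSqY Y α))

theorem distSq_eq (Y α : ℝ) : distSq Y α = (Y - α) ^ 2 + (1 - α ^ 2) := by
  unfold distSq; ring

theorem turnSq_nonneg {Y α : ℝ} (hα : α ^ 2 ≤ 1) : 0 ≤ turnSq Y α := by
  have : 0 ≤ 1 - α ^ 2 := by linarith
  unfold turnSq; positivity

theorem distSq_nonneg {Y α : ℝ} (hα : α ^ 2 ≤ 1) : 0 ≤ distSq Y α := by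
  rw [distSq_eq]; nlinarith [sq_nonneg (Y - α)]

section deriv

variable {u v : ℝ → ℝ} {u' v' t : ℝ}

theorem hasDerivAt_distSq (hu : HasDerivAt u u' t) (hv : HasDerivAt v v' t) :
    HasDerivAt (fun t => distSq (u t) (v t)) (2 * (u t - v t) * u' - 2 * u t * v') t := by
  have h := (((hu.pow 2).sub ((hu.const_mul 2).mul hv))).add_const 1
  unfold distSq
  refine h.congr_deriv ?_
  push_cast; ring

theorem hasDerivAt_turnSq (hu : HasDerivAt u u' t) (hv : HasDerivAt v v' t)
    (hA : distSq (u t) (v t) ≠ 0) :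
    HasDerivAt (fun t => turnSq (u t) (v t))
      (turnSqY (u t) (v t) * u' + turnSqA (u t) (v t) * v') t := by
  have h1 := hasDerivAt_distSq hu hv
  have h2 := (((hu.pow 2).const_mul 4).mul ((hv.pow 2).const_sub 1)).div (h1.pow 2)
    (pow_ne_zero 2 hA)
  unfold turnSq
  refine h2.congr_deriv ?_
  simp only [turnSqY, turnSqA, Pi.pow_apply, Pi.mul_apply]
  field_simp
  push_cast
  ring

theorem hasDerivAt_fieldTan (hu : HasDerivAt u u' t) (hv : HasDerivAt v v' t)
    (hA : distSq (u t) (v t) ≠ 0) :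
    HasDerivAt (fun t => fieldTan (u t) (v t))
      (fieldTanY (u t) (v t) * u' + fieldTanA (u t) (v t) * v') t := by
  have h1 := (hasDerivAt_sincRoot (turnSq (u t) (v t))).comp t (hasDerivAt_turnSq hu hv hA)
  have h2 := hu.mul h1
  unfold fieldTan
  refine h2.congr_deriv ?_
  simp only [fieldTanY, fieldTanA, Function.comp]
  ring

theorem hasDerivAt_fieldRad (l : ℝ) (hu : HasDerivAt u u' t) {α : ℝ}
    (hA : distSq (u t) α ≠ 0) (hu1 : 1 + u t ≠ 0) :
    HasDerivAt (fun t => fieldRad l (u t) α) (fieldRadY l (u t) α * u') t := by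
  have h0 := hasDerivAt_distSq hu (hasDerivAt_const t α)
  have h1 := (hasDerivAt_cosRoot (turnSq (u t) α)).comp t
    (hasDerivAt_turnSq hu (hasDerivAt_const t α) hA)
  have h2 := ((h0.sub ((hu.div (hu.const_add 1) hu1).const_mul (2 / 3))).const_mul (1 - l)).add
    ((h0.mul h1).const_mul l)
  unfold fieldRad
  refine h2.congr_deriv ?_
  simp only [fieldRadY, Function.comp]
  field_simp
  ring

end deriv

/-- The planar part of the divergence inequality of the calibrating field. -/
theorem planar_divergence_le {Y α : ℝ} (hY : 0 < Y) (hα : α ^ 2 ≤ 1) (hA : 0 < distSq Y α) :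
    Y * (2 * (Y - α) * cosRoot (turnSq Y α) +
      distSq Y α * (-(1 / 2) * sincRoot (turnSq Y α) * turnSqY Y α)) +
      2 * α * fieldTan Y α - 2 * (1 - α ^ 2) * fieldTanA Y α ≤ 2 * Y ^ 2 := by
  set A := distSq Y α with hAdef
  set X := turnSq Y α with hX
  set C := cosRoot X
  set T := sincRoot X
  set T' := sincRootDeriv X
  have hX0 : 0 ≤ X := turnSq_nonneg hα
  have hCT : C ^ 2 + X * T ^ 2 = 1 := cosRoot_sq_add hX0
  have hT' : 2 * X * T' = C - T := two_mul_sincRootDeriv hX0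
  have hXA : X * A ^ 2 = 4 * Y ^ 2 * (1 - α ^ 2) := by
    rw [hX, turnSq, div_mul_cancel₀ _ (pow_ne_zero 2 hA.ne')]
  have hXY : A * turnSqY Y α = 2 * X * (A / Y) - 4 * X * (Y - α) := by
    rw [turnSqY, hX, turnSq, ← hAdef]; field_simp; ring
  have hs : (1 - α ^ 2) * turnSqA Y α = X * (-2 * α + 4 * Y * (1 - α ^ 2) / A) := by
    rw [turnSqA, hX, turnSq, ← hAdef]; field_simp; ring
  have hN : fieldTan Y α = Y * T := rfl
  have hNA : 2 * (1 - α ^ 2) * fieldTanA Y α =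
      Y * (C - T) * (-2 * α + 4 * Y * (1 - α ^ 2) / A) := by
    have : fieldTanA Y α = Y * (T' * turnSqA Y α) := rfl
    rw [this, ← hT']
    linear_combination 2 * Y * T' * hs
  -- The vector `Yθ - e` has radial component `Y - α` and tangential length `√(1 - α²)`. If `β` is
  -- its angle with `θ`, then `c = cos 2β` and `√X m = sin 2β`.
  set c := 1 - 2 * (1 - α ^ 2) / A with hc
  set m := (Y - α) / Y with hm
  have hc1 : c ^ 2 + X * m ^ 2 = 1 := by
    have h1 : A = (Y - α) ^ 2 + (1 - α ^ 2) := distSq_eq Y α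
    have h2 : X = 4 * Y ^ 2 * (1 - α ^ 2) / A ^ 2 := rfl
    rw [hc, hm, h2]
    field_simp
    rw [h1]
    ring
  have e : Y * (2 * (Y - α) * C + A * (-(1 / 2) * T * turnSqY Y α)) +
      2 * α * fieldTan Y α - 2 * (1 - α ^ 2) * fieldTanA Y α =
      2 * Y ^ 2 * (C * c + X * (T * m)) := by
    rw [hNA, hN]
    have h3 : A * (-(1 / 2) * T * turnSqY Y α) = -(1 / 2) * T * (A * turnSqY Y α) := by ring
    have h4 : 4 * Y ^ 2 * (1 - α ^ 2) / A = X * A := by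
      rw [div_eq_iff hA.ne', ← hXA]; ring
    have h5 : 4 * Y * (1 - α ^ 2) / A = X * A / Y := by
      rw [eq_div_iff hY.ne', ← h4]; ring
    have h6 : c = 1 - X * A / (2 * Y ^ 2) := by
      rw [hc, ← h4]; field_simp; ring
    rw [h3, hXY, h5, h6, hm]
    field_simp
    ring
  rw [e]
  -- Cauchy-Schwarz for the unit vectors `(C, √X T)` and `(c, √X m)`; the divergence is `2Y²` times
  -- their inner product.
  have h7 : C * c + X * (T * m) ≤ 1 := by
    nlinarith [sq_nonneg (C - c), mul_nonneg hX0 (sq_nonneg (T - m))]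
  nlinarith [sq_nonneg Y]

/-- The part of the radial field with weight `1 - l` is not turned, whereas the zeroth-order term of
the tangential field enters the divergence with full weight. The right side, which is the derivative
of the correction `2/3 · Y/(1+Y)` in `fieldRad`, pays for this mismatch. Only `α < 0` is at stake,
and there `1 - T ≤ X/6` suffices. -/
theorem correction_bound {Y α : ℝ} (hY : 0 < Y) (hα : α ^ 2 ≤ 1) :
    -2 * α * (1 - sincRoot (turnSq Y α)) ≤ 2 / 3 * (1 / (1 + Y) ^ 2) := by
  have hX0 : 0 ≤ turnSq Y α := turnSq_nonneg hα
  have h1 := sincRoot_le_one hX0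
  have h2 := one_sub_le_sincRoot hX0
  have hα1 := abs_le_one_iff_mul_self_le_one.2 (by nlinarith : α * α ≤ 1)
  rw [abs_le] at hα1
  rcases le_or_gt 0 α with h | h
  · have : 0 ≤ 2 / 3 * (1 / (1 + Y) ^ 2) := by positivity
    nlinarith
  · obtain ⟨t, rfl⟩ : ∃ t, α = -t := ⟨-α, by ring⟩
    have ht : 0 < t := by linarith
    have ht1 : t ≤ 1 := by linarith
    have h3 : -2 * -t * (1 - sincRoot (turnSq Y (-t))) ≤ 2 * t * (turnSq Y (-t) / 6) := by
      nlinarith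
    refine h3.trans ?_
    have hA : 0 < distSq Y (-t) := by unfold distSq; nlinarith [mul_pos hY ht, sq_nonneg Y]
    rw [turnSq]
    set A := distSq Y (-t) with hAdef
    -- `g` is the arithmetic mean of `2t` and `1 - t²`, so `g²` dominates their product.
    set g := (1 + 2 * t - t ^ 2) / 2 with hg
    have hg0 : 0 ≤ g := by rw [hg]; nlinarith
    have h4 : 2 * t * (1 - t ^ 2) ≤ g ^ 2 := by rw [hg]; nlinarith [sq_nonneg (2 * t - (1 - t ^ 2))]
    have h5 : g * (Y * (1 + Y)) ≤ A := by
      rw [hg, hAdef, distSq]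
      nlinarith [sq_nonneg ((1 - t) * Y - 1 / 2), mul_pos hY ht, mul_pos (mul_pos hY ht) ht]
    have h6 : (g * (Y * (1 + Y))) ^ 2 ≤ A ^ 2 := pow_le_pow_left₀ (by positivity) h5 2
    have h7 : 2 * t * (1 - t ^ 2) * (Y * (1 + Y)) ^ 2 ≤ A ^ 2 := by
      refine le_trans ?_ h6
      rw [mul_pow g]
      exact mul_le_mul_of_nonneg_right h4 (by positivity)
    have e : 2 * t * (4 * Y ^ 2 * (1 - (-t) ^ 2) / A ^ 2 / 6) =
        2 / 3 * ((2 * t * (1 - t ^ 2) * Y ^ 2) / A ^ 2) := by field_simp; ring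
    rw [e]
    refine mul_le_mul_of_nonneg_left ?_ (by norm_num)
    rw [div_le_div_iff₀ (by positivity) (by positivity)]
    nlinarith

/-- The divergence inequality of the calibrating field. -/
theorem field_divergence_le {l Y α : ℝ} (hl0 : 0 ≤ l) (hl1 : l ≤ 1) (hY : 0 < Y) (hα : α ^ 2 ≤ 1)
    (hA : 0 < distSq Y α) :
    Y * fieldRadY l Y α + 2 * α * fieldTan Y α - 2 * l * (1 - α ^ 2) * fieldTanA Y α ≤
      2 * Y ^ 2 := by
  have h1 := planar_divergence_le hY hα hA
  have h2 := correction_bound hY hα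
  have h3 : Y * (2 * (Y - α) - 2 / 3 * (1 / (1 + Y) ^ 2)) + 2 * α * fieldTan Y α ≤ 2 * Y ^ 2 := by
    rw [fieldTan]
    nlinarith [mul_le_mul_of_nonneg_left h2 hY.le]
  have h4 := mul_le_mul_of_nonneg_left h1 hl0
  have h5 := mul_le_mul_of_nonneg_left h3 (sub_nonneg.2 hl1)
  rw [fieldRadY]
  linarith

/-- The calibrating field is bounded by the integrand: Cauchy-Schwarz. -/
theorem field_le {l Y α d w : ℝ} (hl0 : 0 ≤ l) (hl1 : l ≤ 1) (hY : 0 < Y) (hα : α ^ 2 ≤ 1)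
    (hw : 0 ≤ w) (hd : d ^ 2 ≤ (1 - α ^ 2) * w) :
    fieldRad l Y α + 2 * l * fieldTan Y α * d ≤ distSq Y α * √(1 + l * w) := by
  have hA := distSq_nonneg (Y := Y) hα
  have hX0 : 0 ≤ turnSq Y α := turnSq_nonneg hα
  have hCT := cosRoot_sq_add hX0
  have hP : fieldRad l Y α ≤ distSq Y α * ((1 - l) + l * cosRoot (turnSq Y α)) := by
    have h1 : 0 ≤ (1 - l) * (2 / 3 * (Y / (1 + Y))) :=
      mul_nonneg (by linarith) (by positivity)
    unfold fieldRad
    linarith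
  -- Vanishing distance forces `α² = 1`, so the tangential derivative `d` vanishes too.
  rcases hA.eq_or_lt with h0 | hpos
  · have h1 := distSq_eq Y α
    have h2 : 1 - α ^ 2 = 0 := by nlinarith [sq_nonneg (Y - α)]
    have h3 : d = 0 := by
      rw [h2, zero_mul] at hd
      exact pow_eq_zero_iff two_ne_zero |>.1 (le_antisymm hd (sq_nonneg d))
    rw [← h0] at hP ⊢
    rw [h3]
    linarith
  have hXA : turnSq Y α * distSq Y α ^ 2 = 4 * Y ^ 2 * (1 - α ^ 2) := by
    rw [turnSq, div_mul_cancel₀ _ (pow_ne_zero 2 hpos.ne')]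
  rw [fieldTan]
  set A := distSq Y α
  set X := turnSq Y α
  set C := cosRoot X
  set T := sincRoot X
  have hC : 0 ≤ l * (1 - C ^ 2) := mul_nonneg hl0 (by nlinarith [mul_nonneg hX0 (sq_nonneg T)])
  have hlw : 0 ≤ l * w := mul_nonneg hl0 hw
  set D := √(l * w)
  set G := √(l * (1 - C ^ 2))
  have hD : D ^ 2 = l * w := Real.sq_sqrt hlw
  have hG : G ^ 2 = l * (1 - C ^ 2) := Real.sq_sqrt hC
  have hQ : 2 * l * (Y * T) * d ≤ A * (G * D) := by
    refine le_of_abs_le (abs_le_of_sq_le_sq ?_ (by positivity))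
    have e1 : (A * (G * D)) ^ 2 = l ^ 2 * T ^ 2 * (X * A ^ 2) * w := by
      rw [mul_pow, mul_pow, hG, hD, show 1 - C ^ 2 = X * T ^ 2 by linarith]; ring
    rw [e1, hXA]
    have := mul_le_mul_of_nonneg_left hd (by positivity : 0 ≤ 4 * l ^ 2 * Y ^ 2 * T ^ 2)
    nlinarith
  -- Cauchy-Schwarz against `(1, D)`: the vector `((1 - l) + lC, G)` has squared length `1 - l(1 -
  -- l)(1 - C)²`.
  have hB : ((1 - l) + l * C) + G * D ≤ √(1 + l * w) := by
    refine Real.le_sqrt_of_sq_le ?_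
    have h1 : ((1 - l) + l * C) ^ 2 + G ^ 2 ≤ 1 := by
      rw [hG]
      nlinarith [mul_nonneg (mul_nonneg hl0 (sub_nonneg.2 hl1)) (sq_nonneg (1 - C))]
    have h2 := mul_le_mul_of_nonneg_right h1 (by positivity : 0 ≤ 1 + D ^ 2)
    rw [← hD]
    nlinarith [sq_nonneg (((1 - l) + l * C) * D - G)]
  nlinarith [mul_le_mul_of_nonneg_left hB hA]

/-! ### Scaling the calibrated integral: the weighted inequality on the sphere -/

theorem distSq_sphere_pos {e : E n} (he : ‖e‖ = 1) {θ : S n} {Y : ℝ} (hY : 0 < Y)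
    (hne : (θ : E n) = e → Y ≠ 1) : 0 < distSq Y (inner ℝ e (θ : E n)) := by
  have hα : |inner ℝ e (θ : E n)| ≤ 1 := by
    simpa [he, sph_norm] using abs_real_inner_le_norm e (θ : E n)
  rw [abs_le] at hα
  by_cases h : inner ℝ e (θ : E n) = 1
  · have h1 : (θ : E n) = e := ((inner_eq_one_iff_of_norm_eq_one he (sph_norm θ)).1 h).symm
    rw [h, distSq]
    have : Y - 1 ≠ 0 := sub_ne_zero.2 (hne h1)
    have : 0 < (Y - 1) ^ 2 := by positivity
    linarith
  · have h1 : inner ℝ e (θ : E n) < 1 := lt_of_le_of_ne hα.2 h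
    rw [distSq]
    nlinarith [sq_nonneg (Y - 1), mul_pos hY (sub_pos.2 h1)]

theorem sq_inner_sphere_le {e : E n} (he : ‖e‖ = 1) (θ : S n) :
    inner ℝ e (θ : E n) ^ 2 ≤ 1 := by
  have hα : |inner ℝ e (θ : E n)| ≤ 1 := by
    simpa [he, sph_norm] using abs_real_inner_le_norm e (θ : E n)
  rw [abs_le] at hα
  nlinarith

/-- The tangential part of `e` at a point of the sphere. -/
def tang (e θ : E n) : E n := e - inner ℝ e θ • θ

theorem norm_tang_sq {e : E n} (he : ‖e‖ = 1) (θ : S n) :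
    ‖tang e (θ : E n)‖ ^ 2 = 1 - inner ℝ e (θ : E n) ^ 2 := by
  rw [tang, norm_sub_sq_real, he, inner_smul_right, norm_smul, sph_norm]
  simp
  ring

theorem norm_sub_sq_eq_distSq {e : E n} (he : ‖e‖ = 1) (θ : S n) (Y : ℝ) :
    ‖Y • (θ : E n) - e‖ ^ 2 = distSq Y (inner ℝ e (θ : E n)) := by
  rw [norm_sub_sq_real, norm_smul, sph_norm, he, inner_smul_left, real_inner_comm, distSq]
  simp
  ring

/-- The calibrating integrand. -/
def calib (l : ℝ) (e : E n) (y : E n → ℝ) (μ : ℝ) (θ : S n) : ℝ :=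
  fieldRad l (μ * y θ) (inner ℝ e (θ : E n)) +
    2 * l * (μ * sincRoot (turnSq (μ * y θ) (inner ℝ e (θ : E n)))) *
      fderiv ℝ y θ (tang e θ) - μ ^ 2 * y θ ^ 2

/-- The derivative of `calib` in `μ`. -/
def calibDeriv (l : ℝ) (e : E n) (y : E n → ℝ) (μ : ℝ) (θ : S n) : ℝ :=
  fieldRadY l (μ * y θ) (inner ℝ e (θ : E n)) * y θ +
    2 * l * fieldTanY (μ * y θ) (inner ℝ e (θ : E n)) *
      fderiv ℝ y θ (tang e θ) - 2 * μ * y θ ^ 2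

theorem hasDerivAt_calib (l : ℝ) (e : E n) (y : E n → ℝ) {μ : ℝ} (hμ : 0 < μ) (θ : S n)
    (hy : 0 < y θ) (hA : distSq (μ * y θ) (inner ℝ e (θ : E n)) ≠ 0) :
    HasDerivAt (fun μ => calib l e y μ θ) (calibDeriv l e y μ θ) μ := by
  have h1 : HasDerivAt (fun μ => μ * y θ) (y θ) μ := by
    simpa using (hasDerivAt_id μ).mul_const (y θ)
  have h2 := hasDerivAt_fieldRad l h1 hA (by positivity)
  have h3 := (hasDerivAt_sincRoot _).comp μ
    (hasDerivAt_turnSq h1 (hasDerivAt_const μ (inner ℝ e (θ : E n))) hA)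
  have h4 := ((h2.add (((hasDerivAt_id μ).mul h3).const_mul (2 * l) |>.mul_const
    (fderiv ℝ y θ (tang e θ)))).sub ((hasDerivAt_pow 2 μ).mul_const (y θ ^ 2)))
  unfold calib
  refine h4.congr_deriv ?_
  simp only [calibDeriv, fieldTanY, Function.comp, id]
  push_cast
  ring

theorem sphere_continuous_data {y : E n → ℝ} (hy : ContDiffOn ℝ 1 y {0}ᶜ) (e : E n) :
    Continuous (fun θ : S n => y θ) ∧ Continuous (fun θ : S n => inner ℝ e (θ : E n)) ∧
      Continuous (fun θ : S n => fderiv ℝ y θ (tang e θ)) := by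
  have hS : ∀ θ : S n, (θ : E n) ∈ ({0}ᶜ : Set (E n)) := fun θ => sph_ne_zero θ
  refine ⟨continuous_sphere_of_contDiffOn hS hy, by fun_prop, ?_⟩
  have h1 := continuous_sphere_fderiv isOpen_compl_singleton hS hy
  have h2 : Continuous fun θ : S n => tang e (θ : E n) := by unfold tang; fun_prop
  exact h1.clm_apply h2

/-- The divergence theorem for `x ↦ fieldTan (μ y x) ⟨e, x⟩` in the direction `e`, with the chain
rule carried out. It removes the derivative of `y` from the derivative of the calibrated integral.
-/
theorem integral_fieldTanY {y : E n → ℝ} (hy : ContDiffOn ℝ 1 y {0}ᶜ) {e : E n} (he : ‖e‖ = 1)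
    {μ : ℝ}
    (hA : ∀ θ : S n, 0 < distSq (μ * y θ) (inner ℝ e (θ : E n))) :
    ∫ θ : S n, (fieldTanY (μ * y θ) (inner ℝ e (θ : E n)) * (μ * fderiv ℝ y θ (tang e θ)) +
      fieldTanA (μ * y θ) (inner ℝ e (θ : E n)) * (1 - inner ℝ e (θ : E n) ^ 2)) ∂(sph n) =
    ((n : ℝ) - 1) * ∫ θ : S n, inner ℝ e (θ : E n) *
      fieldTan (μ * y θ) (inner ℝ e (θ : E n)) ∂(sph n) := by
  set f : E n → ℝ := fun x => distSq (μ * y x) (inner ℝ e x) with hf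
  have hfc : ContDiffOn ℝ 1 f {0}ᶜ := by
    have h1 : ContDiffOn ℝ 1 (fun x : E n => inner ℝ e x) {0}ᶜ :=
      (innerSL ℝ e).contDiff.contDiffOn
    have h2 : ContDiffOn ℝ 1 (fun x => μ * y x) {0}ᶜ := contDiffOn_const.mul hy
    exact (((h2.pow 2).sub ((contDiffOn_const.mul h2).mul h1)).add contDiffOn_const)
  -- The field must be `C¹` on an open neighbourhood of the sphere. There `1 - ⟨e, x⟩²` may be
  -- negative, which is why `sincRoot` is continued past `0`.
  set U : Set (E n) := {0}ᶜ ∩ f ⁻¹' {0}ᶜ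
  have hU : IsOpen U := hfc.continuousOn.isOpen_inter_preimage isOpen_compl_singleton
    isOpen_compl_singleton
  have hS : ∀ θ : S n, (θ : E n) ∈ U := fun θ => ⟨sph_ne_zero θ, (hA θ).ne'⟩
  have hψ : ContDiffOn ℝ 1 (fun x : E n => fieldTan (μ * y x) (inner ℝ e x)) U := by
    have h1 : ContDiffOn ℝ 1 (fun x : E n => inner ℝ e x) U :=
      (innerSL ℝ e).contDiff.contDiffOn
    have h2 : ContDiffOn ℝ 1 (fun x => μ * y x) U :=
      contDiffOn_const.mul (hy.mono Set.inter_subset_left)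
    refine h2.mul (contDiff_sincRoot.comp_contDiffOn ?_)
    refine ContDiffOn.div ((contDiffOn_const.mul (h2.pow 2)).mul (contDiffOn_const.sub (h1.pow 2)))
      ((hfc.mono Set.inter_subset_left).pow 2) ?_
    intro x hx
    exact pow_ne_zero 2 hx.2
  rw [← integral_sphere_tangent hU hS hψ e]
  refine integral_congr_ae (Eventually.of_forall fun θ => ?_)
  simp only
  have hd : DifferentiableAt ℝ y (θ : E n) :=
    (hy.differentiableOn (by simp)).differentiableAt
      (isOpen_compl_singleton.mem_nhds (sph_ne_zero θ))
  have hline : HasDerivAt (fun t : ℝ => (θ : E n) + t • tang e θ) (tang e θ) 0 := by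
    simpa using ((hasDerivAt_id (0 : ℝ)).smul_const (tang e (θ : E n))).const_add (θ : E n)
  have e0 : (θ : E n) + (0 : ℝ) • tang e θ = θ := by simp
  have hu : HasDerivAt (fun t : ℝ => μ * y ((θ : E n) + t • tang e θ))
      (μ * fderiv ℝ y θ (tang e θ)) 0 := by
    refine HasDerivAt.const_mul μ ?_
    exact HasFDerivAt.comp_hasDerivAt (0 : ℝ) (by rw [e0]; exact hd.hasFDerivAt) hline
  have hv : HasDerivAt (fun t : ℝ => inner ℝ e ((θ : E n) + t • tang e θ))
      (1 - inner ℝ e (θ : E n) ^ 2) 0 := by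
    have h1 : HasDerivAt (fun t : ℝ => inner ℝ e ((θ : E n) + t • tang e θ))
        (innerSL ℝ e (tang e (θ : E n))) 0 :=
      (innerSL ℝ e).hasFDerivAt.comp_hasDerivAt (0 : ℝ) hline
    refine h1.congr_deriv ?_
    rw [innerSL_apply_apply, tang, inner_sub_right, inner_smul_right,
      real_inner_self_eq_norm_sq, he]
    ring
  have h1 := hasDerivAt_fieldTan hu hv (by simp only [e0]; exact (hA θ).ne')
  have h2 : HasDerivAt (fun t : ℝ => fieldTan (μ * y ((θ : E n) + t • tang e θ))
      (inner ℝ e ((θ : E n) + t • tang e θ)))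
      (fderiv ℝ (fun x : E n => fieldTan (μ * y x) (inner ℝ e x)) θ (tang e θ)) 0 := by
    have hdψ := ((hψ.differentiableOn (by simp)).differentiableAt
      (hU.mem_nhds (hS θ))).hasFDerivAt
    exact HasFDerivAt.comp_hasDerivAt (0 : ℝ)
      (l := fun x : E n => fieldTan (μ * y x) (inner ℝ e x)) (by rw [e0]; exact hdψ) hline
  have h3 := h1.unique h2
  simp only [e0] at h3
  exact h3

/-- After multiplication by `μ` and integration by parts, the derivative of the integral is that of
the expression bounded in `field_divergence_le`, which no longer contains the derivative of `y` and
is pointwise nonpositive. The excluded `μ` is the one at which the surface `μ y(θ) θ` passes through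
`e`, where the field is singular. -/
theorem hasDerivAt_integral_calib {y : E n → ℝ} (hy : ContDiffOn ℝ 1 y {0}ᶜ)
    (hpos : ∀ θ : S n, 0 < y θ) {e : E n} (he : ‖e‖ = 1) (hn : 2 ≤ n) {μ : ℝ} (hμ : 0 < μ) (hμe : μ * y e ≠ 1) :
    ∃ D ≤ 0, HasDerivAt (fun μ => ∫ θ, calib (1 / ((n : ℝ) - 1)) e y μ θ ∂(sph n)) D μ := by
  have hn1 : (0 : ℝ) < (n : ℝ) - 1 := by
    have : (2 : ℝ) ≤ n := by exact_mod_cast hn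
    linarith
  set l : ℝ := 1 / ((n : ℝ) - 1) with hl
  have hl0 : 0 ≤ l := by positivity
  have hl1 : l ≤ 1 := by
    rw [hl, div_le_one hn1]
    have : (2 : ℝ) ≤ n := by exact_mod_cast hn
    linarith
  obtain ⟨cy, ci, cD⟩ := sphere_continuous_data hy e
  set U : Set ℝ := {μ | 0 < μ} ∩ {μ | μ * y e ≠ 1} with hUdef
  have hU : IsOpen U := (isOpen_lt continuous_const continuous_id).inter
    (isOpen_ne_fun (by fun_prop) continuous_const)
  have hA : ∀ μ ∈ U, ∀ θ : S n, 0 < distSq (μ * y θ) (inner ℝ e (θ : E n)) := by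
    intro μ hμ θ
    refine distSq_sphere_pos he (mul_pos hμ.1 (hpos θ)) fun h => ?_
    rw [h]; exact hμ.2
  have cc : Continuous cosRoot := continuous_cosRoot
  have cs : Continuous sincRoot := continuous_sincRoot
  have cs' : Continuous sincRootDeriv := continuous_sincRootDeriv
  have hY : ContinuousOn (fun p : ℝ × S n => p.1 * y p.2) (U ×ˢ Set.univ) :=
    (continuous_fst.mul (cy.comp continuous_snd)).continuousOn
  have hα : ContinuousOn (fun p : ℝ × S n => inner ℝ e (p.2 : E n)) (U ×ˢ Set.univ) :=
    (ci.comp continuous_snd).continuousOn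
  have hyc : ContinuousOn (fun p : ℝ × S n => y p.2) (U ×ˢ Set.univ) :=
    (cy.comp continuous_snd).continuousOn
  have hDc : ContinuousOn (fun p : ℝ × S n => fderiv ℝ y p.2 (tang e p.2)) (U ×ˢ Set.univ) :=
    (cD.comp continuous_snd).continuousOn
  have hdist : ContinuousOn (fun p : ℝ × S n => distSq (p.1 * y p.2) (inner ℝ e (p.2 : E n)))
      (U ×ˢ Set.univ) := by
    unfold distSq
    exact (((hY.pow 2).sub ((continuousOn_const.mul hY).mul hα)).add continuousOn_const)
  have hne : ∀ k : ℕ, ∀ p ∈ U ×ˢ (Set.univ : Set (S n)),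
      distSq (p.1 * y p.2) (inner ℝ e (p.2 : E n)) ^ k ≠ 0 :=
    fun k p hp => pow_ne_zero k (hA p.1 hp.1 p.2).ne'
  have hs : ContinuousOn (fun p : ℝ × S n => 1 - inner ℝ e (p.2 : E n) ^ 2) (U ×ˢ Set.univ) :=
    continuousOn_const.sub (hα.pow 2)
  have hturn : ContinuousOn (fun p : ℝ × S n => turnSq (p.1 * y p.2) (inner ℝ e (p.2 : E n)))
      (U ×ˢ Set.univ) := by
    unfold turnSq
    exact ((continuousOn_const.mul (hY.pow 2)).mul hs).div (hdist.pow 2) (hne 2)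
  have hturnY : ContinuousOn (fun p : ℝ × S n => turnSqY (p.1 * y p.2) (inner ℝ e (p.2 : E n)))
      (U ×ˢ Set.univ) := by
    unfold turnSqY
    exact (((continuousOn_const.mul hY).mul hs).div (hdist.pow 2) (hne 2)).sub
      ((((continuousOn_const.mul (hY.pow 2)).mul hs).mul (hY.sub hα)).div (hdist.pow 3) (hne 3))
  have hturnA : ContinuousOn (fun p : ℝ × S n => turnSqA (p.1 * y p.2) (inner ℝ e (p.2 : E n)))
      (U ×ˢ Set.univ) := by
    unfold turnSqA
    exact (((continuousOn_const.mul (hY.pow 2)).mul hα).div (hdist.pow 2) (hne 2)).add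
      (((continuousOn_const.mul (hY.pow 3)).mul hs).div (hdist.pow 3) (hne 3))
  have hfT : ContinuousOn (fun p : ℝ × S n => fieldTan (p.1 * y p.2) (inner ℝ e (p.2 : E n)))
      (U ×ˢ Set.univ) := hY.mul (cs.comp_continuousOn hturn)
  have hfTY : ContinuousOn (fun p : ℝ × S n => fieldTanY (p.1 * y p.2) (inner ℝ e (p.2 : E n)))
      (U ×ˢ Set.univ) :=
    (cs.comp_continuousOn hturn).add (hY.mul ((cs'.comp_continuousOn hturn).mul hturnY))
  have hfTA : ContinuousOn (fun p : ℝ × S n => fieldTanA (p.1 * y p.2) (inner ℝ e (p.2 : E n)))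
      (U ×ˢ Set.univ) := hY.mul ((cs'.comp_continuousOn hturn).mul hturnA)
  have hY1 : ∀ p ∈ U ×ˢ (Set.univ : Set (S n)), 1 + p.1 * y p.2 ≠ 0 := fun p hp => by
    have := mul_pos hp.1.1 (hpos p.2)
    positivity
  have hfR : ContinuousOn (fun p : ℝ × S n => fieldRad l (p.1 * y p.2) (inner ℝ e (p.2 : E n)))
      (U ×ˢ Set.univ) := by
    unfold fieldRad
    exact (continuousOn_const.mul (hdist.sub (continuousOn_const.mul
      (hY.div (continuousOn_const.add hY) hY1)))).add
      (continuousOn_const.mul (hdist.mul (cc.comp_continuousOn hturn)))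
  have hfRY : ContinuousOn (fun p : ℝ × S n => fieldRadY l (p.1 * y p.2) (inner ℝ e (p.2 : E n)))
      (U ×ˢ Set.univ) := by
    unfold fieldRadY
    exact (continuousOn_const.mul ((continuousOn_const.mul (hY.sub hα)).sub
      (continuousOn_const.mul (continuousOn_const.div ((continuousOn_const.add hY).pow 2)
        fun p hp => pow_ne_zero 2 (hY1 p hp))))).add
      (continuousOn_const.mul (((continuousOn_const.mul (hY.sub hα)).mul
        (cc.comp_continuousOn hturn)).add (hdist.mul
          ((continuousOn_const.mul (cs.comp_continuousOn hturn)).mul hturnY))))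
  have slice : ∀ {f : ℝ × S n → ℝ}, ContinuousOn f (U ×ˢ Set.univ) → ∀ μ ∈ U,
      Continuous fun θ => f (μ, θ) := by
    intro f hf μ hμ
    rw [← continuousOn_univ]
    exact hf.comp (f := fun θ => (μ, θ)) (by fun_prop) fun θ _ => ⟨hμ, trivial⟩
  have hμU : μ ∈ U := ⟨hμ, hμe⟩
  have hmain := hasDerivAt_integral_of_compact (μ := sph n) hU (f := calib l e y)
    (f' := calibDeriv l e y)
    (fun μ hμ => by
      unfold calib
      exact ((slice hfR μ hμ).add ((continuous_const.mul (continuous_const.mul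
        (slice (cs.comp_continuousOn hturn) μ hμ))).mul cD)).sub
        (continuous_const.mul (cy.pow 2)))
    (by
      unfold calibDeriv
      exact ((hfRY.mul hyc).add ((continuousOn_const.mul hfTY).mul hDc)).sub
        ((continuousOn_const.mul continuousOn_fst).mul (hyc.pow 2)))
    (fun μ hμ θ => hasDerivAt_calib l e y hμ.1 θ (hpos θ) (hA μ hμ θ).ne') hμU
  refine ⟨_, ?_, hmain⟩
  have hnull := integral_fieldTanY hy he (hA μ hμU)
  have i1 : Integrable (fun θ : S n => fieldTanY (μ * y θ) (inner ℝ e (θ : E n)) *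
      (μ * fderiv ℝ y θ (tang e θ)) +
      fieldTanA (μ * y θ) (inner ℝ e (θ : E n)) * (1 - inner ℝ e (θ : E n) ^ 2)) (sph n) :=
    integrable_of_compact (((slice hfTY μ hμU).mul (continuous_const.mul cD)).add
      ((slice hfTA μ hμU).mul (slice hs μ hμU)))
  have i2 : Integrable (fun θ : S n => inner ℝ e (θ : E n) *
      fieldTan (μ * y θ) (inner ℝ e (θ : E n))) (sph n) :=
    integrable_of_compact (ci.mul (slice hfT μ hμU))
  have i3 : Integrable (fun θ : S n => fieldRadY l (μ * y θ) (inner ℝ e (θ : E n)) * (μ * y θ) -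
      2 * (μ * y θ) ^ 2 - 2 * l * (fieldTanA (μ * y θ) (inner ℝ e (θ : E n)) *
        (1 - inner ℝ e (θ : E n) ^ 2))) (sph n) :=
    integrable_of_compact ((((slice hfRY μ hμU).mul (continuous_const.mul cy)).sub
      (continuous_const.mul ((continuous_const.mul cy).pow 2))).sub
      (continuous_const.mul ((slice hfTA μ hμU).mul (slice hs μ hμU))))
  have e1 : μ * ∫ θ, calibDeriv l e y μ θ ∂(sph n) =
      ∫ θ : S n, (fieldRadY l (μ * y θ) (inner ℝ e (θ : E n)) * (μ * y θ) -
      2 * (μ * y θ) ^ 2 - 2 * l * (fieldTanA (μ * y θ) (inner ℝ e (θ : E n)) *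
        (1 - inner ℝ e (θ : E n) ^ 2))) ∂(sph n) +
      2 * l * ((n : ℝ) - 1) * ∫ θ : S n, inner ℝ e (θ : E n) *
        fieldTan (μ * y θ) (inner ℝ e (θ : E n)) ∂(sph n) := by
    rw [mul_assoc (2 * l), ← hnull, ← integral_const_mul, ← integral_const_mul, ← integral_add i3
      (i1.const_mul _)]
    refine integral_congr_ae (Eventually.of_forall fun θ => ?_)
    simp only [calibDeriv]
    ring
  -- The weight `l = 1/(n-1)` cancels the factor `n - 1` from the divergence theorem.
  have e2 : 2 * l * ((n : ℝ) - 1) = 2 := by rw [hl]; field_simp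
  rw [e2, ← integral_const_mul (2 : ℝ), ← integral_add i3 (i2.const_mul _)] at e1
  have e3 : μ * ∫ θ, calibDeriv l e y μ θ ∂(sph n) ≤ 0 := by
    rw [e1]
    refine integral_nonpos fun θ => ?_
    have := field_divergence_le hl0 hl1 (mul_pos hμ (hpos θ)) (sq_inner_sphere_le he θ)
      (hA μ hμU θ)
    simp only [Pi.zero_apply]
    linarith
  exact nonpos_of_mul_nonpos_right e3 hμ

theorem measurable_calib (l : ℝ) (e : E n) {y : E n → ℝ} (hy : ContDiffOn ℝ 1 y {0}ᶜ) (μ : ℝ) :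
    Measurable (calib l e y μ) := by
  obtain ⟨cy, ci, cD⟩ := sphere_continuous_data hy e
  have my := cy.measurable
  have mi := ci.measurable
  have mD := cD.measurable
  have mY : Measurable fun θ : S n => μ * y θ := my.const_mul μ
  have md : Measurable fun θ : S n => distSq (μ * y θ) (inner ℝ e (θ : E n)) := by
    unfold distSq
    exact ((mY.pow_const 2).sub ((mY.const_mul 2).mul mi)).add_const 1
  have mt : Measurable fun θ : S n => turnSq (μ * y θ) (inner ℝ e (θ : E n)) := by
    unfold turnSq
    exact (((mY.pow_const 2).const_mul 4).mul ((mi.pow_const 2).const_sub 1)).div (md.pow_const 2)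
  unfold calib fieldRad
  exact ((((md.sub ((mY.div (mY.const_add 1)).const_mul (2 / 3))).const_mul (1 - l)).add
    ((md.mul (continuous_cosRoot.measurable.comp mt)).const_mul l)).add
    ((((continuous_sincRoot.measurable.comp mt).const_mul μ).const_mul (2 * l)).mul mD)).sub
    ((my.pow_const 2).const_mul (μ ^ 2))

/-- A continuous majorant, uniform in `μ ≤ Λ` and valid at the singular value too, since the turned
components are bounded by `1`. It serves both integrability and dominated convergence. -/
theorem abs_calib_le {l : ℝ} (hl0 : 0 ≤ l) (hl1 : l ≤ 1) {e : E n} (he : ‖e‖ = 1) (y : E n → ℝ)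
    {μ Λ : ℝ} (hμ : 0 ≤ μ) (hμΛ : μ ≤ Λ) (θ : S n) (hy : 0 < y θ) :
    |calib l e y μ θ| ≤ 2 * (Λ * y θ + 1) ^ 2 + 1 + 2 * Λ * |fderiv ℝ y θ (tang e θ)| +
      (Λ * y θ) ^ 2 := by
  have hα := sq_inner_sphere_le he θ
  set α := inner ℝ e (θ : E n)
  have hα1 := abs_le.1 (abs_le_one_iff_mul_self_le_one.2 (by nlinarith : α * α ≤ 1))
  set Y := μ * y θ with hY
  have hY0 : 0 ≤ Y := by positivity
  have hYΛ : Y ≤ Λ * y θ := mul_le_mul_of_nonneg_right hμΛ hy.le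
  have hX0 := turnSq_nonneg (Y := Y) hα
  have hA0 := distSq_nonneg (Y := Y) hα
  have hA1 : distSq Y α ≤ (Λ * y θ + 1) ^ 2 := by
    rw [distSq]; nlinarith [mul_nonneg hY0 (by linarith : 0 ≤ 1 + α)]
  have hC := abs_cosRoot_le_one hX0
  have hT := abs_sincRoot_le_one hX0
  have hε0 : 0 ≤ Y / (1 + Y) := by positivity
  have hε1 : Y / (1 + Y) ≤ 1 := by rw [div_le_one (by positivity)]; linarith
  have h1 : |fieldRad l Y α| ≤ 2 * (Λ * y θ + 1) ^ 2 + 1 := by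
    have h2 : |distSq Y α * cosRoot (turnSq Y α)| ≤ (Λ * y θ + 1) ^ 2 := by
      rw [abs_mul, abs_of_nonneg hA0]
      nlinarith [abs_nonneg (cosRoot (turnSq Y α))]
    rw [abs_le] at h2 ⊢
    rw [fieldRad]
    constructor <;> nlinarith [mul_nonneg hl0 hA0, mul_nonneg (sub_nonneg.2 hl1) hA0,
      mul_nonneg (sub_nonneg.2 hl1) hε0, mul_nonneg (sub_nonneg.2 hl1) (sub_nonneg.2 hε1)]
  have h3 : |2 * l * (μ * sincRoot (turnSq Y α)) * fderiv ℝ y θ (tang e θ)| ≤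
      2 * Λ * |fderiv ℝ y θ (tang e θ)| := by
    rw [abs_mul]
    refine mul_le_mul_of_nonneg_right ?_ (abs_nonneg _)
    rw [abs_mul, abs_mul μ, abs_of_nonneg (by positivity : 0 ≤ 2 * l), abs_of_nonneg hμ]
    have hΛ0 : 0 ≤ Λ := hμ.trans hμΛ
    calc 2 * l * (μ * |sincRoot (turnSq Y α)|) ≤ 2 * 1 * (Λ * 1) := by gcongr
      _ = 2 * Λ := by ring
  have h4 : |μ ^ 2 * y θ ^ 2| ≤ (Λ * y θ) ^ 2 := by
    rw [← mul_pow, abs_of_nonneg (by positivity)]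
    exact pow_le_pow_left₀ hY0 hYΛ 2
  calc |calib l e y μ θ| ≤ |fieldRad l Y α| +
        |2 * l * (μ * sincRoot (turnSq Y α)) * fderiv ℝ y θ (tang e θ)| + |μ ^ 2 * y θ ^ 2| :=
        (abs_sub _ _).trans (add_le_add (abs_add_le _ _) le_rfl)
    _ ≤ _ := by linarith

theorem continuous_calib_bound (e : E n) {y : E n → ℝ} (hy : ContDiffOn ℝ 1 y {0}ᶜ) (Λ : ℝ) :
    Continuous fun θ : S n => 2 * (Λ * y θ + 1) ^ 2 + 1 +
      2 * Λ * |fderiv ℝ y θ (tang e θ)| + (Λ * y θ) ^ 2 := by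
  obtain ⟨cy, ci, cD⟩ := sphere_continuous_data hy e
  have cY := (continuous_const (y := Λ)).mul cy
  exact (((continuous_const.mul ((cY.add continuous_const).pow 2)).add continuous_const).add
    (continuous_const.mul cD.abs)).add (cY.pow 2)

/-- No value of `μ` is excluded: if `α² = 1` the turning angle vanishes identically, and otherwise
the squared distance in the denominator never does. -/
theorem continuousOn_calib {l : ℝ} {e : E n} (he : ‖e‖ = 1) (y : E n → ℝ) (θ : S n)
    (hy : 0 < y θ) : ContinuousOn (fun μ => calib l e y μ θ) (Set.Ici 0) := by
  have hα := sq_inner_sphere_le he θ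
  have hY : ContinuousOn (fun μ : ℝ => μ * y θ) (Set.Ici 0) := by fun_prop
  have hd : ContinuousOn (fun μ : ℝ => distSq (μ * y θ) (inner ℝ e (θ : E n))) (Set.Ici 0) := by
    unfold distSq; fun_prop
  have ht : ContinuousOn (fun μ : ℝ => turnSq (μ * y θ) (inner ℝ e (θ : E n))) (Set.Ici 0) := by
    unfold turnSq
    rcases hα.eq_or_lt with h | h
    · simp only [h, sub_self, mul_zero, zero_div]
      exact continuousOn_const
    · refine ContinuousOn.div (by fun_prop) (hd.pow 2) fun μ _ => ?_
      refine pow_ne_zero 2 (ne_of_gt ?_)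
      rw [distSq_eq]
      nlinarith [sq_nonneg (μ * y θ - inner ℝ e (θ : E n))]
  have hY1 : ∀ μ ∈ Set.Ici (0 : ℝ), 1 + μ * y θ ≠ 0 := fun μ hμ => by
    have := mul_nonneg (Set.mem_Ici.1 hμ) hy.le
    positivity
  unfold calib fieldRad
  exact (((continuousOn_const.mul (hd.sub (continuousOn_const.mul
      (hY.div (continuousOn_const.add hY) hY1)))).add
      (continuousOn_const.mul (hd.mul (continuous_cosRoot.comp_continuousOn ht)))).add
      ((continuousOn_const.mul (continuousOn_id.mul
        (continuous_sincRoot.comp_continuousOn ht))).mul continuousOn_const)).sub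
      ((continuousOn_id.pow 2).mul continuousOn_const)

theorem integrable_calib {l : ℝ} (hl0 : 0 ≤ l) (hl1 : l ≤ 1) {e : E n} (he : ‖e‖ = 1)
    {y : E n → ℝ} (hy : ContDiffOn ℝ 1 y {0}ᶜ) (hpos : ∀ θ : S n, 0 < y θ) {μ : ℝ} (hμ : 0 ≤ μ) :
    Integrable (calib l e y μ) (sph n) := by
  refine Integrable.mono' (integrable_of_compact (f := fun θ : S n => 2 * (μ * y θ + 1) ^ 2 + 1 +
    2 * μ * |fderiv ℝ y θ (tang e θ)| + (μ * y θ) ^ 2) (continuous_calib_bound e hy μ))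
    (measurable_calib l e hy μ).aestronglyMeasurable
    (Eventually.of_forall fun θ => abs_calib_le hl0 hl1 he y hμ le_rfl θ (hpos θ))

theorem continuousOn_integral_calib {l : ℝ} (hl0 : 0 ≤ l) (hl1 : l ≤ 1) {e : E n} (he : ‖e‖ = 1)
    {y : E n → ℝ} (hy : ContDiffOn ℝ 1 y {0}ᶜ) (hpos : ∀ θ : S n, 0 < y θ) (Λ : ℝ) :
    ContinuousOn (fun μ => ∫ θ, calib l e y μ θ ∂(sph n)) (Set.Icc 0 Λ) := by
  refine continuousOn_of_dominated (bound := fun θ : S n => 2 * (Λ * y θ + 1) ^ 2 + 1 +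
    2 * Λ * |fderiv ℝ y θ (tang e θ)| + (Λ * y θ) ^ 2)
    (fun μ _ => (measurable_calib l e hy μ).aestronglyMeasurable)
    (fun μ hμ => Eventually.of_forall fun θ => abs_calib_le hl0 hl1 he y hμ.1 hμ.2 θ (hpos θ))
    (integrable_of_compact (continuous_calib_bound e hy Λ))
    (Eventually.of_forall fun θ => (continuousOn_calib he y θ (hpos θ)).mono
      Set.Icc_subset_Ici_self)

/-- A continuous function whose derivative is nonpositive off one point is antitone. -/
theorem le_of_deriv_nonpos_off_point {J : ℝ → ℝ} {a b : ℝ} (hab : a ≤ b) (m : ℝ)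
    (hc : ContinuousOn J (Set.Icc a b))
    (hd : ∀ x ∈ Set.Ioo a b, x ≠ m → ∃ D ≤ 0, HasDerivAt J D x) : J b ≤ J a := by
  have main : ∀ c d, a ≤ c → d ≤ b → c ≤ d → m ∉ Set.Ioo c d → J d ≤ J c := by
    intro c d hac hdb hcd hm
    have hsub : Set.Icc c d ⊆ Set.Icc a b := Set.Icc_subset_Icc hac hdb
    have hd' : ∀ x ∈ interior (Set.Icc c d), ∃ D ≤ 0, HasDerivAt J D x := by
      intro x hx
      rw [interior_Icc] at hx
      exact hd x ⟨hac.trans_lt hx.1, hx.2.trans_le hdb⟩ fun h => hm (h ▸ hx)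
    refine antitoneOn_of_deriv_nonpos (convex_Icc c d) (hc.mono hsub) ?_ ?_
      (Set.left_mem_Icc.2 hcd) (Set.right_mem_Icc.2 hcd) hcd
    · intro x hx
      obtain ⟨D, _, h⟩ := hd' x hx
      exact h.differentiableAt.differentiableWithinAt
    · intro x hx
      obtain ⟨D, h0, h⟩ := hd' x hx
      rw [h.deriv]; exact h0
  by_cases hm : m ∈ Set.Ioo a b
  · exact (main m b hm.1.le le_rfl hm.2.le fun h => lt_irrefl _ h.1).trans
      (main a m le_rfl hm.2.le hm.1.le fun h => lt_irrefl _ h.2)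
  · exact main a b le_rfl le_rfl hab hm

/-- The derivative is nonpositive except at `μ = 1 / y e`, and dominated convergence gives
continuity across that value. -/
theorem integral_calib_antitone {y : E n → ℝ} (hy : ContDiffOn ℝ 1 y {0}ᶜ)
    (hpos : ∀ θ : S n, 0 < y θ) {e : E n} (he : ‖e‖ = 1) (hn : 2 ≤ n) {Λ : ℝ} (hΛ : 1 ≤ Λ) :
    ∫ θ, calib (1 / ((n : ℝ) - 1)) e y Λ θ ∂(sph n) ≤
      ∫ θ, calib (1 / ((n : ℝ) - 1)) e y 1 θ ∂(sph n) := by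
  have h2 : (2 : ℝ) ≤ n := by exact_mod_cast hn
  have hl0 : 0 ≤ 1 / ((n : ℝ) - 1) := by apply one_div_nonneg.2; linarith
  have hl1 : 1 / ((n : ℝ) - 1) ≤ 1 := by rw [div_le_one] <;> linarith
  have hye : 0 < y e := hpos ⟨e, by simpa using he⟩
  refine le_of_deriv_nonpos_off_point (J := fun μ => ∫ θ, calib (1 / ((n : ℝ) - 1)) e y μ θ ∂(sph n))
    hΛ (1 / y e) ((continuousOn_integral_calib hl0 hl1 he hy hpos Λ).mono
      (Set.Icc_subset_Icc_left zero_le_one)) fun x hx hxm => ?_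
  refine hasDerivAt_integral_calib hy hpos he hn (zero_lt_one.trans hx.1) fun h => hxm ?_
  rw [eq_div_iff hye.ne', h]

/-- Asymptotic lower bound for the calibrating integrand. -/
theorem le_calib {l : ℝ} (hl0 : 0 ≤ l) (hl1 : l ≤ 1) {e : E n} (he : ‖e‖ = 1) (y : E n → ℝ)
    {μ : ℝ} (hμ : 0 < μ) (θ : S n) (hy : 0 < y θ) (hY : 4 ≤ μ * y θ) :
    1 - 2 * (μ * y θ) * inner ℝ e (θ : E n) + 2 * l * μ * fderiv ℝ y θ (tang e θ) -
        2 / 3 * (1 - l) - 2 * l * (1 - inner ℝ e (θ : E n) ^ 2) -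
        (8 / y θ + 6 * |fderiv ℝ y θ (tang e θ)| / y θ ^ 2) / μ ≤
      calib l e y μ θ := by
  have hα := sq_inner_sphere_le he θ
  set α := inner ℝ e (θ : E n)
  have hα1 := abs_le.1 (abs_le_one_iff_mul_self_le_one.2 (by nlinarith : α * α ≤ 1))
  set D := fderiv ℝ y θ (tang e θ)
  have hs0 : 0 ≤ 1 - α ^ 2 := by linarith
  rw [calib]
  set Y := μ * y θ with hYdef
  have hX0 := turnSq_nonneg (Y := Y) hα
  have hY0 : 0 < Y := by linarith
  have hA2 : Y ^ 2 / 2 ≤ distSq Y α := by rw [distSq]; nlinarith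
  have hA1 : Y * (Y - 2) ≤ distSq Y α := by rw [distSq]; nlinarith
  have hA0 : 0 < distSq Y α := lt_of_lt_of_le (by positivity) hA2
  have hX16 : turnSq Y α ≤ 16 / Y ^ 2 := by
    rw [turnSq, div_le_div_iff₀ (by positivity) (by positivity)]
    have h1 : (Y ^ 2 / 2) ^ 2 ≤ distSq Y α ^ 2 := pow_le_pow_left₀ (by positivity) hA2 2
    nlinarith [mul_nonneg (sq_nonneg (Y ^ 2)) (sq_nonneg α)]
  have hC : distSq Y α - 2 * (1 - α ^ 2) - 8 / Y ≤ distSq Y α * cosRoot (turnSq Y α) := by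
    have h1 := mul_le_mul_of_nonneg_left (one_sub_le_cosRoot hX0) hA0.le
    have h2 : distSq Y α * (turnSq Y α / 2) ≤ 2 * (1 - α ^ 2) + 8 / Y := by
      have e1 : distSq Y α * (turnSq Y α / 2) = 2 * Y ^ 2 * (1 - α ^ 2) / distSq Y α := by
        rw [turnSq]; field_simp; norm_num; ring
      rw [e1, div_le_iff₀ hA0]
      -- The excess `8(1 - α²)/Y` is large enough to replace `distSq Y α` by its lower bound `Y(Y -
      -- 2)` once `Y ≥ 4`.
      have h3 : 2 * Y ^ 2 * (1 - α ^ 2) ≤ (2 * (1 - α ^ 2) + 8 * (1 - α ^ 2) / Y) * (Y * (Y - 2)) := by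
        have : (2 * (1 - α ^ 2) + 8 * (1 - α ^ 2) / Y) * (Y * (Y - 2)) =
          (1 - α ^ 2) * (2 * Y * (Y - 2) + 8 * (Y - 2)) := by field_simp
        rw [this]
        nlinarith
      refine h3.trans (mul_le_mul ?_ hA1 (by nlinarith) (by positivity))
      have : 8 * (1 - α ^ 2) / Y ≤ 8 / Y := by
        apply div_le_div_of_nonneg_right _ hY0.le
        nlinarith [sq_nonneg α]
      linarith
    linarith
  have hε : Y / (1 + Y) ≤ 1 := by rw [div_le_one (by positivity)]; linarith
  have hT1 : |sincRoot (turnSq Y α) - 1| ≤ 3 / Y ^ 2 := by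
    rw [abs_le]
    have h1 := sincRoot_le_one hX0
    have h2 := one_sub_le_sincRoot hX0
    have h3 : turnSq Y α / 6 ≤ 3 / Y ^ 2 := by
      have : 16 / Y ^ 2 / 6 ≤ 3 / Y ^ 2 := by
        rw [div_div, div_le_div_iff₀ (by positivity) (by positivity)]
        nlinarith [sq_nonneg Y]
      linarith [div_le_div_of_nonneg_right hX16 (by norm_num : (0 : ℝ) ≤ 6)]
    have h4 : 0 ≤ 3 / Y ^ 2 := by positivity
    constructor <;> linarith
  have hTD : 2 * l * μ * D - 6 * |D| / y θ ^ 2 / μ ≤ 2 * l * (μ * sincRoot (turnSq Y α)) * D := by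
    have h1 : |2 * l * μ * (sincRoot (turnSq Y α) - 1) * D| ≤ 2 * 1 * μ * (3 / Y ^ 2) * |D| := by
      rw [abs_mul, abs_mul, abs_of_nonneg (by positivity : 0 ≤ 2 * l * μ)]
      gcongr
    have h2 : 2 * 1 * μ * (3 / Y ^ 2) * |D| = 6 * |D| / y θ ^ 2 / μ := by
      rw [hYdef]; field_simp; ring
    rw [h2] at h1
    have := (abs_le.1 h1).1
    linarith
  have h8 : (8 / y θ + 6 * |D| / y θ ^ 2) / μ = 8 / Y + 6 * |D| / y θ ^ 2 / μ := by
    rw [hYdef]; field_simp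
  rw [h8, fieldRad, ← mul_pow, ← hYdef]
  have h5 := mul_le_mul_of_nonneg_left hC hl0
  have h6 := mul_le_mul_of_nonneg_left hε (sub_nonneg.2 hl1)
  have h7 : l * (8 / Y) ≤ 8 / Y := by
    have : 0 ≤ 8 / Y := by positivity
    nlinarith
  have h9 : distSq Y α = Y ^ 2 - 2 * Y * α + 1 := rfl
  linarith

/-- Monotonicity allows `μ` to be replaced by any large `Λ`. In the expansion there, the terms
linear in `Λ` cancel by the divergence theorem, the error is `O(1/Λ)`, and the constant term is `|S|
(n-2)(n-3) / (3n(n-1))`. -/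
theorem integral_calib_nonneg {y : E n → ℝ} (hy : ContDiffOn ℝ 1 y {0}ᶜ)
    (hpos : ∀ θ : S n, 0 < y θ) {e : E n} (he : ‖e‖ = 1) (hn : 2 ≤ n) :
    0 ≤ ∫ θ, calib (1 / ((n : ℝ) - 1)) e y 1 θ ∂(sph n) := by
  have h2 : (2 : ℝ) ≤ n := by exact_mod_cast hn
  have hn1 : (0 : ℝ) < (n : ℝ) - 1 := by linarith
  obtain ⟨cy, ci, cD⟩ := sphere_continuous_data hy e
  set l : ℝ := 1 / ((n : ℝ) - 1) with hl
  have hl0 : 0 ≤ l := by positivity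
  have hl1 : l ≤ 1 := by rw [hl, div_le_one] <;> linarith
  have hln : l * ((n : ℝ) - 1) = 1 := by rw [hl]; field_simp
  have hne : (Set.univ : Set (S n)).Nonempty := ⟨⟨e, by simpa using he⟩, trivial⟩
  obtain ⟨θ₀, -, hθ₀⟩ := isCompact_univ.exists_isMinOn hne cy.continuousOn
  set y₀ := y θ₀
  have hy₀ : 0 < y₀ := hpos θ₀
  have hmin : ∀ θ : S n, y₀ ≤ y θ := fun θ => hθ₀ trivial
  set B := ∫ θ : S n, (8 / y θ + 6 * |fderiv ℝ y θ (tang e θ)| / y θ ^ 2) ∂(sph n)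
  have cB : Continuous fun θ : S n => 8 / y θ + 6 * |fderiv ℝ y θ (tang e θ)| / y θ ^ 2 :=
    (continuous_const.div cy fun θ => (hpos θ).ne').add
      ((continuous_const.mul cD.abs).div (cy.pow 2) fun θ => pow_ne_zero 2 (hpos θ).ne')
  have hS : ∀ θ : S n, (θ : E n) ∈ ({0}ᶜ : Set (E n)) := fun θ => sph_ne_zero θ
  have hnull : ∫ θ : S n, fderiv ℝ y θ (tang e θ) ∂(sph n) =
      ((n : ℝ) - 1) * ∫ θ : S n, inner ℝ e (θ : E n) * y θ ∂(sph n) :=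
    integral_sphere_tangent isOpen_compl_singleton hS hy e
  have hsq := integral_sphere_inner_sq e
  rw [he, one_pow, one_mul] at hsq
  -- The second condition gives `Λ y ≥ 4` on the whole sphere, the range of `le_calib`.
  have key : ∀ Λ : ℝ, 1 ≤ Λ → 4 / y₀ ≤ Λ →
      -B / Λ ≤ ∫ θ, calib l e y 1 θ ∂(sph n) := by
    intro Λ h1 h4
    have hΛ : 0 < Λ := by linarith
    refine le_trans ?_ (integral_calib_antitone hy hpos he hn h1)
    have i1 : Integrable (fun θ : S n => fderiv ℝ y θ (tang e θ)) (sph n) :=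
      integrable_of_compact cD
    have i2 : Integrable (fun θ : S n => inner ℝ e (θ : E n) * y θ) (sph n) :=
      integrable_of_compact (ci.mul cy)
    have i3 : Integrable (fun θ : S n => inner ℝ e (θ : E n) ^ 2) (sph n) :=
      integrable_of_compact (ci.pow 2)
    have i4 := integrable_of_compact (μ := sph n) cB
    have j1 : Integrable (fun θ : S n => (1 - 2 / 3 * (1 - l) - 2 * l) +
        (2 * l * Λ) * fderiv ℝ y θ (tang e θ)) (sph n) :=
      (integrable_const _).add (i1.const_mul _)
    have j2 : Integrable (fun θ : S n => (1 - 2 / 3 * (1 - l) - 2 * l) +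
        (2 * l * Λ) * fderiv ℝ y θ (tang e θ) + (-2 * Λ) * (inner ℝ e (θ : E n) * y θ)) (sph n) :=
      j1.add (i2.const_mul _)
    have j3 : Integrable (fun θ : S n => (1 - 2 / 3 * (1 - l) - 2 * l) +
        (2 * l * Λ) * fderiv ℝ y θ (tang e θ) + (-2 * Λ) * (inner ℝ e (θ : E n) * y θ) +
        (2 * l) * inner ℝ e (θ : E n) ^ 2) (sph n) := j2.add (i3.const_mul _)
    have hle : ∫ θ : S n, ((1 - 2 / 3 * (1 - l) - 2 * l) + (2 * l * Λ) * fderiv ℝ y θ (tang e θ) +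
        (-2 * Λ) * (inner ℝ e (θ : E n) * y θ) + (2 * l) * inner ℝ e (θ : E n) ^ 2 +
        (-1 / Λ) * (8 / y θ + 6 * |fderiv ℝ y θ (tang e θ)| / y θ ^ 2)) ∂(sph n) ≤
        ∫ θ, calib l e y Λ θ ∂(sph n) := by
      refine integral_mono (j3.add (i4.const_mul _))
        (integrable_calib hl0 hl1 he hy hpos hΛ.le) fun θ => ?_
      have hY : 4 ≤ Λ * y θ := by
        rw [div_le_iff₀ hy₀] at h4
        exact h4.trans (mul_le_mul_of_nonneg_left (hmin θ) hΛ.le)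
      have := le_calib hl0 hl1 he y hΛ θ (hpos θ) hY
      refine le_trans (le_of_eq ?_) this
      ring
    refine le_trans ?_ hle
    rw [integral_add j3 (i4.const_mul _), integral_add j2 (i3.const_mul _),
      integral_add j1 (i2.const_mul _), integral_add (integrable_const _) (i1.const_mul _),
      integral_const_mul, integral_const_mul, integral_const_mul, integral_const_mul,
      integral_const, hnull, smul_eq_mul]
    set Q := ∫ θ : S n, inner ℝ e (θ : E n) * y θ ∂(sph n)
    set R := ∫ θ : S n, inner ℝ e (θ : E n) ^ 2 ∂(sph n)
    set s := (sph n).real Set.univ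
    have hs : 0 ≤ s := measureReal_nonneg
    have e1 : 2 * l * Λ * (((n : ℝ) - 1) * Q) = 2 * Λ * Q := by
      linear_combination 2 * Λ * Q * hln
    -- Integrality of `n` is used here: the product is negative strictly between 2 and 3. It
    -- vanishes for `n = 2` and `n = 3`, so the constant `2/3` of the correction leaves no slack in
    -- these dimensions.
    have hint : 0 ≤ ((n : ℝ) - 2) * ((n : ℝ) - 3) := by
      rcases hn.eq_or_lt with h | h
      · rw [← h]; norm_num
      · have : (3 : ℝ) ≤ n := by exact_mod_cast h
        exact mul_nonneg (by linarith) (by linarith)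
    have e2 : R = s / n := by rw [eq_div_iff (by linarith), ← hsq]; ring
    have e3 : s * (1 - 2 / 3 * (1 - l) - 2 * l) + 2 * l * R =
        s * ((((n : ℝ) - 2) * ((n : ℝ) - 3)) / (3 * n * (n - 1))) := by
      rw [e2, hl]; field_simp; ring
    have e4 : 0 ≤ s * ((((n : ℝ) - 2) * ((n : ℝ) - 3)) / (3 * n * (n - 1))) := by positivity
    rw [e1]
    have e5 : -1 / Λ * B = -B / Λ := by ring
    rw [show ∫ θ : S n, (8 / y θ + 6 * |fderiv ℝ y θ (tang e θ)| / y θ ^ 2) ∂(sph n) = B from rfl,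
      e5]
    linarith
  have hlim : Tendsto (fun Λ : ℝ => -B / Λ) atTop (𝓝 0) :=
    tendsto_const_nhds.div_atTop tendsto_id
  refine le_of_tendsto hlim ?_
  filter_upwards [eventually_ge_atTop (1 : ℝ), eventually_ge_atTop (4 / y₀)] with Λ h1 h4
  exact key Λ h1 h4

/-- The calibrated integral at `μ = 1` is nonnegative, and `field_le` bounds its integrand pointwise
by the difference of the two integrands compared here. -/
theorem sphere_key_of_norm_one {y : E n → ℝ} (hy : ContDiffOn ℝ 1 y {0}ᶜ)
    (hpos : ∀ θ : S n, 0 < y θ) {e : E n} (he : ‖e‖ = 1) (hn : 2 ≤ n) :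
    ∫ θ : S n, y θ ^ 2 ∂(sph n) ≤ ∫ θ : S n, ‖y θ • (θ : E n) - e‖ ^ 2 *
      √(1 + 1 / ((n : ℝ) - 1) * (‖fderiv ℝ y θ‖ ^ 2 / y θ ^ 2)) ∂(sph n) := by
  have h2 : (2 : ℝ) ≤ n := by exact_mod_cast hn
  have hn1 : (0 : ℝ) < (n : ℝ) - 1 := by linarith
  obtain ⟨cy, ci, cD⟩ := sphere_continuous_data hy e
  have hnn := integral_calib_nonneg hy hpos he hn
  set l : ℝ := 1 / ((n : ℝ) - 1) with hl
  have hl0 : 0 ≤ l := by positivity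
  have hl1 : l ≤ 1 := by rw [hl, div_le_one] <;> linarith
  have hS : ∀ θ : S n, (θ : E n) ∈ ({0}ᶜ : Set (E n)) := fun θ => sph_ne_zero θ
  have cF := continuous_sphere_fderiv isOpen_compl_singleton hS hy
  have i1 : Integrable (fun θ : S n => y θ ^ 2) (sph n) := integrable_of_compact (cy.pow 2)
  have i2 : Integrable (fun θ : S n => ‖y θ • (θ : E n) - e‖ ^ 2 *
      √(1 + l * (‖fderiv ℝ y θ‖ ^ 2 / y θ ^ 2))) (sph n) := by
    refine integrable_of_compact ((((cy.smul continuous_subtype_val).sub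
      continuous_const).norm.pow 2).mul ?_)
    exact (continuous_const.add (continuous_const.mul ((cF.norm.pow 2).div (cy.pow 2)
      fun θ => pow_ne_zero 2 (hpos θ).ne'))).sqrt
  rw [← sub_nonneg, ← integral_sub i2 i1]
  refine hnn.trans (integral_mono (integrable_calib hl0 hl1 he hy hpos zero_le_one) (i2.sub i1)
    fun θ => ?_)
  have hα := sq_inner_sphere_le he θ
  have hyθ := hpos θ
  have hd : (fderiv ℝ y θ (tang e θ) / y θ) ^ 2 ≤
      (1 - inner ℝ e (θ : E n) ^ 2) * (‖fderiv ℝ y θ‖ ^ 2 / y θ ^ 2) := by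
    rw [div_pow, ← mul_div_assoc]
    refine div_le_div_of_nonneg_right ?_ (by positivity)
    have h := (fderiv ℝ y θ).le_opNorm (tang e θ)
    rw [← norm_tang_sq he θ, ← mul_pow, ← sq_abs, mul_comm ‖tang e (θ : E n)‖]
    exact pow_le_pow_left₀ (abs_nonneg _) h 2
  have h := field_le hl0 hl1 hyθ hα (by positivity) hd
  have e1 : 2 * l * fieldTan (y θ) (inner ℝ e (θ : E n)) * (fderiv ℝ y θ (tang e θ) / y θ) =
      2 * l * sincRoot (turnSq (y θ) (inner ℝ e (θ : E n))) * fderiv ℝ y θ (tang e θ) := by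
    rw [fieldTan]; field_simp
  rw [e1] at h
  simp only [calib, one_mul, one_pow, norm_sub_sq_eq_distSq he]
  linarith

/-- The weighted isoperimetric-type inequality on the sphere behind the upper bound. -/
theorem sphere_key {y : E n → ℝ} (hy : ContDiffOn ℝ 1 y {0}ᶜ)
    (hpos : ∀ θ : S n, 0 < y θ) (hn : 2 ≤ n) (c : E n) :
    ∫ θ : S n, y θ ^ 2 ∂(sph n) ≤ ∫ θ : S n, ‖y θ • (θ : E n) - c‖ ^ 2 *
      √(1 + 1 / ((n : ℝ) - 1) * (‖fderiv ℝ y θ‖ ^ 2 / y θ ^ 2)) ∂(sph n) := by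
  have h2 : (2 : ℝ) ≤ n := by exact_mod_cast hn
  have hn1 : (0 : ℝ) < (n : ℝ) - 1 := by linarith
  have hS : ∀ θ : S n, (θ : E n) ∈ ({0}ᶜ : Set (E n)) := fun θ => sph_ne_zero θ
  have cy := continuous_sphere_of_contDiffOn hS hy
  have cF := continuous_sphere_fderiv isOpen_compl_singleton hS hy
  by_cases hc : c = 0
  · subst hc
    refine integral_mono (integrable_of_compact (cy.pow 2)) (integrable_of_compact
      ((((cy.smul continuous_subtype_val).sub continuous_const).norm.pow 2).mul
      (continuous_const.add (continuous_const.mul ((cF.norm.pow 2).div (cy.pow 2)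
      fun θ => pow_ne_zero 2 (hpos θ).ne'))).sqrt)) fun θ => ?_
    simp only [sub_zero, norm_smul, sph_norm, mul_one, Real.norm_eq_abs, sq_abs]
    refine le_mul_of_one_le_right (sq_nonneg _) (Real.one_le_sqrt.2 ?_)
    have : 0 ≤ 1 / ((n : ℝ) - 1) * (‖fderiv ℝ y θ‖ ^ 2 / y θ ^ 2) := by positivity
    linarith
  · have hc' : 0 < ‖c‖ := norm_pos_iff.2 hc
    have he : ‖‖c‖⁻¹ • c‖ = 1 := by
      rw [norm_smul, norm_inv, norm_norm, inv_mul_cancel₀ hc'.ne']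
    -- Both sides scale quadratically when `y` and `c` are multiplied by the same positive number,
    -- so `c` may be normalised.
    have h := sphere_key_of_norm_one (y := fun x => ‖c‖⁻¹ * y x) (contDiffOn_const.mul hy)
      (fun θ => mul_pos (inv_pos.2 hc') (hpos θ)) he hn
    have h3 := mul_le_mul_of_nonneg_left h (sq_nonneg ‖c‖)
    rw [← integral_const_mul, ← integral_const_mul] at h3
    refine le_trans (le_of_eq ?_) (h3.trans (le_of_eq ?_))
    · refine integral_congr_ae (Eventually.of_forall fun θ => ?_)
      simp only
      field_simp
    · refine integral_congr_ae (Eventually.of_forall fun θ => ?_)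
      simp only
      have hd : DifferentiableAt ℝ y (θ : E n) :=
        (hy.differentiableOn (by simp)).differentiableAt
          (isOpen_compl_singleton.mem_nhds (sph_ne_zero θ))
      have e1 : fderiv ℝ (fun x => ‖c‖⁻¹ * y x) (θ : E n) = ‖c‖⁻¹ • fderiv ℝ y (θ : E n) :=
        fderiv_const_mul hd _
      have e2 : y θ • (θ : E n) - c = ‖c‖ • ((‖c‖⁻¹ * y θ) • (θ : E n) - ‖c‖⁻¹ • c) := by
        rw [smul_sub, smul_smul, smul_smul, mul_inv_cancel₀ hc'.ne', ← mul_assoc,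
          mul_inv_cancel₀ hc'.ne', one_mul, one_smul]
      have hyθ := (hpos θ).ne'
      have e3 : (‖c‖⁻¹ * ‖fderiv ℝ y (θ : E n)‖) ^ 2 / (‖c‖⁻¹ * y θ) ^ 2 =
          ‖fderiv ℝ y (θ : E n)‖ ^ 2 / y θ ^ 2 := by field_simp
      rw [e1, e2, norm_smul ‖c‖, norm_norm, norm_smul (‖c‖⁻¹), norm_inv, norm_norm, e3]
      ring

/-! ### Increments of periodic functions via Fourier coefficients -/

theorem abs_sin_nat_mul_le (k : ℕ) (x : ℝ) : |Real.sin (k * x)| ≤ k * |Real.sin x| := by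
  induction k with
  | zero => simp
  | succ k ih =>
    have h1 : ((k + 1 : ℕ) : ℝ) * x = k * x + x := by push_cast; ring
    rw [h1, Real.sin_add]
    calc |Real.sin (k * x) * Real.cos x + Real.cos (k * x) * Real.sin x| ≤
          |Real.sin (k * x)| * |Real.cos x| + |Real.cos (k * x)| * |Real.sin x| := by
          rw [← abs_mul, ← abs_mul]; exact abs_add_le _ _
      _ ≤ |Real.sin (k * x)| * 1 + 1 * |Real.sin x| := by
          gcongr
          · exact Real.abs_cos_le_one x
          · exact Real.abs_cos_le_one _
      _ ≤ ((k + 1 : ℕ) : ℝ) * |Real.sin x| := by push_cast; linarith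

/-- In half angles this is `|sin kx| ≤ |k| |sin x|`. It compares the factor `|e^{ikd} - 1|² = 2(1 -
cos kd)` of an increment with the factor `k²` of a derivative, with equality for `k = ±1`. -/
theorem one_sub_cos_int_mul_le (k : ℤ) (d : ℝ) :
    1 - Real.cos (k * d) ≤ (k : ℝ) ^ 2 * (1 - Real.cos d) := by
  have h : ∀ x : ℝ, 1 - Real.cos x = 2 * Real.sin (x / 2) ^ 2 := fun x => by
    have h1 : Real.cos x = 2 * Real.cos (x / 2) ^ 2 - 1 := by
      rw [← Real.cos_two_mul]; ring_nf
    rw [h1, Real.cos_sq']; ring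
  rw [h, h, ← sq_abs (Real.sin (d / 2)), ← sq_abs (Real.sin (k * d / 2))]
  have h2 : |Real.sin (k * d / 2)| ≤ |(k : ℝ)| * |Real.sin (d / 2)| := by
    have h3 := abs_sin_nat_mul_le k.natAbs (d / 2)
    rw [Nat.cast_natAbs, Int.cast_abs] at h3
    refine le_trans (le_of_eq ?_) h3
    rcases abs_choice (k : ℝ) with h4 | h4
    · rw [h4]; ring_nf
    · rw [h4, neg_mul, Real.sin_neg, abs_neg]; ring_nf
  have h5 := pow_le_pow_left₀ (abs_nonneg _) h2 2
  rw [mul_pow, sq_abs (k : ℝ)] at h5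
  linarith

theorem fourierCoeffOn_two_pi (f : ℝ → ℂ) (k : ℤ) :
    fourierCoeffOn Real.two_pi_pos f k =
      (1 / (2 * Real.pi)) • ∫ x in (0 : ℝ)..2 * Real.pi, Complex.exp (-(k * x * Complex.I)) * f x := by
  rw [fourierCoeffOn_eq_integral, sub_zero]
  congr 1
  refine intervalIntegral.integral_congr fun x _ => ?_
  simp only [smul_eq_mul]
  congr 1
  rw [fourier_coe_apply]
  congr 1
  have : (Real.pi : ℂ) ≠ 0 := by exact_mod_cast Real.pi_ne_zero
  push_cast
  field_simp
  try ring

theorem fourierCoeffOn_translate_sub {g : ℝ → ℂ} (hg : Continuous g)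
    (hper : Function.Periodic g (2 * Real.pi)) (d : ℝ) (k : ℤ) :
    fourierCoeffOn Real.two_pi_pos (fun s => g (s + d) - g s) k =
      (Complex.exp (k * d * Complex.I) - 1) * fourierCoeffOn Real.two_pi_pos g k := by
  rw [fourierCoeffOn_two_pi, fourierCoeffOn_two_pi]
  have h1 : ∫ x in (0 : ℝ)..2 * Real.pi, Complex.exp (-(k * x * Complex.I)) * g (x + d) =
      Complex.exp (k * d * Complex.I) *
        ∫ x in (0 : ℝ)..2 * Real.pi, Complex.exp (-(k * x * Complex.I)) * g x := by
    have hp : Function.Periodic (fun x : ℝ => Complex.exp (-(k * x * Complex.I)) * g x)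
        (2 * Real.pi) := by
      intro x
      simp only [hper x]
      congr 1
      have : (-(k * ((x + 2 * Real.pi : ℝ) : ℂ) * Complex.I)) =
          -(k * x * Complex.I) - k * (2 * Real.pi * Complex.I) := by push_cast; ring
      rw [this, Complex.exp_periodic.sub_int_mul_eq]
    have h2 := hp.intervalIntegral_add_eq d 0
    rw [zero_add] at h2
    rw [← h2, ← intervalIntegral.integral_const_mul]
    have h3 := intervalIntegral.integral_comp_add_right (a := 0) (b := 2 * Real.pi)
      (fun x : ℝ => Complex.exp (k * d * Complex.I) * (Complex.exp (-(k * x * Complex.I)) * g x)) d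
    rw [zero_add, add_comm (2 * Real.pi) d] at h3
    rw [← h3]
    refine intervalIntegral.integral_congr fun x _ => ?_
    rw [← mul_assoc, ← Complex.exp_add]
    congr 2
    push_cast; ring
  have h4 : ∀ f : ℝ → ℂ, Continuous f → IntervalIntegrable
      (fun x : ℝ => Complex.exp (-(k * x * Complex.I)) * f x) volume 0 (2 * Real.pi) := fun f hf =>
    Continuous.intervalIntegrable (by fun_prop) _ _
  simp only [mul_sub]
  rw [intervalIntegral.integral_sub (h4 (fun x => g (x + d)) (by fun_prop)) (h4 g hg), h1]
  simp only [Complex.real_smul]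
  ring

/-- The sharp comparison of the increment of a periodic function with its derivative. -/
theorem integral_increment_sq_le {g g' : ℝ → ℝ} (hg : ∀ x, HasDerivAt g (g' x) x)
    (hg' : Continuous g') (hper : Function.Periodic g (2 * Real.pi)) (d : ℝ) :
    ∫ s in (0 : ℝ)..2 * Real.pi, (g (s + d) - g s) ^ 2 ≤
      2 * (1 - Real.cos d) * ∫ s in (0 : ℝ)..2 * Real.pi, g' s ^ 2 := by
  have hgc : Continuous g := continuous_iff_continuousAt.2 fun x => (hg x).continuousAt
  set G : ℝ → ℂ := fun x => (g x : ℂ)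
  set G' : ℝ → ℂ := fun x => (g' x : ℂ)
  have hGc : Continuous G := Complex.continuous_ofReal.comp hgc
  have hGc' : Continuous G' := Complex.continuous_ofReal.comp hg'
  have hGp : Function.Periodic G (2 * Real.pi) := fun x => by simp only [G, hper x]
  have hL2 : ∀ f : ℝ → ℂ, Continuous f →
      MemLp f 2 (volume.restrict (Set.Ioc 0 (2 * Real.pi))) := fun f hf =>
    (memLp_two_iff_integrable_sq_norm hf.aestronglyMeasurable).2 (((hf.norm.pow 2).integrableOn_Icc (a := 0) (b := 2 * Real.pi)).mono_set Set.Ioc_subset_Icc_self)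
  have p1 := hasSum_sq_fourierCoeffOn Real.two_pi_pos
    (hL2 (fun s => G (s + d) - G s) (by fun_prop))
  have p2 := (hasSum_sq_fourierCoeffOn Real.two_pi_pos (hL2 G' hGc')).mul_left
    (2 * (1 - Real.cos d))
  -- Parseval on both sides reduces the claim to each Fourier mode separately.
  have hle := hasSum_le (fun k => ?_) p1 p2
  · have hpi := Real.two_pi_pos
    simp only [sub_zero, smul_eq_mul] at hle
    have e1 : ∀ s, ‖G (s + d) - G s‖ ^ 2 = (g (s + d) - g s) ^ 2 := fun s => by
      rw [← Complex.ofReal_sub, Complex.norm_real, Real.norm_eq_abs, sq_abs]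
    have e2 : ∀ s, ‖G' s‖ ^ 2 = g' s ^ 2 := fun s => by
      rw [Complex.norm_real, Real.norm_eq_abs, sq_abs]
    simp only [e1, e2] at hle
    rw [mul_left_comm] at hle
    exact le_of_mul_le_mul_left hle (inv_pos.2 hpi)
  · rw [fourierCoeffOn_translate_sub hGc hGp, norm_mul, mul_pow]
    have e1 : ‖Complex.exp (k * d * Complex.I) - 1‖ ^ 2 = 2 * (1 - Real.cos (k * d)) := by
      have : (k : ℂ) * d * Complex.I = ((k * d : ℝ) : ℂ) * Complex.I := by push_cast; ring
      rw [this, ← Complex.normSq_eq_norm_sq, Complex.normSq_apply, Complex.exp_mul_I,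
        ← Complex.ofReal_cos, ← Complex.ofReal_sin]
      have h1 := Real.sin_sq_add_cos_sq ((k : ℝ) * d)
      generalize Real.cos (k * d) = c at *
      generalize Real.sin (k * d) = s at *
      simp
      linear_combination h1
    rw [e1]
    -- An increment has no constant mode, so nothing is required of the derivative there.
    by_cases hk : k = 0
    · subst hk
      simp
      exact mul_nonneg (by linarith [Real.cos_le_one d]) (sq_nonneg _)
    · have hd := fourierCoeffOn_of_hasDerivAt Real.two_pi_pos hk (f := G) (f' := G')
        (fun x _ => (hg x).ofReal_comp) (hGc'.intervalIntegrable _ _)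
      have hb : G (2 * Real.pi) = G 0 := by simpa using hGp 0
      have hk' : (k : ℂ) ≠ 0 := by exact_mod_cast hk
      have e2 : fourierCoeffOn Real.two_pi_pos G' k =
          Complex.I * k * fourierCoeffOn Real.two_pi_pos G k := by
        rw [hd, hb]
        have : (Real.pi : ℂ) ≠ 0 := by exact_mod_cast Real.pi_ne_zero
        push_cast
        field_simp [Complex.I_ne_zero]
        ring
      have e3 : ‖fourierCoeffOn Real.two_pi_pos G' k‖ ^ 2 =
          (k : ℝ) ^ 2 * ‖fourierCoeffOn Real.two_pi_pos G k‖ ^ 2 := by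
        rw [e2, norm_mul, norm_mul, Complex.norm_I, one_mul, mul_pow, Complex.norm_intCast, sq_abs]
      rw [e3]
      have := mul_le_mul_of_nonneg_right (one_sub_cos_int_mul_le k d)
        (sq_nonneg ‖fourierCoeffOn Real.two_pi_pos G k‖)
      linarith

/-! ### Averaging over the orthogonal group and the sharp Poincaré inequality -/

instance : ContinuousStar (E n →L[ℝ] E n) :=
  ⟨(ContinuousLinearMap.adjoint (𝕜 := ℝ) (E := E n) (F := E n)).continuous⟩

/-- The orthogonal group, with the Borel structure and topology of the space of operators. -/
abbrev Orth (n : ℕ) : Type := unitary (E n →L[ℝ] E n)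

theorem isCompact_orth : IsCompact (unitary (E n →L[ℝ] E n) : Set (E n →L[ℝ] E n)) := by
  have : ProperSpace (E n →L[ℝ] E n) := FiniteDimensional.proper ℝ _
  refine (isCompact_closedBall (0 : E n →L[ℝ] E n) 1).of_isClosed_subset isClosed_unitary ?_
  intro u hu
  rw [mem_closedBall_zero_iff]
  refine ContinuousLinearMap.opNorm_le_bound _ zero_le_one fun x => ?_
  rw [one_mul, Unitary.norm_map ⟨u, hu⟩ x]

instance : CompactSpace (Orth n) := isCompact_iff_compactSpace.1 isCompact_orth

instance : SecondCountableTopology (Orth n) := by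
  have : ProperSpace (E n →L[ℝ] E n) := FiniteDimensional.proper ℝ _
  infer_instance

/-- The right-invariant Haar measure of the orthogonal group. -/
def orthHaar (n : ℕ) : Measure (Orth n) := (Measure.haar : Measure (Orth n)).inv

instance : IsFiniteMeasure (orthHaar n) := by
  unfold orthHaar Measure.inv; infer_instance

instance : IsFiniteMeasureOnCompacts (orthHaar n) := ⟨fun _ _ => measure_lt_top _ _⟩

instance : (orthHaar n).IsMulRightInvariant := by
  unfold orthHaar; infer_instance

instance : (orthHaar n).IsOpenPosMeasure := by
  unfold orthHaar; infer_instance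

theorem orthHaar_univ_pos : 0 < (orthHaar n).real Set.univ := by
  rw [measureReal_def]
  exact ENNReal.toReal_pos (isOpen_univ.measure_ne_zero _ Set.univ_nonempty) (measure_ne_top _ _)

/-- A linear isometry as an element of the orthogonal group. -/
def toOrth (T : E n ≃ₗᵢ[ℝ] E n) : Orth n := Unitary.linearIsometryEquiv.symm T

theorem continuous_orth_apply {X : Type*} [TopologicalSpace X] {f : X → Orth n} {g : X → E n}
    (hf : Continuous f) (hg : Continuous g) :
    Continuous fun x => (f x : E n →L[ℝ] E n) (g x) :=
  (continuous_subtype_val.comp hf).clm_apply hg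

/-- Pairs of vectors that are congruent have the same distribution under a random rotation. -/
theorem integral_orth_comp (T : E n ≃ₗᵢ[ℝ] E n) (F : E n → E n → ℝ) (x y : E n) :
    ∫ R : Orth n, F ((R : E n →L[ℝ] E n) (T x)) ((R : E n →L[ℝ] E n) (T y)) ∂(orthHaar n) =
      ∫ R : Orth n, F ((R : E n →L[ℝ] E n) x) ((R : E n →L[ℝ] E n) y) ∂(orthHaar n) :=
  -- `T` acts before `R`, so right invariance is what is needed; hence the inverse of Haar measure
  -- in `orthHaar`.
  integral_mul_right_eq_self (μ := orthHaar n)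
    (fun R : Orth n => F ((R : E n →L[ℝ] E n) x) ((R : E n →L[ℝ] E n) y)) (toOrth T)

/-- The reflection in the hyperplane orthogonal to `x - y`, which contains every `a` with equal
inner products. -/
theorem exists_isometry_swap {x y : E n} (h : ‖x‖ = ‖y‖) :
    ∃ T : E n ≃ₗᵢ[ℝ] E n, T x = y ∧
      ∀ a, inner ℝ a x = inner ℝ a y → T a = a := by
  refine ⟨(ℝ ∙ (x - y))ᗮ.reflection, Submodule.reflection_sub h, fun a ha => ?_⟩
  refine Submodule.reflection_mem_subspace_eq_self ?_
  rw [Submodule.mem_orthogonal_singleton_iff_inner_left, inner_sub_right, ha, sub_self]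

theorem integral_orth_eq_of_norm_eq {x y : E n} (h : ‖x‖ = ‖y‖) (F : E n → ℝ) :
    ∫ R : Orth n, F ((R : E n →L[ℝ] E n) x) ∂(orthHaar n) =
      ∫ R : Orth n, F ((R : E n →L[ℝ] E n) y) ∂(orthHaar n) := by
  obtain ⟨T, hT, -⟩ := exists_isometry_swap h
  rw [← hT]
  exact (integral_orth_comp T (fun u _ => F u) x x).symm

theorem integral_sphere_orth (R : Orth n) (f : E n → ℝ) :
    ∫ θ : S n, f ((R : E n →L[ℝ] E n) θ) ∂(sph n) = ∫ θ : S n, f θ ∂(sph n) :=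
  integral_sphere_comp_isometry (Unitary.linearIsometryEquiv R) f

/-- A random rotation of a unit vector is uniformly distributed. -/
theorem integral_orth_eq_integral_sphere {a : E n} (ha : ‖a‖ = 1) {F : E n → ℝ}
    (hF : Continuous F) :
    (sph n).real Set.univ * ∫ R : Orth n, F ((R : E n →L[ℝ] E n) a) ∂(orthHaar n) =
      (orthHaar n).real Set.univ * ∫ θ : S n, F θ ∂(sph n) := by
  -- The double integral over sphere and group is evaluated in both orders: each inner integral is
  -- constant in the outer variable.
  have h1 : ∫ θ : S n, ∫ R : Orth n, F ((R : E n →L[ℝ] E n) θ) ∂(orthHaar n) ∂(sph n) =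
      (sph n).real Set.univ * ∫ R : Orth n, F ((R : E n →L[ℝ] E n) a) ∂(orthHaar n) := by
    have : ∀ θ : S n, ∫ R : Orth n, F ((R : E n →L[ℝ] E n) θ) ∂(orthHaar n) =
        ∫ R : Orth n, F ((R : E n →L[ℝ] E n) a) ∂(orthHaar n) := fun θ =>
      integral_orth_eq_of_norm_eq (by rw [ha, sph_norm]) F
    simp only [this, integral_const, smul_eq_mul]
  have h2 : ∫ R : Orth n, ∫ θ : S n, F ((R : E n →L[ℝ] E n) θ) ∂(sph n) ∂(orthHaar n) =
      (orthHaar n).real Set.univ * ∫ θ : S n, F θ ∂(sph n) := by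
    simp only [integral_sphere_orth, integral_const, smul_eq_mul]
  rw [← h1, ← h2]
  refine integral_integral_swap_of_hasCompactSupport
    (f := fun (θ : S n) (R : Orth n) => F ((R : E n →L[ℝ] E n) θ)) ?_
    (HasCompactSupport.of_compactSpace _)
  exact hF.comp (continuous_orth_apply continuous_snd (continuous_subtype_val.comp continuous_fst))

/-- The squared norm of the part of the derivative tangent to the sphere. -/
def tangSq (f : E n → ℝ) (x : E n) : ℝ := ‖fderiv ℝ f x‖ ^ 2 - fderiv ℝ f x x ^ 2

theorem norm_fderiv_sq_eq_sum (L : E n →L[ℝ] ℝ) (R : Orth n) :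
    ‖L‖ ^ 2 = ∑ i, L ((R : E n →L[ℝ] E n) (EuclideanSpace.single i (1 : ℝ))) ^ 2 := by
  set v := (InnerProductSpace.toDual ℝ (E n)).symm L with hv
  have h1 : ‖L‖ = ‖v‖ := by rw [hv, LinearIsometryEquiv.norm_map]
  have h2 : ∀ x, L x = inner ℝ v x := fun x => by
    rw [hv, InnerProductSpace.toDual_symm_apply]
  let b := (EuclideanSpace.basisFun (Fin n) ℝ).map (Unitary.linearIsometryEquiv R)
  rw [h1, ← b.sum_sq_norm_inner_left v]
  refine Finset.sum_congr rfl fun i _ => ?_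
  rw [h2, Real.norm_eq_abs, sq_abs]
  have hb : b i = (R : E n →L[ℝ] E n) (EuclideanSpace.single i 1) := by
    simp only [b, OrthonormalBasis.map_apply, EuclideanSpace.basisFun_apply]
    rfl
  rw [hb]

section

variable {f : E n → ℝ}

theorem continuous_fderiv_apply (hf : ContDiff ℝ 1 f) {X : Type*} [TopologicalSpace X]
    {u v : X → E n} (hu : Continuous u) (hv : Continuous v) :
    Continuous fun x => fderiv ℝ f (u x) (v x) :=
  ((hf.continuous_fderiv (by simp)).comp hu).clm_apply hv

theorem continuous_tangSq (hf : ContDiff ℝ 1 f) : Continuous (tangSq f) :=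
  (((hf.continuous_fderiv (by simp)).norm).pow 2).sub
    ((continuous_fderiv_apply hf continuous_id continuous_id).pow 2)

/-- In the orthonormal frame `R e_j` the tangential norm is a sum of `n - 1` squares. Isometries
fixing `e_i` and moving `e_j` to `v` show that all have the same mean. -/
theorem integral_orth_tangSq (hf : ContDiff ℝ 1 f) (i : Fin n) {v : E n} (hv : ‖v‖ = 1)
    (hav : inner ℝ (EuclideanSpace.single i (1 : ℝ)) v = 0) :
    ∫ R : Orth n, tangSq f ((R : E n →L[ℝ] E n) (EuclideanSpace.single i 1)) ∂(orthHaar n) =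
      ((n : ℝ) - 1) * ∫ R : Orth n, fderiv ℝ f ((R : E n →L[ℝ] E n) (EuclideanSpace.single i 1))
        ((R : E n →L[ℝ] E n) v) ^ 2 ∂(orthHaar n) := by
  set e : Fin n → E n := fun j => EuclideanSpace.single j (1 : ℝ)
  have hc : ∀ w : E n, Continuous fun R : Orth n => fderiv ℝ f ((R : E n →L[ℝ] E n) (e i))
      ((R : E n →L[ℝ] E n) w) ^ 2 := fun w =>
    (continuous_fderiv_apply hf (continuous_orth_apply continuous_id continuous_const)
      (continuous_orth_apply continuous_id continuous_const)).pow 2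
  have h1 : ∀ j ∈ Finset.univ.erase i, ∫ R : Orth n, fderiv ℝ f ((R : E n →L[ℝ] E n) (e i))
        ((R : E n →L[ℝ] E n) (e j)) ^ 2 ∂(orthHaar n) =
      ∫ R : Orth n, fderiv ℝ f ((R : E n →L[ℝ] E n) (e i))
        ((R : E n →L[ℝ] E n) v) ^ 2 ∂(orthHaar n) := by
    intro j hj
    have hij : inner ℝ (e i) (e j) = 0 := by
      have := (Finset.mem_erase.1 hj).1
      simp only [e, inner_single_left']
      simp [this.symm]
    obtain ⟨T, hT, hTa⟩ := exists_isometry_swap (x := e j) (y := v) (by rw [hv]; simp [e])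
    have h2 := integral_orth_comp T (fun u w => fderiv ℝ f u w ^ 2) (e i) (e j)
    rw [hT, hTa (e i) (by rw [hij, hav])] at h2
    exact h2.symm
  have h2 : ∀ R : Orth n, tangSq f ((R : E n →L[ℝ] E n) (e i)) =
      ∑ j ∈ Finset.univ.erase i, fderiv ℝ f ((R : E n →L[ℝ] E n) (e i))
        ((R : E n →L[ℝ] E n) (e j)) ^ 2 := fun R => by
    rw [tangSq, norm_fderiv_sq_eq_sum _ R, ← Finset.add_sum_erase _ _ (Finset.mem_univ i)]
    simp only [e]
    ring
  rw [integral_congr_ae (Eventually.of_forall h2)]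
  rw [integral_finsetSum _ fun j _ => integrable_of_compact (hc (e j)), Finset.sum_congr rfl h1,
    Finset.sum_const, Finset.card_erase_of_mem (Finset.mem_univ i), Finset.card_univ,
    Fintype.card_fin, nsmul_eq_mul, Nat.cast_pred (Nat.pos_of_ne_zero (Fin.pos i).ne')]

/-- The arc of the unit circle in the plane of `a` and `v`. -/
def arc (a v : E n) (s : ℝ) : E n := Real.cos s • a + Real.sin s • v

theorem continuous_arc (a v : E n) : Continuous (arc a v) := by unfold arc; fun_prop

theorem rot_arc {a v : E n} (ha : ‖a‖ = 1) (hv : ‖v‖ = 1) (hav : inner ℝ a v = 0) (s t : ℝ) :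
    rot ha hv hav t (arc a v s) = arc a v (s + t) := by
  have hva : inner ℝ v a = 0 := by rw [real_inner_comm]; exact hav
  change rotFun a v t (arc a v s) = _
  simp only [rotFun, arc, inner_add_right, inner_smul_right, real_inner_self_eq_norm_sq, ha, hv,
    hav, hva, Real.cos_add, Real.sin_add]
  module

/-- The mean square increment between two points of the sphere, over all rotations. -/
theorem integral_orth_increment_le (hf : ContDiff ℝ 1 f) {a v : E n} (ha : ‖a‖ = 1) (hv : ‖v‖ = 1)
    (hav : inner ℝ a v = 0) (d : ℝ) :
    ∫ R : Orth n, (f ((R : E n →L[ℝ] E n) (arc a v d)) - f ((R : E n →L[ℝ] E n) a)) ^ 2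
        ∂(orthHaar n) ≤
      2 * (1 - Real.cos d) * ∫ R : Orth n, fderiv ℝ f ((R : E n →L[ℝ] E n) a)
        ((R : E n →L[ℝ] E n) v) ^ 2 ∂(orthHaar n) := by
  have hpi := Real.two_pi_pos
  have harc0 : arc a v 0 = a := by simp [arc]
  have harc1 : arc a v (Real.pi / 2) = v := by simp [arc]
  set g : Orth n → ℝ → ℝ := fun R s => f ((R : E n →L[ℝ] E n) (arc a v s))
  set g' : Orth n → ℝ → ℝ := fun R s => fderiv ℝ f ((R : E n →L[ℝ] E n) (arc a v s))
    ((R : E n →L[ℝ] E n) (arc a v (Real.pi / 2 + s)))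
  have hR : Continuous fun p : ℝ × Orth n => p.2 := continuous_snd
  have hgc : Continuous fun p : ℝ × Orth n => g p.2 p.1 :=
    hf.continuous.comp (continuous_orth_apply hR ((continuous_arc a v).comp continuous_fst))
  have hgc' : Continuous fun p : ℝ × Orth n => g' p.2 p.1 :=
    continuous_fderiv_apply hf (continuous_orth_apply hR ((continuous_arc a v).comp continuous_fst))
      (continuous_orth_apply hR ((continuous_arc a v).comp (continuous_const.add continuous_fst)))
  have hd : ∀ R s, HasDerivAt (g R) (g' R s) s := by
    intro R s
    have h1 : HasDerivAt (arc a v) (arc a v (Real.pi / 2 + s)) s := by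
      have := ((Real.hasDerivAt_cos s).smul_const a).add ((Real.hasDerivAt_sin s).smul_const v)
      refine this.congr_deriv ?_
      simp [arc, Real.cos_add, Real.sin_add]
    have h2 : HasDerivAt (fun s => (R : E n →L[ℝ] E n) (arc a v s))
        ((R : E n →L[ℝ] E n) (arc a v (Real.pi / 2 + s))) s :=
      (R : E n →L[ℝ] E n).hasFDerivAt.comp_hasDerivAt s h1
    exact ((hf.differentiable (by simp)) _).hasFDerivAt.comp_hasDerivAt s h2
  have hper : ∀ R, Function.Periodic (g R) (2 * Real.pi) := fun R s => by
    simp only [g, arc, Real.cos_add_two_pi, Real.sin_add_two_pi]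
  have hsl : ∀ R, Continuous (g' R) := fun R => hgc'.comp (continuous_id.prodMk continuous_const)
  have hint : ∀ F : ℝ × Orth n → ℝ, Continuous F →
      Integrable F ((volume.restrict (Set.uIoc 0 (2 * Real.pi))).prod (orthHaar n)) := by
    intro F hF
    have h1 : IntegrableOn F (Set.Icc 0 (2 * Real.pi) ×ˢ Set.univ) (volume.prod (orthHaar n)) :=
      hF.continuousOn.integrableOn_compact (isCompact_Icc.prod isCompact_univ)
    have h2 : (volume.restrict (Set.uIoc 0 (2 * Real.pi))).prod (orthHaar n) =
        (volume.prod (orthHaar n)).restrict (Set.uIoc 0 (2 * Real.pi) ×ˢ Set.univ) := by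
      rw [← Measure.prod_restrict, Measure.restrict_univ]
    rw [h2]
    refine h1.mono_set (Set.prod_mono ?_ subset_rfl)
    rw [Set.uIoc_of_le hpi.le]
    exact Set.Ioc_subset_Icc_self
  -- Rotating along the arc is absorbed by the group, so neither mean depends on `s`. Integrating
  -- the circle inequality over `s` and `R` therefore gives the claim times `2π`.
  have s1 : ∀ s, ∫ R : Orth n, (g R (s + d) - g R s) ^ 2 ∂(orthHaar n) =
      ∫ R : Orth n, (f ((R : E n →L[ℝ] E n) (arc a v d)) - f ((R : E n →L[ℝ] E n) a)) ^ 2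
        ∂(orthHaar n) := by
    intro s
    have := integral_orth_comp (rot ha hv hav s) (fun x y => (f x - f y) ^ 2) (arc a v d)
      (arc a v 0)
    rw [rot_arc, rot_arc, harc0, zero_add, add_comm d s] at this
    exact this
  have s2 : ∀ s, ∫ R : Orth n, g' R s ^ 2 ∂(orthHaar n) =
      ∫ R : Orth n, fderiv ℝ f ((R : E n →L[ℝ] E n) a) ((R : E n →L[ℝ] E n) v) ^ 2
        ∂(orthHaar n) := by
    intro s
    have := integral_orth_comp (rot ha hv hav s) (fun x y => fderiv ℝ f x y ^ 2) (arc a v 0)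
      (arc a v (Real.pi / 2))
    rw [rot_arc, rot_arc, harc0, harc1, zero_add] at this
    exact this
  have c1 : Continuous fun p : ℝ × Orth n => (g p.2 (p.1 + d) - g p.2 p.1) ^ 2 :=
    ((hgc.comp ((continuous_fst.add continuous_const).prodMk continuous_snd)).sub hgc).pow 2
  have c2 : Continuous fun p : ℝ × Orth n => g' p.2 p.1 ^ 2 := hgc'.pow 2
  have f1 := intervalIntegral_integral_swap (f := fun s (R : Orth n) => (g R (s + d) - g R s) ^ 2)
    (hint _ c1)
  have f2 := intervalIntegral_integral_swap (f := fun s (R : Orth n) => g' R s ^ 2)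
    (hint _ c2)
  simp only [s1, intervalIntegral.integral_const, sub_zero, smul_eq_mul] at f1
  simp only [s2, intervalIntegral.integral_const, sub_zero, smul_eq_mul] at f2
  have hle : ∫ R : Orth n, (∫ s in (0 : ℝ)..2 * Real.pi, (g R (s + d) - g R s) ^ 2) ∂(orthHaar n) ≤
      ∫ R : Orth n, 2 * (1 - Real.cos d) * (∫ s in (0 : ℝ)..2 * Real.pi, g' R s ^ 2)
        ∂(orthHaar n) := by
    refine integral_mono ?_ ?_ fun R => integral_increment_sq_le (hd R) (hsl R) (hper R) d
    · refine integrable_of_compact ?_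
      exact intervalIntegral.continuous_parametric_intervalIntegral_of_continuous'
        (f := fun (R : Orth n) s => (g R (s + d) - g R s) ^ 2) (c1.comp continuous_swap) _ _
    · refine integrable_of_compact (continuous_const.mul ?_)
      exact intervalIntegral.continuous_parametric_intervalIntegral_of_continuous'
        (f := fun (R : Orth n) s => g' R s ^ 2) (c2.comp continuous_swap) _ _
  rw [integral_const_mul, ← f1, ← f2] at hle
  rw [mul_left_comm] at hle
  exact le_of_mul_le_mul_left hle hpi

/-- The sharp Poincaré inequality on the unit sphere. -/
theorem sphere_poincare (hn : 2 ≤ n) (hf : ContDiff ℝ 1 f) :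
    ((n : ℝ) - 1) * (∫ θ : S n, f θ ^ 2 ∂(sph n) -
      (∫ θ : S n, f θ ∂(sph n)) ^ 2 / (sph n).real Set.univ) ≤ ∫ θ : S n, tangSq f θ ∂(sph n) := by
  have hn2 : (2 : ℝ) ≤ n := by exact_mod_cast hn
  set i : Fin n := ⟨0, by omega⟩
  set j : Fin n := ⟨1, by omega⟩
  set a : E n := EuclideanSpace.single i 1 with ha_def
  set b : E n := EuclideanSpace.single j 1
  have ha : ‖a‖ = 1 := by simp [a]
  have hb : ‖b‖ = 1 := by simp [b]
  have hab : inner ℝ a b = 0 := by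
    simp only [a, b, inner_single_left']
    simp [i, j]
  set K := ∫ R : Orth n, fderiv ℝ f ((R : E n →L[ℝ] E n) a) ((R : E n →L[ℝ] E n) b) ^ 2
    ∂(orthHaar n) with hK
  have hK' : ∀ v : E n, ‖v‖ = 1 → inner ℝ a v = 0 → ∫ R : Orth n, fderiv ℝ f
      ((R : E n →L[ℝ] E n) a) ((R : E n →L[ℝ] E n) v) ^ 2 ∂(orthHaar n) = K := by
    intro v hv hav
    have h1 := integral_orth_tangSq hf i hv hav
    rw [integral_orth_tangSq hf i hb hab] at h1
    exact (mul_left_cancel₀ (by linarith) h1).symm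
  -- Each `y` lies on a great circle through `a`, at arc length `arccos ⟨a, y⟩`.
  have hpt : ∀ y : S n, ∫ R : Orth n, (f ((R : E n →L[ℝ] E n) y) - f ((R : E n →L[ℝ] E n) a)) ^ 2
      ∂(orthHaar n) ≤ 2 * (1 - inner ℝ a (y : E n)) * K := by
    intro y
    set α := inner ℝ a (y : E n) with hα
    have hsq := norm_tang_sq (θ := ⟨a, by simpa using ha⟩) (sph_norm y)
    have hα1 : |α| ≤ 1 := by simpa [ha, sph_norm] using abs_real_inner_le_norm a (y : E n)
    have hcos : Real.cos (Real.arccos α) = α :=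
      Real.cos_arccos (abs_le.1 hα1).1 (abs_le.1 hα1).2
    have hsin : Real.sin (Real.arccos α) = √(1 - α ^ 2) := Real.sin_arccos α
    simp only [tang] at hsq
    rw [real_inner_comm, ← hα] at hsq
    have hinner : inner ℝ a ((y : E n) - α • a) = 0 := by
      rw [inner_sub_right, inner_smul_right, real_inner_self_eq_norm_sq, ha, ← hα]; ring
    have hnorm : ‖(y : E n) - α • a‖ = √(1 - α ^ 2) := by
      rw [← hsq, Real.sqrt_sq (norm_nonneg _)]
    obtain ⟨v, hv, hav, hy⟩ : ∃ v : E n, ‖v‖ = 1 ∧ inner ℝ a v = 0 ∧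
        (y : E n) = arc a v (Real.arccos α) := by
      -- If `y = ±a` the great circle is not unique, and the one through `b` is taken.
      by_cases h0 : (y : E n) - α • a = 0
      · refine ⟨b, hb, hab, ?_⟩
        rw [arc, hcos, hsin, ← hnorm, h0, norm_zero, zero_smul, add_zero]
        exact sub_eq_zero.1 h0
      · have h1 := norm_pos_iff.2 h0
        refine ⟨‖(y : E n) - α • a‖⁻¹ • ((y : E n) - α • a), ?_, ?_, ?_⟩
        · rw [norm_smul, norm_inv, norm_norm, inv_mul_cancel₀ h1.ne']
        · rw [inner_smul_right, hinner, mul_zero]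
        · rw [arc, hcos, hsin, ← hnorm, smul_smul, mul_inv_cancel₀ h1.ne', one_smul,
            add_sub_cancel]
    have := integral_orth_increment_le hf ha hv hav (Real.arccos α)
    rw [← hy, hcos, hK' v hv hav] at this
    exact this
  set s := (sph n).real Set.univ
  set m := (orthHaar n).real Set.univ
  have hm : 0 < m := orthHaar_univ_pos
  have cS : ∀ F : E n → ℝ, Continuous F → Continuous fun θ : S n => F θ := fun F hF =>
    hF.comp continuous_subtype_val
  have cO : ∀ F : E n → ℝ, Continuous F →
      Continuous fun R : Orth n => F ((R : E n →L[ℝ] E n) a) := fun F hF =>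
    hF.comp (continuous_orth_apply continuous_id continuous_const)
  have cΦ : Continuous fun p : S n × Orth n =>
      (f ((p.2 : E n →L[ℝ] E n) p.1) - f ((p.2 : E n →L[ℝ] E n) a)) ^ 2 :=
    ((hf.continuous.comp (continuous_orth_apply continuous_snd
      (continuous_subtype_val.comp continuous_fst))).sub
      (hf.continuous.comp (continuous_orth_apply continuous_snd continuous_const))).pow 2
  have hΦ : Continuous fun y : S n => ∫ R : Orth n, (f ((R : E n →L[ℝ] E n) y) -
      f ((R : E n →L[ℝ] E n) a)) ^ 2 ∂(orthHaar n) := by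
    have := continuous_parametric_integral_of_continuous (μ := orthHaar n)
      (f := fun (y : S n) (R : Orth n) => (f ((R : E n →L[ℝ] E n) y) -
      f ((R : E n →L[ℝ] E n) a)) ^ 2) cΦ isCompact_univ
    simpa using this
  -- On averaging over `y`, the factor `1 - ⟨a, y⟩` has mean one.
  have hlin : ∫ θ : S n, inner ℝ a (θ : E n) ∂(sph n) = 0 := by
    have h1 := integral_sphere_tangent (U := Set.univ) isOpen_univ (fun _ => trivial)
      (ψ := fun _ : E n => (1 : ℝ)) contDiffOn_const a
    simp only [fderiv_fun_const, Pi.zero_apply, _root_.zero_apply, integral_zero,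
      mul_one] at h1
    exact (mul_eq_zero.1 h1.symm).resolve_left (by linarith)
  have cin : Continuous fun θ : S n => inner ℝ a (θ : E n) := by fun_prop
  have hmain := integral_mono (μ := sph n) (integrable_of_compact hΦ)
    (integrable_of_compact (f := fun y : S n => 2 * (1 - inner ℝ a (y : E n)) * K)
      ((continuous_const.mul (continuous_const.sub cin)).mul continuous_const)) hpt
  rw [integral_mul_const, integral_const_mul, integral_sub (integrable_const _)
    (integrable_of_compact cin), hlin, integral_const, smul_eq_mul, mul_one, sub_zero] at hmain
  rw [integral_integral_swap_of_hasCompactSupport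
    (f := fun (y : S n) (R : Orth n) => (f ((R : E n →L[ℝ] E n) y) -
      f ((R : E n →L[ℝ] E n) a)) ^ 2) cΦ (HasCompactSupport.of_compactSpace _)] at hmain
  have iS1 : Integrable (fun θ : S n => f θ) (sph n) := integrable_of_compact (cS f hf.continuous)
  have iS2 : Integrable (fun θ : S n => f θ ^ 2) (sph n) :=
    integrable_of_compact (cS _ (hf.continuous.pow 2))
  -- Expanding the square: for two independent uniform points, the mean square difference is twice
  -- the variance.
  have e1 : ∀ R : Orth n, ∫ y : S n, (f ((R : E n →L[ℝ] E n) y) - f ((R : E n →L[ℝ] E n) a)) ^ 2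
      ∂(sph n) = ∫ θ : S n, f θ ^ 2 ∂(sph n) -
        (2 * ∫ θ : S n, f θ ∂(sph n)) * f ((R : E n →L[ℝ] E n) a) +
        s * f ((R : E n →L[ℝ] E n) a) ^ 2 := by
    intro R
    rw [integral_sphere_orth R (fun x => (f x - f ((R : E n →L[ℝ] E n) a)) ^ 2)]
    have : ∀ θ : S n, (f θ - f ((R : E n →L[ℝ] E n) a)) ^ 2 = f θ ^ 2 -
        (2 * f ((R : E n →L[ℝ] E n) a)) * f θ + f ((R : E n →L[ℝ] E n) a) ^ 2 := fun θ => by ring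
    simp only [this]
    have j : Integrable (fun θ : S n => f θ ^ 2 - (2 * f ((R : E n →L[ℝ] E n) a)) * f θ) (sph n) :=
      iS2.sub (iS1.const_mul _)
    rw [integral_add j (integrable_const _), integral_sub iS2
      (iS1.const_mul _), integral_const_mul, integral_const, smul_eq_mul]
    ring
  simp only [e1] at hmain
  have iO1 : Integrable (fun R : Orth n => f ((R : E n →L[ℝ] E n) a)) (orthHaar n) :=
    integrable_of_compact (cO f hf.continuous)
  have iO2 : Integrable (fun R : Orth n => f ((R : E n →L[ℝ] E n) a) ^ 2) (orthHaar n) :=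
    integrable_of_compact (cO _ (hf.continuous.pow 2))
  have j : Integrable (fun R : Orth n => ∫ θ : S n, f θ ^ 2 ∂(sph n) -
      (2 * ∫ θ : S n, f θ ∂(sph n)) * f ((R : E n →L[ℝ] E n) a)) (orthHaar n) :=
    (integrable_const _).sub (iO1.const_mul _)
  rw [integral_add j (iO2.const_mul _),
    integral_sub (integrable_const _) (iO1.const_mul _), integral_const_mul, integral_const_mul,
    integral_const, smul_eq_mul] at hmain
  have h0 : s * ∫ R : Orth n, f ((R : E n →L[ℝ] E n) a) ^ 2 ∂(orthHaar n) =
      m * ∫ θ : S n, f θ ^ 2 ∂(sph n) :=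
    integral_orth_eq_integral_sphere ha (F := fun x => f x ^ 2) (hf.continuous.pow 2)
  rw [h0] at hmain
  have h1 := integral_orth_eq_integral_sphere ha hf.continuous
  have h2 := integral_orth_eq_integral_sphere ha (continuous_tangSq hf)
  rw [integral_orth_tangSq hf i hb hab, ← hK] at h2
  have hs : 0 < s := by
    have : Nonempty (S n) := ⟨⟨a, by simpa using ha⟩⟩
    rw [show s = (sph n).real Set.univ from rfl, measureReal_def]
    refine ENNReal.toReal_pos ?_ (measure_ne_top _ _)
    rw [Measure.toSphere_apply_univ]
    have hv : (volume : Measure (E n)) (Metric.ball 0 1) ≠ 0 :=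
      (Metric.isOpen_ball.measure_pos _ ⟨0, by simp⟩).ne'
    simpa using ⟨by omega, hv⟩
  set Q := ∫ θ : S n, f θ ∂(sph n)
  set B := ∫ θ : S n, f θ ^ 2 ∂(sph n)
  set A := ∫ R : Orth n, f ((R : E n →L[ℝ] E n) a) ∂(orthHaar n)
  change s * A = m * Q at h1
  have hA : A = m * Q / s := by rw [eq_div_iff hs.ne', ← h1]; ring
  rw [hA] at hmain
  have h3 : m * (B - Q ^ 2 / s) ≤ s * K := by
    have e : m * B - 2 * Q * (m * Q / s) + m * B = 2 * (m * (B - Q ^ 2 / s)) := by ring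
    rw [e] at hmain
    linarith
  have h4 := mul_le_mul_of_nonneg_left h3 (by linarith : (0 : ℝ) ≤ (n : ℝ) - 1)
  have h5 : ((n : ℝ) - 1) * (s * K) = m * ∫ θ : S n, tangSq f θ ∂(sph n) := by
    rw [← h2]; ring
  rw [h5, mul_left_comm] at h4
  exact le_of_mul_le_mul_left h4 hm

end

/-! ### Volume, gradient norm and surface measure on the perforated domain -/

theorem IsRadialFunction.continuousOn {ρ : E n → ℝ} (hρ : IsRadialFunction ρ) :
    ContinuousOn ρ {0}ᶜ := hρ.smooth.continuousOn

theorem IsRadialFunction.smul_sphere {ρ : E n → ℝ} (hρ : IsRadialFunction ρ) {r : ℝ} (hr : 0 < r)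
    (θ : S n) : ρ (r • (θ : E n)) = ρ θ := hρ.homogeneous r θ hr

theorem IsRadialFunction.const {R : ℝ} (hR : 0 < R) : IsRadialFunction (fun _ : E n => R) :=
  ⟨fun _ _ => hR, fun _ _ _ => rfl, contDiffOn_const⟩

theorem IsRadialFunction.continuous_sphere {ρ : E n → ℝ} (hρ : IsRadialFunction ρ) :
    Continuous fun θ : S n => ρ θ :=
  hρ.continuousOn.comp_continuous continuous_subtype_val fun θ => sph_ne_zero θ

theorem IsRadialFunction.le_of_sphere {ρ : E n → ℝ} (hρ : IsRadialFunction ρ) {B : ℝ}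
    (hB : ∀ θ : S n, ρ θ ≤ B) {x : E n} (hx : x ≠ 0) : ρ x ≤ B := by
  have h0 : 0 < ‖x‖ := norm_pos_iff.2 hx
  have h1 := hρ.homogeneous ‖x‖⁻¹ x (inv_pos.2 h0)
  rw [← h1]
  exact hB ⟨‖x‖⁻¹ • x, by simp [norm_smul, h0.ne']⟩

theorem IsRadialFunction.exists_bound {ρ : E n → ℝ} (hρ : IsRadialFunction ρ) :
    ∃ B, ∀ θ : S n, ρ θ ≤ B := by
  obtain ⟨B, hB⟩ := isCompact_univ.exists_bound_of_continuousOn hρ.continuous_sphere.continuousOn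
  exact ⟨B, fun θ => (le_abs_self _).trans (hB θ trivial)⟩

/-- The closed shell. -/
def shell (n : ℕ) (R₁ B : ℝ) : Set (E n) := {x | R₁ ≤ ‖x‖} ∩ Metric.closedBall 0 B

theorem isCompact_shell (R₁ B : ℝ) : IsCompact (shell n R₁ B) :=
  (isCompact_closedBall _ _).inter_left (isClosed_le continuous_const continuous_norm)

theorem shell_subset {R₁ B : ℝ} (hR : 0 < R₁) : shell n R₁ B ⊆ {0}ᶜ := by
  rintro x ⟨hx, -⟩ h0
  rw [Set.mem_singleton_iff.1 h0, Set.mem_ofPred_eq, norm_zero] at hx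
  linarith

theorem ne_zero_of_mem_perforated {ρ : E n → ℝ} {R₁ : ℝ} (hR : 0 < R₁) {x : E n}
    (hx : x ∈ perforated ρ R₁) : x ≠ 0 := norm_pos_iff.1 (hR.trans hx.1)

theorem perforated_subset_shell {ρ : E n → ℝ} (hρ : IsRadialFunction ρ) {R₁ B : ℝ} (hR : 0 < R₁)
    (hB : ∀ θ : S n, ρ θ ≤ B) : perforated ρ R₁ ⊆ shell n R₁ B := fun _ hx =>
  ⟨hx.1.le, mem_closedBall_zero_iff.2
    (hx.2.le.trans (hρ.le_of_sphere hB (ne_zero_of_mem_perforated hR hx)))⟩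

theorem isOpen_perforated {ρ : E n → ℝ} (hρ : IsRadialFunction ρ) {R₁ : ℝ} (hR : 0 < R₁) :
    IsOpen (perforated ρ R₁) := by
  have h1 : IsOpen ({0}ᶜ ∩ (fun x => ρ x - ‖x‖) ⁻¹' Set.Ioi 0) :=
    (hρ.continuousOn.sub continuous_norm.continuousOn).isOpen_inter_preimage
      isOpen_compl_singleton isOpen_Ioi
  have h2 : perforated ρ R₁ = {x | R₁ < ‖x‖} ∩ ({0}ᶜ ∩ (fun x => ρ x - ‖x‖) ⁻¹' Set.Ioi 0) := by
    ext x
    constructor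
    · intro hx
      exact ⟨hx.1, ne_zero_of_mem_perforated hR hx, sub_pos.2 hx.2⟩
    · rintro ⟨h1, -, h3⟩
      exact ⟨h1, sub_pos.1 h3⟩
  rw [h2]
  exact (isOpen_lt continuous_const continuous_norm).inter h1

/-- The density of the Riemannian volume. -/
def volDensity (n : ℕ) (h : ℝ → ℝ) (x : E n) : ℝ := (h ‖x‖ / ‖x‖) ^ (n - 1)

theorem continuousOn_volDensity {h : ℝ → ℝ} (hc : Continuous h) :
    ContinuousOn (volDensity n h) {0}ᶜ :=
  ((hc.comp continuous_norm).continuousOn.div continuous_norm.continuousOn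
    fun _ hx => norm_ne_zero_iff.2 hx).pow _

theorem measurable_volDensity {h : ℝ → ℝ} (hc : Continuous h) : Measurable (volDensity n h) :=
  ((hc.measurable.comp measurable_norm).div measurable_norm).pow_const _

theorem volDensity_nonneg {h : ℝ → ℝ} (hp : ∀ r, 0 < h r) (x : E n) : 0 ≤ volDensity n h x :=
  pow_nonneg (div_nonneg (hp _).le (norm_nonneg _)) _

theorem vol_ac (h : ℝ → ℝ) (ρ : E n → ℝ) (R₁ : ℝ) :
    vol h ρ R₁ ≪ volume.restrict (perforated ρ R₁) := withDensity_absolutelyContinuous _ _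

theorem ae_vol_mem {h : ℝ → ℝ} {ρ : E n → ℝ} (hρ : IsRadialFunction ρ) {R₁ : ℝ} (hR : 0 < R₁) :
    ∀ᵐ x ∂(vol h ρ R₁), x ∈ perforated ρ R₁ :=
  (vol_ac h ρ R₁).ae_le (ae_restrict_mem (isOpen_perforated hρ hR).measurableSet)

theorem isFiniteMeasure_vol {h : ℝ → ℝ} (hc : Continuous h) {ρ : E n → ℝ}
    (hρ : IsRadialFunction ρ) {R₁ : ℝ} (hR : 0 < R₁) : IsFiniteMeasure (vol h ρ R₁) := by
  obtain ⟨B, hB⟩ := hρ.exists_bound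
  have h1 : IntegrableOn (volDensity n h) (perforated ρ R₁) :=
    (((continuousOn_volDensity hc).mono (shell_subset hR)).integrableOn_compact
      (isCompact_shell R₁ B)).mono_set (perforated_subset_shell hρ hR hB)
  exact isFiniteMeasure_withDensity_ofReal h1.2

theorem aestronglyMeasurable_vol {h : ℝ → ℝ} {ρ : E n → ℝ}
    (hρ : IsRadialFunction ρ) {R₁ : ℝ} (hR : 0 < R₁) {F : Type*} [NormedAddCommGroup F]
    {f : E n → F} (hf : ContinuousOn f {0}ᶜ) [SecondCountableTopologyEither (E n) F] :
    AEStronglyMeasurable f (vol h ρ R₁) := by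
  refine AEStronglyMeasurable.mono_ac (vol_ac h ρ R₁) ?_
  refine (hf.mono fun x hx => ?_).aestronglyMeasurable (isOpen_perforated hρ hR).measurableSet
  exact ne_zero_of_mem_perforated hR hx

theorem exists_bound_vol {h : ℝ → ℝ} {ρ : E n → ℝ}
    (hρ : IsRadialFunction ρ) {R₁ : ℝ} (hR : 0 < R₁) {F : Type*} [NormedAddCommGroup F]
    {f : E n → F} (hf : ContinuousOn f {0}ᶜ) : ∃ C, ∀ᵐ x ∂(vol h ρ R₁), ‖f x‖ ≤ C := by
  obtain ⟨B, hB⟩ := hρ.exists_bound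
  obtain ⟨C, hC⟩ := (isCompact_shell R₁ B).exists_bound_of_continuousOn
    (hf.mono (shell_subset (n := n) hR))
  refine ⟨C, ?_⟩
  filter_upwards [ae_vol_mem hρ hR] with x hx
  exact hC x (perforated_subset_shell hρ hR hB hx)

theorem memLp_vol {h : ℝ → ℝ} (hc : Continuous h) {ρ : E n → ℝ}
    (hρ : IsRadialFunction ρ) {R₁ : ℝ} (hR : 0 < R₁) {F : Type*} [NormedAddCommGroup F]
    {f : E n → F} (hf : ContinuousOn f {0}ᶜ) [SecondCountableTopologyEither (E n) F] :
    MemLp f 2 (vol h ρ R₁) := by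
  have := isFiniteMeasure_vol hc hρ hR
  obtain ⟨C, hC⟩ := exists_bound_vol (h := h) hρ hR hf
  exact MemLp.of_bound (aestronglyMeasurable_vol hρ hR hf) C hC

/-- Integration in polar coordinates over the perforated domain. -/
theorem integral_vol {h : ℝ → ℝ} (hc : Continuous h) (hp : ∀ r, 0 < h r) {ρ : E n → ℝ}
    (hρ : IsRadialFunction ρ) {R₁ : ℝ} (hR : 0 < R₁) (hR₁ : ∀ θ : S n, R₁ ≤ ρ θ)
    {f : E n → ℝ} (hf : ContinuousOn f {0}ᶜ) (hn : n ≠ 0) :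
    ∫ x, f x ∂(vol h ρ R₁) =
      ∫ θ : S n, (∫ r in R₁..ρ θ, h r ^ (n - 1) * f (r • (θ : E n))) ∂(sph n) := by
  have : Nontrivial (E n) := by
    have : Nonempty (Fin n) := ⟨⟨0, Nat.pos_of_ne_zero hn⟩⟩
    infer_instance
  obtain ⟨B, hB⟩ := hρ.exists_bound
  have hmeas := (isOpen_perforated hρ hR).measurableSet
  set g : E n → ℝ := (perforated ρ R₁).indicator fun x => volDensity n h x * f x with hg
  have h1 : ∫ x, f x ∂(vol h ρ R₁) = ∫ x, g x := by
    rw [hg, integral_indicator hmeas]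
    have h2 := integral_withDensity_eq_integral_smul
      (μ := volume.restrict (perforated ρ R₁)) (measurable_volDensity (n := n) hc).real_toNNReal f
    refine h2.trans (integral_congr_ae (Eventually.of_forall fun x => ?_))
    simp only [NNReal.smul_def, smul_eq_mul, Real.coe_toNNReal _ (volDensity_nonneg hp x)]
  have hgi : Integrable g := by
    rw [hg, integrable_indicator_iff hmeas]
    exact ((((continuousOn_volDensity hc).mul hf).mono (shell_subset hR)).integrableOn_compact
      (isCompact_shell R₁ B)).mono_set (perforated_subset_shell hρ hR hB)
  set G : S n × Set.Ioi (0 : ℝ) → ℝ := fun p => g ((p.2 : ℝ) • (p.1 : E n)) with hG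
  have hGg : ∀ x : ({0}ᶜ : Set (E n)), G (homeomorphUnitSphereProd (E n) x) = g x := by
    intro x
    have : ‖(x : E n)‖ ≠ 0 := norm_ne_zero_iff.2 x.2
    simp only [hG, homeomorphUnitSphereProd_apply_fst_coe, homeomorphUnitSphereProd_apply_snd_coe,
      smul_smul, mul_inv_cancel₀ this, one_smul]
  have hmp := (volume : Measure (E n)).measurePreserving_homeomorphUnitSphereProd
  have hemb := Homeomorph.measurableEmbedding (homeomorphUnitSphereProd (E n))
  have hGi : Integrable G ((sph n).prod (.volumeIoiPow (Module.finrank ℝ (E n) - 1))) := by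
    rw [← hmp.integrable_comp_emb hemb]
    have : (G ∘ homeomorphUnitSphereProd (E n)) = g ∘ Subtype.val := funext hGg
    rw [this, ← integrableOn_iff_comap_subtypeVal (measurableSet_singleton _).compl]
    exact hgi.integrableOn
  rw [h1]
  calc ∫ x, g x = ∫ x : ({0}ᶜ : Set (E n)), g x ∂((volume : Measure (E n)).comap (↑)) := by
        rw [integral_subtype_comap (measurableSet_singleton _).compl g,
          restrict_compl_singleton]
    _ = ∫ p, G p ∂((sph n).prod (.volumeIoiPow (Module.finrank ℝ (E n) - 1))) := by
        rw [← hmp.integral_comp hemb]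
        exact integral_congr_ae (Eventually.of_forall fun x => (hGg x).symm)
    _ = ∫ θ : S n, (∫ r : Set.Ioi (0 : ℝ), G (θ, r) ∂(.volumeIoiPow (Module.finrank ℝ (E n) - 1)))
          ∂(sph n) := integral_prod _ hGi
    _ = _ := by
        refine integral_congr_ae (Eventually.of_forall fun θ => ?_)
        simp only [Measure.volumeIoiPow, ENNReal.ofReal, finrank_euclideanSpace, Fintype.card_fin]
        rw [integral_withDensity_eq_integral_smul (measurable_subtype_coe.pow_const _).real_toNNReal,
          integral_subtype_comap measurableSet_Ioi
            fun r => Real.toNNReal (r ^ (n - 1)) • g (r • (θ : E n)),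
          intervalIntegral.integral_of_le (hR₁ θ), integral_Ioc_eq_integral_Ioo]
        have hmem : ∀ r : ℝ, 0 < r → (r • (θ : E n) ∈ perforated ρ R₁ ↔ r ∈ Set.Ioo R₁ (ρ θ)) := by
          intro r hr
          rw [perforated, Set.mem_ofPred_eq, norm_smul, sph_norm, mul_one, Real.norm_of_nonneg hr.le,
            hρ.smul_sphere hr, Set.mem_Ioo]
        rw [setIntegral_eq_of_subset_of_forall_sdiff_eq_zero measurableSet_Ioi
          (s := Set.Ioo R₁ (ρ θ)) fun r hr => hR.trans hr.1]
        · refine setIntegral_congr_fun measurableSet_Ioo fun r hr => ?_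
          have hr0 : 0 < r := hR.trans hr.1
          simp only [hg, NNReal.smul_def, smul_eq_mul, Real.coe_toNNReal _ (pow_nonneg hr0.le _)]
          rw [Set.indicator_of_mem ((hmem r hr0).2 hr), volDensity, norm_smul, sph_norm, mul_one,
            Real.norm_of_nonneg hr0.le, ← mul_assoc, ← mul_pow, mul_div_cancel₀ _ hr0.ne']
        · rintro r ⟨hr, hr'⟩
          simp only [hg]
          rw [Set.indicator_of_notMem fun h => hr' ((hmem r hr).1 h), smul_zero]

theorem abs_inner_radial_le (x G : E n) : |inner ℝ (radial x) G| ≤ ‖G‖ := by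
  have h1 : ‖radial x‖ ≤ 1 := by
    rw [radial, norm_smul, norm_inv, norm_norm]
    exact inv_mul_le_one
  exact (abs_real_inner_le_norm _ _).trans (mul_le_of_le_one_left (norm_nonneg _) h1)

theorem sq_inner_radial_le (x G : E n) : inner ℝ (radial x) G ^ 2 ≤ ‖G‖ ^ 2 := by
  rw [← sq_abs]; exact pow_le_pow_left₀ (abs_nonneg _) (abs_inner_radial_le x G) 2

section gradNormSq

variable {h : ℝ → ℝ}

theorem gradNormSq_nonneg (hp : ∀ r, 0 < h r) {x : E n} (hx : x ≠ 0) (G : E n) :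
    0 ≤ gradNormSq h x G := by
  rw [gradNormSq_eq h hx (hp _).ne']
  have := sub_nonneg.2 (sq_inner_radial_le x G)
  positivity

theorem gradNormSq_le (hp : ∀ r, 0 < h r) {x : E n} (hx : x ≠ 0) (G : E n) :
    gradNormSq h x G ≤ (1 + (‖x‖ / h ‖x‖) ^ 2) * ‖G‖ ^ 2 := by
  rw [gradNormSq_eq h hx (hp _).ne']
  have h1 := sq_inner_radial_le x G
  have h2 : 0 ≤ (‖x‖ / h ‖x‖) ^ 2 := sq_nonneg _
  nlinarith [mul_nonneg h2 (sq_nonneg (inner ℝ (radial x) G))]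

/-- Young's inequality for the quadratic form `gradNormSq h x`: it is nonnegative at `δ G - (K -
G)`, and this value is `δ` times the difference of the two sides. -/
theorem gradNormSq_add_le (hp : ∀ r, 0 < h r) {x : E n} (hx : x ≠ 0) (G K : E n) {δ : ℝ}
    (hδ : 0 < δ) :
    gradNormSq h x K ≤ (1 + δ) * gradNormSq h x G + (1 + 1 / δ) * gradNormSq h x (K - G) := by
  have h1 := gradNormSq_nonneg hp hx (δ • G - (K - G))
  have h2 : gradNormSq h x (δ • G - (K - G)) = δ * ((1 + δ) * gradNormSq h x G +
      (1 + 1 / δ) * gradNormSq h x (K - G) - gradNormSq h x K) := by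
    simp only [gradNormSq_eq h hx (hp _).ne']
    simp only [← real_inner_self_eq_norm_sq, inner_sub_left, inner_sub_right, inner_smul_left,
      inner_smul_right, RCLike.conj_to_real, real_inner_comm K G]
    field_simp
    ring
  rw [h2] at h1
  have := (mul_nonneg_iff_of_pos_left hδ).1 h1
  linarith

theorem continuousOn_radial : ContinuousOn (radial : E n → E n) {0}ᶜ :=
  (continuous_norm.continuousOn.inv₀ fun _ hx => norm_ne_zero_iff.2 hx).smul continuousOn_id

theorem continuous_normDiv (hc : Continuous h) (hp : ∀ r, 0 < h r) :
    Continuous fun x : E n => ‖x‖ / h ‖x‖ :=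
  continuous_norm.div (hc.comp continuous_norm) fun _ => (hp _).ne'

theorem continuousOn_gradNormSq (hc : Continuous h) (hp : ∀ r, 0 < h r) {G : E n → E n}
    (hG : ContinuousOn G {0}ᶜ) : ContinuousOn (fun x => gradNormSq h x (G x)) {0}ᶜ := by
  have h1 : ContinuousOn (fun x => inner ℝ (radial x) (G x)) {0}ᶜ := ContinuousOn.inner (𝕜 := ℝ) continuousOn_radial hG
  refine ContinuousOn.congr ((h1.pow 2).add
    (((continuous_normDiv hc hp).continuousOn.pow 2).mul ((hG.norm.pow 2).sub (h1.pow 2)))) ?_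
  intro x hx
  exact gradNormSq_eq h hx (hp _).ne' _

variable {ρ : E n → ℝ} {R₁ : ℝ}

theorem integrable_gradNormSq (hc : Continuous h) (hp : ∀ r, 0 < h r) (hρ : IsRadialFunction ρ)
    (hR : 0 < R₁) {G : E n → E n} (hG : MemLp G 2 (vol h ρ R₁)) :
    Integrable (fun x => gradNormSq h x (G x)) (vol h ρ R₁) := by
  obtain ⟨C, hC⟩ := exists_bound_vol (h := h) hρ hR
    (f := fun x : E n => 1 + (‖x‖ / h ‖x‖) ^ 2)
    (continuous_const.add ((continuous_normDiv hc hp).pow 2)).continuousOn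
  have hG2 : Integrable (fun x => ‖G x‖ ^ 2) (vol h ρ R₁) :=
    (memLp_two_iff_integrable_sq_norm hG.1).1 hG
  refine Integrable.mono' (hG2.const_mul C) ?_ ?_
  · have h0 := aestronglyMeasurable_vol (h := h) hρ hR (continuousOn_radial (n := n))
    have h1 : AEStronglyMeasurable (fun x => inner ℝ (radial x) (G x)) (vol h ρ R₁) :=
      h0.inner hG.1
    refine AEStronglyMeasurable.congr ((h1.pow 2).add
      (((continuous_normDiv hc hp).aestronglyMeasurable.pow 2).mul
        ((hG.1.norm.pow 2).sub (h1.pow 2)))) ?_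
    filter_upwards [ae_vol_mem hρ hR] with x hx
    exact (gradNormSq_eq h (ne_zero_of_mem_perforated hR hx) (hp _).ne' _).symm
  · filter_upwards [ae_vol_mem hρ hR, hC] with x hx hCx
    have hx0 := ne_zero_of_mem_perforated hR hx
    rw [Real.norm_of_nonneg (gradNormSq_nonneg hp hx0 _)]
    exact (gradNormSq_le hp hx0 _).trans
      (mul_le_mul_of_nonneg_right ((le_abs_self _).trans hCx) (sq_nonneg _))

end gradNormSq

/-- The density of the surface measure of the outer boundary. -/
def surfDensity (h : ℝ → ℝ) (ρ : E n → ℝ) (θ : S n) : ℝ :=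
  h (ρ θ) ^ (n - 1) * √(1 + ‖sphGrad ρ θ‖ ^ 2 / h (ρ θ) ^ 2)

section surf

variable {h : ℝ → ℝ} {ρ : E n → ℝ}

theorem continuous_sphGrad (hρ : IsRadialFunction ρ) : Continuous fun θ : S n => sphGrad ρ θ := by
  have h1 : Continuous fun θ : S n => fderiv ℝ ρ (θ : E n) :=
    continuous_sphere_fderiv isOpen_compl_singleton (fun θ => sph_ne_zero θ)
      (hρ.smooth.of_le (by exact_mod_cast le_top))
  exact (InnerProductSpace.toDual ℝ (E n)).symm.continuous.comp h1

theorem surfDensity_pos (hp : ∀ r, 0 < h r) (θ : S n) : 0 < surfDensity h ρ θ := by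
  have := hp (ρ θ)
  unfold surfDensity
  positivity

theorem continuous_surfDensity (hc : Continuous h) (hp : ∀ r, 0 < h r) (hρ : IsRadialFunction ρ) :
    Continuous (surfDensity h ρ) := by
  have h1 := hc.comp hρ.continuous_sphere
  exact (h1.pow _).mul (continuous_const.add (((continuous_sphGrad hρ).norm.pow 2).div (h1.pow 2)
    fun θ => pow_ne_zero 2 (hp _).ne')).sqrt

theorem isFiniteMeasure_surf (hc : Continuous h) (hp : ∀ r, 0 < h r) (hρ : IsRadialFunction ρ) :
    IsFiniteMeasure (surf h ρ) :=
  isFiniteMeasure_withDensity_ofReal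
    (integrable_of_compact (μ := sph n) (continuous_surfDensity hc hp hρ)).2

theorem integral_surf (hc : Continuous h) (hp : ∀ r, 0 < h r) (hρ : IsRadialFunction ρ)
    (f : S n → ℝ) : ∫ θ, f θ ∂(surf h ρ) = ∫ θ, surfDensity h ρ θ * f θ ∂(sph n) := by
  have h2 := integral_withDensity_eq_integral_smul (μ := sph n)
    (continuous_surfDensity hc hp hρ).measurable.real_toNNReal f
  refine h2.trans (integral_congr_ae (Eventually.of_forall fun θ => ?_))
  simp only [NNReal.smul_def, smul_eq_mul, Real.coe_toNNReal _ (surfDensity_pos hp θ).le]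

theorem integrable_surf (hc : Continuous h) (hp : ∀ r, 0 < h r) (hρ : IsRadialFunction ρ)
    {f : S n → ℝ} (hf : Continuous f) : Integrable f (surf h ρ) :=
  have := isFiniteMeasure_surf hc hp hρ
  integrable_of_compact hf

theorem memLp_surf (hc : Continuous h) (hp : ∀ r, 0 < h r) (hρ : IsRadialFunction ρ)
    {f : S n → ℝ} (hf : Continuous f) : MemLp f 2 (surf h ρ) :=
  (memLp_two_iff_integrable_sq hf.aestronglyMeasurable).2
    (integrable_surf hc hp hρ (hf.pow 2))

theorem continuous_bdry (hρ : IsRadialFunction ρ) : Continuous (bdry ρ) :=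
  hρ.continuous_sphere.smul continuous_subtype_val

end surf

/-! ### The variational problem reduced to `C¹` functions -/

/-- The total mass is minimized at the mean. -/
theorem integral_sub_mean_sq_le {X : Type*} [MeasurableSpace X] {μ : Measure X} [IsFiniteMeasure μ]
    {f : X → ℝ} (hf : MemLp f 2 μ) {c : ℝ} (hmean : ∫ x, (f x - c) ∂μ = 0) (c' : ℝ) :
    ∫ x, (f x - c) ^ 2 ∂μ ≤ ∫ x, (f x - c') ^ 2 ∂μ := by
  have h1 : Integrable (fun x => (f x - c) ^ 2) μ := (hf.sub (memLp_const c)).integrable_sq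
  have h2 : Integrable (fun x => f x - c) μ :=
    (hf.integrable one_le_two).sub (integrable_const c)
  have e : ∀ x, (f x - c') ^ 2 = (f x - c) ^ 2 + ((2 * (c - c')) * (f x - c) + (c - c') ^ 2) :=
    fun x => by ring
  have h3 : Integrable (fun x => (2 * (c - c')) * (f x - c) + (c - c') ^ 2) μ :=
    (h2.const_mul _).add (integrable_const _)
  simp only [e]
  rw [integral_add h1 h3, integral_add (h2.const_mul _) (integrable_const _), integral_const_mul,
    hmean, integral_const, smul_eq_mul]
  have : 0 ≤ μ.real Set.univ * (c - c') ^ 2 := mul_nonneg measureReal_nonneg (sq_nonneg _)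
  linarith

theorem integral_norm_sq_eq {X F : Type*} [MeasurableSpace X] [NormedAddCommGroup F] {μ : Measure X}
    {f : X → F} (hf : MemLp f 2 μ) : ∫ x, ‖f x‖ ^ 2 ∂μ = (eLpNorm f 2 μ).toReal ^ 2 := by
  have h0 : 0 ≤ ∫ x, ‖f x‖ ^ 2 ∂μ := integral_nonneg fun _ => sq_nonneg _
  rw [hf.eLpNorm_eq_integral_rpow_norm two_ne_zero ENNReal.ofNat_ne_top]
  simp only [ENNReal.toReal_ofNat, Real.rpow_two]
  rw [ENNReal.toReal_ofReal (Real.rpow_nonneg h0 _), ← Real.rpow_natCast, ← Real.rpow_mul h0]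
  norm_num

theorem tendsto_integral_norm_sq {X F : Type*} [MeasurableSpace X] [NormedAddCommGroup F]
    {μ : Measure X} {f : ℕ → X → F} (hf : ∀ k, MemLp (f k) 2 μ)
    (h : Tendsto (fun k => eLpNorm (f k) 2 μ) atTop (𝓝 0)) :
    Tendsto (fun k => ∫ x, ‖f k x‖ ^ 2 ∂μ) atTop (𝓝 0) := by
  simp only [fun k => integral_norm_sq_eq (hf k)]
  have h1 := ((ENNReal.tendsto_toReal ENNReal.zero_ne_top).comp h).pow 2
  simpa using h1

/-- The Dirichlet energy on the perforated domain. -/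
def energy (h : ℝ → ℝ) (ρ : E n → ℝ) (R₁ : ℝ) (w : E n → ℝ) : ℝ :=
  ∫ x, gradNormSq h x (gradient w x) ∂(vol h ρ R₁)

section mu1

variable {h : ℝ → ℝ} {ρ : E n → ℝ} {R₁ : ℝ}

theorem continuous_gradient {w : E n → ℝ} (hw : ContDiff ℝ 1 w) : Continuous (gradient w) :=
  (InnerProductSpace.toDual ℝ (E n)).symm.continuous.comp (hw.continuous_fderiv (by simp))

theorem integral_gradNormSq_nonneg (hp : ∀ r, 0 < h r) (hρ : IsRadialFunction ρ) (hR : 0 < R₁)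
    (G : E n → E n) : 0 ≤ ∫ x, gradNormSq h x (G x) ∂(vol h ρ R₁) := by
  refine integral_nonneg_of_ae ?_
  filter_upwards [ae_vol_mem hρ hR] with x hx
  exact gradNormSq_nonneg hp (ne_zero_of_mem_perforated hR hx) _

/-- The infimum is tested with `w - c`. If the boundary variance is zero there is no quotient, but
then only nonnegativity of the energy is claimed. -/
theorem mu1_mul_integral_sq_le (hc : Continuous h) (hp : ∀ r, 0 < h r) (hρ : IsRadialFunction ρ)
    (hR : 0 < R₁) {w : E n → ℝ} (hw : ContDiff ℝ 1 w) {c : ℝ}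
    (hmean : ∫ θ, (w (bdry ρ θ) - c) ∂(surf h ρ) = 0) :
    mu1 h ρ R₁ * ∫ θ, (w (bdry ρ θ) - c) ^ 2 ∂(surf h ρ) ≤ energy h ρ R₁ w := by
  have h0 : 0 ≤ ∫ θ, (w (bdry ρ θ) - c) ^ 2 ∂(surf h ρ) := integral_nonneg fun _ => sq_nonneg _
  rcases h0.eq_or_lt with h1 | h1
  · rw [← h1, mul_zero]
    exact integral_gradNormSq_nonneg hp hρ hR _
  rw [← le_div_iff₀ h1]
  refine csInf_le ⟨0, ?_⟩ ⟨fun x => w x - c, gradient w, fun θ => w (bdry ρ θ) - c, ?_, hmean, h1,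
    rfl⟩
  · rintro q ⟨u, G, φ, -, -, hφ, rfl⟩
    exact div_nonneg (integral_gradNormSq_nonneg hp hρ hR G) hφ.le
  · have hwc : ContDiff ℝ 1 fun x => w x - c := hw.sub contDiff_const
    refine ⟨memLp_vol hc hρ hR hwc.continuous.continuousOn,
      memLp_vol hc hρ hR (continuous_gradient hw).continuousOn,
      memLp_surf hc hp hρ ((hw.continuous.comp (continuous_bdry hρ)).sub continuous_const),
      fun _ x => w x - c, fun _ => hwc, ?_, ?_, ?_⟩
    · simp
    · have : gradient (fun x => w x - c) = gradient w := by
        funext x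
        simp only [gradient, fderiv_sub_const]
      simp [this]
    · simp

/-- The inequality passes from the `C¹` approximants to their limit by Young's inequality with a
parameter `δ`, letting first the index tend to infinity and then `δ` to zero. The hypothesis `hne`
makes the set of quotients nonempty; the infimum of the empty set would be `0`. -/
theorem le_mu1 (hc : Continuous h) (hp : ∀ r, 0 < h r) (hρ : IsRadialFunction ρ)
    (hR : 0 < R₁) {κ : ℝ} (hκ : 0 ≤ κ)
    (H : ∀ w : E n → ℝ, ContDiff ℝ 1 w → ∀ c, ∫ θ, (w (bdry ρ θ) - c) ∂(surf h ρ) = 0 →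
      κ * ∫ θ, (w (bdry ρ θ) - c) ^ 2 ∂(surf h ρ) ≤ energy h ρ R₁ w)
    (hne : ∃ w : E n → ℝ, ContDiff ℝ 1 w ∧ ∃ c, ∫ θ, (w (bdry ρ θ) - c) ∂(surf h ρ) = 0 ∧
      0 < ∫ θ, (w (bdry ρ θ) - c) ^ 2 ∂(surf h ρ)) :
    κ ≤ mu1 h ρ R₁ := by
  have fs := isFiniteMeasure_surf hc hp hρ
  have fv := isFiniteMeasure_vol hc hρ hR
  refine le_csInf ?_ ?_
  · obtain ⟨w, hw, c, hmean, hpos⟩ := hne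
    have hwc : ContDiff ℝ 1 fun x => w x - c := hw.sub contDiff_const
    refine ⟨_, fun x => w x - c, gradient (fun x => w x - c), fun θ => w (bdry ρ θ) - c,
      ⟨memLp_vol hc hρ hR hwc.continuous.continuousOn,
      memLp_vol hc hρ hR (continuous_gradient hwc).continuousOn,
      memLp_surf hc hp hρ ((hw.continuous.comp (continuous_bdry hρ)).sub continuous_const),
      fun _ x => w x - c, fun _ => hwc, ?_, ?_, ?_⟩, hmean, hpos, rfl⟩ <;> simp
  · rintro q ⟨u, G, φ, hu, hφ0, hφ, rfl⟩
    rw [le_div_iff₀ hφ]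
    obtain ⟨w, hw, -, hwG, hwφ⟩ := hu.approx
    have hcw : ∀ k, Continuous fun θ => w k (bdry ρ θ) := fun k =>
      (hw k).continuous.comp (continuous_bdry hρ)
    have hmw : ∀ k, MemLp (fun θ => w k (bdry ρ θ)) 2 (surf h ρ) := fun k =>
      memLp_surf hc hp hρ (hcw k)
    have hmg : ∀ k, MemLp (gradient (w k)) 2 (vol h ρ R₁) := fun k =>
      memLp_vol hc hρ hR (continuous_gradient (hw k)).continuousOn
    have hme : ∀ k, MemLp (fun θ => w k (bdry ρ θ) - φ θ) 2 (surf h ρ) := fun k =>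
      (hmw k).sub hu.memLp_trace
    have hmd : ∀ k, MemLp (fun x => gradient (w k) x - G x) 2 (vol h ρ R₁) := fun k =>
      (hmg k).sub hu.memLp_grad
    have t1 := tendsto_integral_norm_sq hmd hwG
    have t2 := tendsto_integral_norm_sq hme hwφ
    obtain ⟨C, hC⟩ := exists_bound_vol (h := h) hρ hR
      (f := fun x : E n => 1 + (‖x‖ / h ‖x‖) ^ 2)
      (continuous_const.add ((continuous_normDiv hc hp).pow 2)).continuousOn
    set Q := ∫ x, gradNormSq h x (G x) ∂(vol h ρ R₁)
    set D := ∫ θ, φ θ ^ 2 ∂(surf h ρ)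
    have main : ∀ δ : ℝ, 0 < δ → κ * D ≤ (1 + δ) ^ 2 * Q := by
      intro δ hδ
      have step : ∀ k, κ * D ≤ (1 + δ) * ((1 + δ) * Q + (1 + 1 / δ) *
          (C * ∫ x, ‖gradient (w k) x - G x‖ ^ 2 ∂(vol h ρ R₁))) +
          κ * (1 + 1 / δ) * ∫ θ, ‖w k (bdry ρ θ) - φ θ‖ ^ 2 ∂(surf h ρ) := by
        intro k
        obtain ⟨c, hmean⟩ : ∃ c, ∫ θ, (w k (bdry ρ θ) - c) ∂(surf h ρ) = 0 := by
          have hk : (surf h ρ).real Set.univ ≠ 0 := by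
            intro h0
            rw [measureReal_eq_zero_iff, Measure.measure_univ_eq_zero] at h0
            rw [show D = ∫ θ, φ θ ^ 2 ∂(surf h ρ) from rfl, h0, integral_zero_measure] at hφ
            exact lt_irrefl _ hφ
          refine ⟨(∫ θ, w k (bdry ρ θ) ∂(surf h ρ)) / (surf h ρ).real Set.univ, ?_⟩
          rw [integral_sub ((hmw k).integrable one_le_two) (integrable_const _), integral_const,
            smul_eq_mul, mul_div_cancel₀ _ hk, sub_self]
        -- The approximant has its own mean `c`; since `φ` has mean zero, shifting it by `c` only
        -- increases the integral.
        have s1 : D ≤ ∫ θ, (φ θ - c) ^ 2 ∂(surf h ρ) := by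
          have := integral_sub_mean_sq_le hu.memLp_trace (c := 0) (by simpa using hφ0) c
          simpa using this
        have i1 : Integrable (fun θ => (w k (bdry ρ θ) - c) ^ 2) (surf h ρ) :=
          ((hmw k).sub (memLp_const c)).integrable_sq
        have i2 : Integrable (fun θ => ‖w k (bdry ρ θ) - φ θ‖ ^ 2) (surf h ρ) :=
          (memLp_two_iff_integrable_sq_norm (hme k).1).1 (hme k)
        have s2 : ∫ θ, (φ θ - c) ^ 2 ∂(surf h ρ) ≤
            (1 + δ) * ∫ θ, (w k (bdry ρ θ) - c) ^ 2 ∂(surf h ρ) +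
            (1 + 1 / δ) * ∫ θ, ‖w k (bdry ρ θ) - φ θ‖ ^ 2 ∂(surf h ρ) := by
          rw [← integral_const_mul, ← integral_const_mul, ← integral_add (i1.const_mul _)
            (i2.const_mul _)]
          refine integral_mono ((hu.memLp_trace.sub (memLp_const c)).integrable_sq)
            ((i1.const_mul _).add (i2.const_mul _)) fun θ => ?_
          simp only [Real.norm_eq_abs, sq_abs]
          set a := w k (bdry ρ θ) - c
          set b := w k (bdry ρ θ) - φ θ
          have e : (1 + δ) * a ^ 2 + (1 + 1 / δ) * b ^ 2 - (φ θ - c) ^ 2 = (δ * a + b) ^ 2 / δ := by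
            have : φ θ - c = a - b := by simp only [a, b]; ring
            rw [this]
            field_simp
            ring
          have : 0 ≤ (δ * a + b) ^ 2 / δ := by positivity
          linarith
        have s3 := H (w k) (hw k) c hmean
        have j1 := integrable_gradNormSq hc hp hρ hR hu.memLp_grad
        have j2 : Integrable (fun x => ‖gradient (w k) x - G x‖ ^ 2) (vol h ρ R₁) :=
          (memLp_two_iff_integrable_sq_norm (hmd k).1).1 (hmd k)
        have s4 : energy h ρ R₁ (w k) ≤ (1 + δ) * Q + (1 + 1 / δ) *
            (C * ∫ x, ‖gradient (w k) x - G x‖ ^ 2 ∂(vol h ρ R₁)) := by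
          rw [← integral_const_mul, ← integral_const_mul, ← integral_const_mul,
            ← integral_add (j1.const_mul _) ((j2.const_mul _).const_mul _)]
          refine integral_mono_ae (integrable_gradNormSq hc hp hρ hR (hmg k))
            ((j1.const_mul _).add ((j2.const_mul _).const_mul _)) ?_
          filter_upwards [ae_vol_mem hρ hR, hC] with x hx hCx
          have hx0 := ne_zero_of_mem_perforated hR hx
          have g1 := gradNormSq_add_le hp hx0 (G x) (gradient (w k) x) hδ
          have g2 := (gradNormSq_le hp hx0 (gradient (w k) x - G x)).trans
            (mul_le_mul_of_nonneg_right ((le_abs_self _).trans hCx) (sq_nonneg _))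
          have : 0 ≤ 1 + 1 / δ := by positivity
          nlinarith
        have s5 := mul_le_mul_of_nonneg_left (s1.trans s2) hκ
        have s6 := mul_le_mul_of_nonneg_left (s3.trans s4) (by positivity : 0 ≤ 1 + δ)
        linarith
      have lim := (((t1.const_mul C).const_mul (1 + 1 / δ)).const_add ((1 + δ) * Q)).const_mul (1 + δ)
        |>.add (t2.const_mul (κ * (1 + 1 / δ)))
      simp only [mul_zero, add_zero] at lim
      refine (ge_of_tendsto lim (Eventually.of_forall step)).trans (le_of_eq ?_)
      ring
    have hlim : Tendsto (fun δ : ℝ => (1 + δ) ^ 2 * Q) (𝓝[>] 0) (𝓝 Q) := by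
      have : Continuous fun δ : ℝ => (1 + δ) ^ 2 * Q := by fun_prop
      have h2 := this.tendsto 0
      simp only [add_zero, one_pow, one_mul] at h2
      exact h2.mono_left nhdsWithin_le_nhds
    exact ge_of_tendsto hlim (eventually_nhdsWithin_of_forall main)

end mu1

/-! ### The Riccati equation -/

/-- The truncated Riccati vector field. -/
def riccatiField (G H : ℝ → ℝ) (t x : ℝ) : ℝ := (G t ^ 2 - min (max x 0) (G t) ^ 2) / H t

/-- Clipping the state to `[0, G t]` makes the field bounded and globally Lipschitz, so
Picard-Lindelöf yields a solution on the whole interval, not merely a local one. -/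
theorem exists_truncated_riccati {G H : ℝ → ℝ} (hG : Continuous G) (hH : Continuous H)
    (hG0 : ∀ t, 0 ≤ G t) (hH0 : ∀ t, 0 < H t) (hGm : Monotone G) {a b : ℝ} (hab : a ≤ b) :
    ∃ F : ℝ → ℝ, F a = 0 ∧ ∀ t ∈ Set.Icc a b,
      HasDerivWithinAt F (riccatiField G H t (F t)) (Set.Icc a b) t := by
  obtain ⟨B, hB⟩ := isCompact_Icc.exists_bound_of_continuousOn (s := Set.Icc a b)
    (hH.inv₀ fun t => (hH0 t).ne').continuousOn
  have hB' : ∀ t ∈ Set.Icc a b, (H t)⁻¹ ≤ B := fun t ht => (le_abs_self _).trans (hB t ht)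
  have hB0 : 0 ≤ B := (inv_nonneg.2 (hH0 a).le).trans (hB' a (Set.left_mem_Icc.2 hab))
  set M := G b
  have hM0 : 0 ≤ M := hG0 b
  have hGM : ∀ t ∈ Set.Icc a b, G t ≤ M := fun t ht => hGm ht.2
  have hclip0 : ∀ t x, 0 ≤ min (max x 0) (G t) := fun t x => le_min (le_max_right _ _) (hG0 t)
  have hclipG : ∀ t x, min (max x 0) (G t) ≤ G t := fun t x => min_le_right _ _
  have hL : 0 ≤ M ^ 2 * B := by positivity
  have hK : 0 ≤ 2 * M * B := by positivity
  have hr : 0 ≤ M ^ 2 * B * (b - a) := mul_nonneg hL (sub_nonneg.2 hab)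
  have hpl : IsPicardLindelof (riccatiField G H) (⟨a, Set.left_mem_Icc.2 hab⟩ : Set.Icc a b)
      (0 : ℝ) ⟨_, hr⟩ 0 ⟨_, hL⟩ ⟨_, hK⟩ := by
    refine ⟨fun t ht => ?_, fun x _ => ?_, fun t ht x _ => ?_, ?_⟩
    · refine LipschitzOnWith.of_dist_le_mul fun x _ y _ => ?_
      rw [Real.dist_eq, Real.dist_eq]
      change |riccatiField G H t x - riccatiField G H t y| ≤ 2 * M * B * |x - y|
      set u := min (max x 0) (G t) with hu
      set v := min (max y 0) (G t) with hv
      have huv : |u - v| ≤ |x - y| := by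
        have h1 : |u - v| ≤ max |max x 0 - max y 0| |G t - G t| :=
          abs_min_sub_min_le_max (max x 0) (G t) (max y 0) (G t)
        have h2 : |max x 0 - max y 0| ≤ max |x - y| |0 - (0 : ℝ)| := abs_max_sub_max_le_max x 0 y 0
        simp only [sub_self, abs_zero] at h1 h2
        rw [max_eq_left (abs_nonneg (max x 0 - max y 0))] at h1
        rw [max_eq_left (abs_nonneg (x - y))] at h2
        exact h1.trans h2
      have e : riccatiField G H t x - riccatiField G H t y = (H t)⁻¹ * ((v + u) * (v - u)) := by
        rw [riccatiField, riccatiField, ← hu, ← hv]; ring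
      rw [e, abs_mul, abs_mul, abs_of_nonneg (inv_nonneg.2 (hH0 t).le),
        abs_of_nonneg (add_nonneg (hclip0 t y) (hclip0 t x)), abs_sub_comm v u]
      have h3 : v + u ≤ 2 * M := by
        linarith [hclipG t x, hclipG t y, hGM t ht]
      calc (H t)⁻¹ * ((v + u) * |u - v|) ≤ B * (2 * M * |x - y|) := by
            have := add_nonneg (hclip0 t y) (hclip0 t x)
            have := hB' t ht
            gcongr
        _ = 2 * M * B * |x - y| := by ring
    · unfold riccatiField
      exact ((((hG.pow 2).sub ((continuous_const.min hG).pow 2)).div hH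
        fun t => (hH0 t).ne')).continuousOn
    · change |riccatiField G H t x| ≤ M ^ 2 * B
      have h1 : 0 ≤ G t ^ 2 - min (max x 0) (G t) ^ 2 := by
        have := pow_le_pow_left₀ (hclip0 t x) (hclipG t x) 2
        linarith
      have h2 : G t ^ 2 - min (max x 0) (G t) ^ 2 ≤ M ^ 2 := by
        have := pow_le_pow_left₀ (hG0 t) (hGM t ht) 2
        nlinarith [sq_nonneg (min (max x 0) (G t))]
      rw [riccatiField, abs_of_nonneg (div_nonneg h1 (hH0 t).le), div_eq_mul_inv]
      exact mul_le_mul h2 (hB' t ht) (inv_nonneg.2 (hH0 t).le) (sq_nonneg _)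
    · simp only [sub_self, NNReal.coe_zero, sub_zero]
      rw [max_eq_left (sub_nonneg.2 hab)]
      exact le_rfl
  obtain ⟨F, hF0, hF⟩ := hpl.exists_eq_forall_mem_Icc_hasDerivWithinAt₀
  exact ⟨F, hF0, hF⟩

/-- Solvability of the Riccati equation `F' = (G² - F²) / H`, `F a = 0`. -/
theorem exists_riccati {G H : ℝ → ℝ} (hG : Continuous G) (hH : Continuous H)
    (hG0 : ∀ t, 0 ≤ G t) (hH0 : ∀ t, 0 < H t) (hGm : Monotone G) {a b : ℝ} (hab : a ≤ b) :
    ∃ F : ℝ → ℝ, F a = 0 ∧ Continuous F ∧ (∀ t ∈ Set.Icc a b, 0 ≤ F t ∧ F t ≤ G t) ∧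
      MonotoneOn F (Set.Icc a b) ∧
      ∀ t ∈ Set.Ioo a b, HasDerivAt F ((G t ^ 2 - F t ^ 2) / H t) t := by
  obtain ⟨F, hFa, hF⟩ := exists_truncated_riccati hG hH hG0 hH0 hGm hab
  have hclip0 : ∀ t x, 0 ≤ min (max x 0) (G t) := fun t x => le_min (le_max_right _ _) (hG0 t)
  have hfield : ∀ t x, 0 ≤ riccatiField G H t x := fun t x => by
    have := pow_le_pow_left₀ (hclip0 t x) (min_le_right _ _) 2
    exact div_nonneg (by linarith) (hH0 t).le
  have hcont : ContinuousOn F (Set.Icc a b) := fun t ht => (hF t ht).continuousWithinAt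
  have hda : ∀ t ∈ Set.Ioo a b, HasDerivAt F (riccatiField G H t (F t)) t := fun t ht =>
    (hF t ⟨ht.1.le, ht.2.le⟩).hasDerivAt (Icc_mem_nhds ht.1 ht.2)
  have hmono : MonotoneOn F (Set.Icc a b) := by
    refine monotoneOn_of_deriv_nonneg (convex_Icc a b) hcont ?_ ?_ <;> rw [interior_Icc]
    · exact fun t ht => (hda t ht).differentiableAt.differentiableWithinAt
    · intro t ht
      rw [(hda t ht).deriv]
      exact hfield t _
  have hnonneg : ∀ t ∈ Set.Icc a b, 0 ≤ F t := fun t ht => by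
    rw [← hFa]; exact hmono (Set.left_mem_Icc.2 hab) ht ht.1
  -- Where `F > G` the truncated field vanishes. After the last time `s` with `F ≤ G` the solution
  -- is therefore constant while `G` does not decrease, so it cannot end above `G`.
  have hle : ∀ t ∈ Set.Icc a b, F t ≤ G t := by
    intro t ht
    by_contra hlt
    push Not at hlt
    set A := Set.Icc a t ∩ {s | F s ≤ G s} with hA
    have hcont' : ContinuousOn F (Set.Icc a t) := hcont.mono (Set.Icc_subset_Icc_right ht.2)
    have hAc : IsCompact A := by
      have h1 : IsClosed (Set.Icc a t ∩ (fun s => F s - G s) ⁻¹' Set.Iic 0) :=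
        (hcont'.sub hG.continuousOn).preimage_isClosed_of_isClosed isClosed_Icc isClosed_Iic
      have h2 : A = Set.Icc a t ∩ (fun s => F s - G s) ⁻¹' Set.Iic 0 := by
        ext s; simp [hA]
      rw [h2]
      exact isCompact_Icc.of_isClosed_subset h1 Set.inter_subset_left
    have hAne : A.Nonempty := ⟨a, Set.left_mem_Icc.2 ht.1, by
      rw [Set.mem_ofPred_eq, hFa]; exact hG0 a⟩
    have hs := hAc.sSup_mem hAne
    set s := sSup A
    have hst : s < t := by
      refine lt_of_le_of_ne hs.1.2 fun h => ?_
      have h3 : F s ≤ G s := hs.2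
      rw [h] at h3
      exact absurd h3 (not_le.2 hlt)
    have hgt : ∀ r ∈ Set.Ioo s t, G r < F r := by
      intro r hr
      by_contra h
      push Not at h
      have h4 : r ∈ A := ⟨⟨hs.1.1.trans hr.1.le, hr.2.le⟩, h⟩
      exact absurd (le_csSup hAc.bddAbove h4) (not_le.2 hr.1)
    have hzero : ∀ r ∈ Set.Ioo s t, HasDerivAt F 0 r := by
      intro r hr
      have h5 := hda r ⟨hs.1.1.trans_lt hr.1, hr.2.trans_le ht.2⟩
      have h6 : riccatiField G H r (F r) = 0 := by
        have h7 := hgt r hr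
        rw [riccatiField, max_eq_left ((hG0 r).trans h7.le), min_eq_right h7.le, sub_self, zero_div]
      rwa [h6] at h5
    obtain ⟨r, hr, hr'⟩ := exists_hasDerivAt_eq_slope F (fun _ => 0) hst
      (hcont'.mono (Set.Icc_subset_Icc_left hs.1.1)) hzero
    have h8 : F t = F s := by
      have := (div_eq_zero_iff.1 hr'.symm).resolve_right (sub_pos.2 hst).ne'
      linarith
    have h9 : F s ≤ G s := hs.2
    linarith [hGm hst.le]
  -- Composing with the clamp freezes `F` outside the interval, which makes it continuous on the
  -- whole line.
  set p : ℝ → ℝ := fun t => max a (min b t)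
  have hp : ∀ t, p t ∈ Set.Icc a b := fun t => ⟨le_max_left _ _, max_le hab (min_le_left _ _)⟩
  have hpid : ∀ t ∈ Set.Icc a b, p t = t := fun t ht => by
    simp only [p]; rw [min_eq_right ht.2, max_eq_right ht.1]
  refine ⟨F ∘ p, ?_, ?_, ?_, ?_, ?_⟩
  · simp only [Function.comp, hpid a (Set.left_mem_Icc.2 hab), hFa]
  · exact hcont.comp_continuous (by fun_prop) hp
  · intro t ht
    simp only [Function.comp, hpid t ht]
    exact ⟨hnonneg t ht, hle t ht⟩
  · intro s hs t ht hst
    simp only [Function.comp, hpid t ht, hpid s hs]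
    exact hmono hs ht hst
  · intro t ht
    have ht' : t ∈ Set.Icc a b := ⟨ht.1.le, ht.2.le⟩
    have h1 := hda t ht
    rw [riccatiField, max_eq_left (hnonneg t ht'), min_eq_left (hle t ht')] at h1
    simp only [Function.comp, hpid t ht']
    refine h1.congr_of_eventuallyEq ?_
    filter_upwards [Icc_mem_nhds ht.1 ht.2] with s hs
    simp only [Function.comp, hpid s hs]

/-! ### Energy in polar coordinates and the lower bound for annuli -/

theorem sph_univ_pos (hn : n ≠ 0) : 0 < (sph n).real Set.univ := by
  have : Nontrivial (E n) := by
    have : Nonempty (Fin n) := ⟨⟨0, Nat.pos_of_ne_zero hn⟩⟩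
    infer_instance
  have : Nonempty (S n) := (NormedSpace.sphere_nonempty.2 zero_le_one).to_subtype
  rw [measureReal_def]
  exact ENNReal.toReal_pos (isOpen_univ.measure_pos _ Set.univ_nonempty).ne' (measure_ne_top _ _)

theorem integral_interval_swap {X : Type*} [TopologicalSpace X] [CompactSpace X]
    [T2Space X] [SecondCountableTopology X] [MeasurableSpace X] [BorelSpace X] {μ : Measure X} [IsFiniteMeasure μ]
    {f : ℝ → X → ℝ} (hf : Continuous (Function.uncurry f)) {a b : ℝ} (hab : a ≤ b) :
    ∫ x, (∫ r in a..b, f r x) ∂μ = ∫ r in a..b, (∫ x, f r x ∂μ) := by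
  simp only [intervalIntegral.integral_of_le hab]
  refine integral_integral_swap ?_
  have h1 : Continuous (Function.uncurry fun (x : X) (r : ℝ) => f r x) :=
    hf.comp continuous_swap
  have h2 : IntegrableOn (Function.uncurry fun (x : X) (r : ℝ) => f r x)
      (Set.univ ×ˢ Set.Icc a b) (μ.prod volume) :=
    h1.continuousOn.integrableOn_compact (isCompact_univ.prod isCompact_Icc)
  have h3 := h2.mono_set (Set.prod_mono_right (s := Set.univ) Set.Ioc_subset_Icc_self)
  rwa [IntegrableOn, ← Measure.prod_restrict, Measure.restrict_univ] at h3

/-- The energy density in polar coordinates. -/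
def polarEnergy (h : ℝ → ℝ) (w : E n → ℝ) (r : ℝ) (θ : S n) : ℝ :=
  h r ^ (n - 1) * (fderiv ℝ w (r • (θ : E n)) θ ^ 2 + r ^ 2 / h r ^ 2 *
    (‖fderiv ℝ w (r • (θ : E n))‖ ^ 2 - fderiv ℝ w (r • (θ : E n)) θ ^ 2))

section polarEnergy

variable {h : ℝ → ℝ} {ρ w : E n → ℝ} {R₁ : ℝ}

theorem tangSq_dilate (hw : ContDiff ℝ 1 w) (r : ℝ) (x : E n) :
    tangSq (fun x => w (r • x)) x =
      r ^ 2 * (‖fderiv ℝ w (r • x)‖ ^ 2 - fderiv ℝ w (r • x) x ^ 2) := by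
  have h1 : fderiv ℝ (fun x => w (r • x)) x = r • fderiv ℝ w (r • x) := by
    have h2 := ((hw.differentiable (by simp)) (r • x)).hasFDerivAt.comp x
      ((hasFDerivAt_id (𝕜 := ℝ) x).const_smul r)
    refine (HasFDerivAt.fderiv h2).trans ?_
    ext v
    simp
  rw [tangSq, h1, norm_smul, mul_pow, Real.norm_eq_abs, sq_abs, _root_.smul_apply, smul_eq_mul]
  ring

theorem continuous_polarEnergy (hc : Continuous h) (hp : ∀ r, 0 < h r) (hw : ContDiff ℝ 1 w) :
    Continuous (Function.uncurry (polarEnergy (n := n) h w)) := by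
  have h1 : Continuous fun p : ℝ × S n => h p.1 := hc.comp continuous_fst
  have h2 : Continuous fun p : ℝ × S n => p.1 • (p.2 : E n) := by fun_prop
  have h3 : Continuous fun p : ℝ × S n => fderiv ℝ w (p.1 • (p.2 : E n)) :=
    (hw.continuous_fderiv (by simp)).comp h2
  have h4 : Continuous fun p : ℝ × S n => fderiv ℝ w (p.1 • (p.2 : E n)) (p.2 : E n) :=
    continuous_fderiv_apply hw h2 (by fun_prop)
  exact (h1.pow _).mul ((h4.pow 2).add ((((continuous_fst.pow 2).div (h1.pow 2)
    fun _ => pow_ne_zero 2 (hp _).ne')).mul ((h3.norm.pow 2).sub (h4.pow 2))))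

theorem polarEnergy_ge (hp : ∀ r, 0 < h r) (w : E n → ℝ) (r : ℝ) (θ : S n) :
    h r ^ (n - 1) * fderiv ℝ w (r • (θ : E n)) θ ^ 2 ≤ polarEnergy h w r θ := by
  have h0 := hp r
  have h1 : fderiv ℝ w (r • (θ : E n)) θ ^ 2 ≤ ‖fderiv ℝ w (r • (θ : E n))‖ ^ 2 := by
    rw [← sq_abs]
    refine pow_le_pow_left₀ (abs_nonneg _) ?_ 2
    have := (fderiv ℝ w (r • (θ : E n))).le_opNorm (θ : E n)
    rwa [sph_norm, mul_one] at this
  have h2 := sub_nonneg.2 h1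
  unfold polarEnergy
  have : 0 ≤ h r ^ (n - 1) * (r ^ 2 / h r ^ 2 *
    (‖fderiv ℝ w (r • (θ : E n))‖ ^ 2 - fderiv ℝ w (r • (θ : E n)) θ ^ 2)) := by positivity
  linarith

theorem polarEnergy_nonneg (hp : ∀ r, 0 < h r) (w : E n → ℝ) (r : ℝ) (θ : S n) :
    0 ≤ polarEnergy h w r θ :=
  le_trans (mul_nonneg (pow_nonneg (hp r).le _) (sq_nonneg _)) (polarEnergy_ge hp w r θ)

theorem energy_eq_polar (hc : Continuous h) (hp : ∀ r, 0 < h r) (hρ : IsRadialFunction ρ)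
    (hR : 0 < R₁) (hR₁ : ∀ θ : S n, R₁ ≤ ρ θ) (hn : n ≠ 0) (hw : ContDiff ℝ 1 w) :
    energy h ρ R₁ w = ∫ θ : S n, (∫ r in R₁..ρ θ, polarEnergy h w r θ) ∂(sph n) := by
  rw [energy, integral_vol hc hp hρ hR hR₁
    (continuousOn_gradNormSq hc hp (continuous_gradient hw).continuousOn) hn]
  refine integral_congr_ae (Eventually.of_forall fun θ =>
    intervalIntegral.integral_congr fun r hr => ?_)
  rw [Set.uIcc_of_le (hR₁ θ)] at hr
  have hr0 : 0 < r := hR.trans_le hr.1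
  have hx : r • (θ : E n) ≠ 0 := smul_ne_zero hr0.ne' (sph_ne_zero θ)
  have hnorm : ‖r • (θ : E n)‖ = r := by
    rw [norm_smul, sph_norm, mul_one, Real.norm_of_nonneg hr0.le]
  have hrad : radial (r • (θ : E n)) = θ := by
    rw [radial, hnorm, smul_smul, inv_mul_cancel₀ hr0.ne', one_smul]
  have hG : inner ℝ (θ : E n) (gradient w (r • (θ : E n))) = fderiv ℝ w (r • (θ : E n)) θ := by
    rw [real_inner_comm, inner_gradient_left]
  have hN : ‖gradient w (r • (θ : E n))‖ = ‖fderiv ℝ w (r • (θ : E n))‖ := by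
    rw [gradient, LinearIsometryEquiv.norm_map]
  simp only [polarEnergy]
  rw [gradNormSq_eq h hx (hp _).ne', hrad, hnorm, hG, hN, div_pow]

theorem hasDerivAt_radial (hw : ContDiff ℝ 1 w) (θ : S n) (r : ℝ) :
    HasDerivAt (fun r : ℝ => w (r • (θ : E n))) (fderiv ℝ w (r • (θ : E n)) θ) r := by
  have h1 := ((hw.differentiable (by simp)) (r • (θ : E n))).hasFDerivAt
  have h2 := h1.comp_hasDerivAt r ((hasDerivAt_id r).smul_const (θ : E n))
  rw [one_smul] at h2
  exact h2

/-- The energy of a spherical slice is at least `(n - 1) h^{n-3}` times its variance plus the radial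
part of the energy. -/
theorem slice_energy_ge (hp : ∀ r, 0 < h r) (hn : 2 ≤ n)
    (hw : ContDiff ℝ 1 w) (r : ℝ) :
    h r ^ (n - 1) * ∫ θ : S n, fderiv ℝ w (r • (θ : E n)) θ ^ 2 ∂(sph n) +
      h r ^ (n - 1) * (((n : ℝ) - 1) / h r ^ 2) * (∫ θ : S n, w (r • (θ : E n)) ^ 2 ∂(sph n) -
        (∫ θ : S n, w (r • (θ : E n)) ∂(sph n)) ^ 2 / (sph n).real Set.univ) ≤
      ∫ θ : S n, polarEnergy h w r θ ∂(sph n) := by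
  have hwr : ContDiff ℝ 1 fun x => w (r • x) := hw.comp (contDiff_const_smul r)
  have h1 := sphere_poincare hn hwr
  have c1 : Continuous fun θ : S n => fderiv ℝ w (r • (θ : E n)) θ :=
    continuous_fderiv_apply hw (by fun_prop) (by fun_prop)
  have c2 : Continuous fun θ : S n => tangSq (fun x => w (r • x)) (θ : E n) :=
    (continuous_tangSq hwr).comp continuous_subtype_val
  have e : ∀ θ : S n, polarEnergy h w r θ = h r ^ (n - 1) * fderiv ℝ w (r • (θ : E n)) θ ^ 2 +
      h r ^ (n - 1) / h r ^ 2 * tangSq (fun x => w (r • x)) (θ : E n) := fun θ => by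
    rw [tangSq_dilate hw, polarEnergy]
    ring
  have j1 : Integrable (fun θ : S n => h r ^ (n - 1) * fderiv ℝ w (r • (θ : E n)) θ ^ 2) (sph n) :=
    (integrable_of_compact (c1.pow 2)).const_mul _
  simp only [e]
  rw [integral_add j1 ((integrable_of_compact c2).const_mul _), integral_const_mul,
    integral_const_mul]
  have h0 := hp r
  have h2 : 0 ≤ h r ^ (n - 1) / h r ^ 2 := by positivity
  have h3 := mul_le_mul_of_nonneg_left h1 h2
  refine add_le_add_right (le_trans (le_of_eq ?_) h3) _
  ring

end polarEnergy

/-- The solution `F` of `F' = (n - 1) h^{n-3} - F² / h^{n-1}`, `F a = 0`. -/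
structure IsRiccati (n : ℕ) (h : ℝ → ℝ) (a b : ℝ) (F : ℝ → ℝ) : Prop where
  initial : F a = 0
  continuous : Continuous F
  nonneg : ∀ t ∈ Set.Icc a b, 0 ≤ F t
  le : ∀ t ∈ Set.Icc a b, F t ≤ √((n : ℝ) - 1) * h t ^ (n - 2)
  mono : MonotoneOn F (Set.Icc a b)
  deriv : ∀ t ∈ Set.Ioo a b,
    HasDerivAt F (h t ^ (n - 1) * (((n : ℝ) - 1) / h t ^ 2) - F t ^ 2 / h t ^ (n - 1)) t

/-- With `G = √(n-1) h^{n-2}` and `H = h^{n-1}` the quotient `G²/H` is `(n-1) h^{n-3}`; monotonicity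
of `h` makes `G` monotone, as the bound `F ≤ G` requires. -/
theorem exists_isRiccati {h : ℝ → ℝ} (hc : Continuous h) (hp : ∀ r, 0 < h r) (hm : Monotone h)
    (hn : 2 ≤ n) {a b : ℝ} (hab : a ≤ b) : ∃ F, IsRiccati n h a b F := by
  have hn1 : (0 : ℝ) ≤ (n : ℝ) - 1 := by
    have : (2 : ℝ) ≤ n := by exact_mod_cast hn
    linarith
  obtain ⟨F, h0, h1, h2, h3, h4⟩ := exists_riccati
    (G := fun t => √((n : ℝ) - 1) * h t ^ (n - 2)) (H := fun t => h t ^ (n - 1))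
    (continuous_const.mul (hc.pow _)) (hc.pow _)
    (fun t => mul_nonneg (Real.sqrt_nonneg _) (pow_nonneg (hp t).le _))
    (fun t => pow_pos (hp t) _)
    (fun s t hst => mul_le_mul_of_nonneg_left (pow_le_pow_left₀ (hp s).le (hm hst) _)
      (Real.sqrt_nonneg _)) hab
  refine ⟨F, h0, h1, fun t ht => (h2 t ht).1, fun t ht => (h2 t ht).2, h3, fun t ht => ?_⟩
  refine (h4 t ht).congr_deriv ?_
  have ht0 := (hp t).ne'
  have e : h t ^ (n - 1) = h t ^ (n - 2) * h t := by rw [← pow_succ]; congr 1; omega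
  simp only [mul_pow, Real.sq_sqrt hn1, e]
  field_simp

section annulus

variable {h : ℝ → ℝ} {ρ w : E n → ℝ} {R₁ : ℝ}

/-- The variance of `w` on the sphere of radius `r`. -/
def sliceVar (w : E n → ℝ) (r : ℝ) : ℝ :=
  ∫ θ : S n, w (r • (θ : E n)) ^ 2 ∂(sph n) -
    (∫ θ : S n, w (r • (θ : E n)) ∂(sph n)) ^ 2 / (sph n).real Set.univ

theorem hasDerivAt_sliceVar (hw : ContDiff ℝ 1 w) (r : ℝ) :
    HasDerivAt (sliceVar w)
      (2 * ∫ θ : S n, w (r • (θ : E n)) * fderiv ℝ w (r • (θ : E n)) θ ∂(sph n) -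
        2 * (∫ θ : S n, w (r • (θ : E n)) ∂(sph n)) *
          (∫ θ : S n, fderiv ℝ w (r • (θ : E n)) θ ∂(sph n)) / (sph n).real Set.univ) r := by
  have c0 : Continuous fun p : ℝ × S n => w (p.1 • (p.2 : E n)) :=
    hw.continuous.comp (by fun_prop)
  have c1 : Continuous fun p : ℝ × S n => fderiv ℝ w (p.1 • (p.2 : E n)) (p.2 : E n) :=
    continuous_fderiv_apply hw (by fun_prop) (by fun_prop)
  have d1 := hasDerivAt_integral_of_compact (μ := sph n) isOpen_univ
    (f := fun r θ => w (r • (θ : E n)))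
    (f' := fun r θ => fderiv ℝ w (r • (θ : E n)) θ)
    (fun t _ => c0.comp (Continuous.prodMk_right t)) c1.continuousOn
    (fun t _ θ => hasDerivAt_radial hw θ t) (t₀ := r) trivial
  have d2 := hasDerivAt_integral_of_compact (μ := sph n) isOpen_univ
    (f := fun r θ => w (r • (θ : E n)) ^ 2)
    (f' := fun r θ => 2 * (w (r • (θ : E n)) * fderiv ℝ w (r • (θ : E n)) θ))
    (fun t _ => (c0.comp (Continuous.prodMk_right t)).pow 2)
    (continuous_const.mul (c0.mul c1)).continuousOn
    (fun t _ θ => by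
      have := (hasDerivAt_radial hw θ t).fun_pow 2
      refine this.congr_deriv ?_
      push_cast
      ring) (t₀ := r) trivial
  rw [integral_const_mul] at d2
  refine (d2.sub ((d1.fun_pow 2).div_const _)).congr_deriv ?_
  push_cast
  ring

/-- The Poincaré inequality on the slice supplies the first term. The rest, `f · Var' ≤ H ∫ w_r² +
(f²/H) Var`, is the expansion of `∫ (H w_r - f (w - mean))² ≥ 0`. The number `f` is free here and
becomes `F r`. -/
theorem sliceVar_deriv_le (hp : ∀ r, 0 < h r) (hn : 2 ≤ n) (hw : ContDiff ℝ 1 w) (r f : ℝ) :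
    (h r ^ (n - 1) * (((n : ℝ) - 1) / h r ^ 2) - f ^ 2 / h r ^ (n - 1)) * sliceVar w r +
      f * (2 * ∫ θ : S n, w (r • (θ : E n)) * fderiv ℝ w (r • (θ : E n)) θ ∂(sph n) -
        2 * (∫ θ : S n, w (r • (θ : E n)) ∂(sph n)) *
          (∫ θ : S n, fderiv ℝ w (r • (θ : E n)) θ ∂(sph n)) / (sph n).real Set.univ) ≤
      ∫ θ : S n, polarEnergy h w r θ ∂(sph n) := by
  have hk := sph_univ_pos (n := n) (by omega)
  refine le_trans ?_ (slice_energy_ge hp hn hw r)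
  have c0 : Continuous fun θ : S n => w (r • (θ : E n)) := hw.continuous.comp (by fun_prop)
  have c1 : Continuous fun θ : S n => fderiv ℝ w (r • (θ : E n)) (θ : E n) :=
    continuous_fderiv_apply hw (by fun_prop) (by fun_prop)
  have hH : 0 < h r ^ (n - 1) := pow_pos (hp r) _
  rw [sliceVar]
  set H := h r ^ (n - 1)
  set k := (sph n).real Set.univ
  set B := ∫ θ : S n, w (r • (θ : E n)) ∂(sph n) with hB
  set A := ∫ θ : S n, w (r • (θ : E n)) ^ 2 ∂(sph n) with hA
  set B' := ∫ θ : S n, fderiv ℝ w (r • (θ : E n)) θ ∂(sph n) with hB'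
  set P := ∫ θ : S n, w (r • (θ : E n)) * fderiv ℝ w (r • (θ : E n)) θ ∂(sph n) with hP
  set W := ∫ θ : S n, fderiv ℝ w (r • (θ : E n)) θ ^ 2 ∂(sph n) with hW
  have h0 : 0 ≤ ∫ θ : S n, (H * fderiv ℝ w (r • (θ : E n)) θ - f * (w (r • (θ : E n)) - B / k)) ^ 2
      ∂(sph n) := integral_nonneg fun _ => sq_nonneg _
  have e : ∀ θ : S n, (H * fderiv ℝ w (r • (θ : E n)) θ - f * (w (r • (θ : E n)) - B / k)) ^ 2 =
      ((H ^ 2 * fderiv ℝ w (r • (θ : E n)) θ ^ 2 +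
        (-2 * H * f) * (w (r • (θ : E n)) * fderiv ℝ w (r • (θ : E n)) θ)) +
      (f ^ 2 * w (r • (θ : E n)) ^ 2 + (2 * H * f * (B / k)) * fderiv ℝ w (r • (θ : E n)) θ)) +
      ((-2 * f ^ 2 * (B / k)) * w (r • (θ : E n)) + f ^ 2 * (B / k) ^ 2) := fun θ => by ring
  have i1 : Integrable (fun θ : S n => H ^ 2 * fderiv ℝ w (r • (θ : E n)) θ ^ 2) (sph n) :=
    (integrable_of_compact (c1.pow 2)).const_mul _
  have i2 : Integrable (fun θ : S n => (-2 * H * f) *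
      (w (r • (θ : E n)) * fderiv ℝ w (r • (θ : E n)) θ)) (sph n) :=
    (integrable_of_compact (c0.mul c1)).const_mul _
  have i3 : Integrable (fun θ : S n => f ^ 2 * w (r • (θ : E n)) ^ 2) (sph n) :=
    (integrable_of_compact (c0.pow 2)).const_mul _
  have i4 : Integrable (fun θ : S n => (2 * H * f * (B / k)) * fderiv ℝ w (r • (θ : E n)) θ)
      (sph n) := (integrable_of_compact c1).const_mul _
  have i5 : Integrable (fun θ : S n => (-2 * f ^ 2 * (B / k)) * w (r • (θ : E n))) (sph n) :=
    (integrable_of_compact c0).const_mul _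
  have i6 : Integrable (fun _ : S n => f ^ 2 * (B / k) ^ 2) (sph n) := integrable_const _
  simp only [e] at h0
  have q1 := integral_add' ((i1.add i2).add (i3.add i4)) (i5.add i6)
  rw [integral_add' (i1.add i2) (i3.add i4), integral_add' i1 i2, integral_add' i3 i4,
    integral_add' i5 i6, integral_const] at q1
  replace h0 := h0.trans_eq q1
  simp only [integral_const_mul, smul_eq_mul] at h0
  rw [← hW, ← hP, ← hA, ← hB', ← hB] at h0
  have h1 : 0 ≤ H * (H * W - f * (2 * P - 2 * B * B' / k) + f ^ 2 / H * (A - B ^ 2 / k)) := by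
    refine h0.trans (le_of_eq ?_)
    change H ^ 2 * W + -2 * H * f * P + (f ^ 2 * A + 2 * H * f * (B / k) * B') +
      (-2 * f ^ 2 * (B / k) * B + k * (f ^ 2 * (B / k) ^ 2)) = _
    field_simp
    ring
  have h2 := (mul_nonneg_iff_of_pos_left hH).1 h1
  linarith

/-- By the Riccati equation, the left side of `sliceVar_deriv_le` with `f = F r` is exactly the
derivative of `F · Var`. The initial value `F a = 0` removes the inner boundary term, reflecting the
Neumann condition. -/
theorem riccati_mul_sliceVar_le (hc : Continuous h) (hp : ∀ r, 0 < h r) (hn : 2 ≤ n)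
    (hw : ContDiff ℝ 1 w) {a b : ℝ} (hab : a ≤ b) {F : ℝ → ℝ} (hF : IsRiccati n h a b F) :
    F b * sliceVar w b ≤ ∫ r in a..b, (∫ θ : S n, polarEnergy h w r θ ∂(sph n)) := by
  have hcont : Continuous fun r => ∫ θ : S n, polarEnergy h w r θ ∂(sph n) :=
    continuous_parametric_integral_of_continuous (s := Set.univ)
      (continuous_polarEnergy hc hp hw) isCompact_univ |> fun h => by simpa using h
  have := intervalIntegral.sub_le_integral_of_hasDeriv_right_of_le hab
    (g := fun r => F r * sliceVar w r)
    (φ := fun r => ∫ θ : S n, polarEnergy h w r θ ∂(sph n))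
    (hF.continuous.mul (continuous_iff_continuousAt.2 fun r =>
      (hasDerivAt_sliceVar hw r).continuousAt)).continuousOn
    (fun r hr => ((hF.deriv r hr).mul (hasDerivAt_sliceVar hw r)).hasDerivWithinAt)
    (hcont.continuousOn.integrableOn_compact isCompact_Icc)
    (fun r hr => sliceVar_deriv_le hp hn hw r (F r))
  simpa [hF.initial] using this

theorem surfDensity_const (R : ℝ) (θ : S n) : surfDensity h (fun _ : E n => R) θ = h R ^ (n - 1) := by
  have : sphGrad (fun _ : E n => R) θ = 0 := by simp [sphGrad, gradient]
  simp [surfDensity, this]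

/-- A linear function has positive variance on the outer boundary. -/
theorem exists_boundary_variance (hc : Continuous h) (hp : ∀ r, 0 < h r) (hρ : IsRadialFunction ρ)
    (hn : n ≠ 0) :
    ∃ w : E n → ℝ, ContDiff ℝ 1 w ∧ ∃ c, ∫ θ, (w (bdry ρ θ) - c) ∂(surf h ρ) = 0 ∧
      0 < ∫ θ, (w (bdry ρ θ) - c) ^ 2 ∂(surf h ρ) := by
  have : Nontrivial (E n) := by
    have : Nonempty (Fin n) := ⟨⟨0, Nat.pos_of_ne_zero hn⟩⟩
    infer_instance
  obtain ⟨e, he⟩ := NormedSpace.sphere_nonempty (x := (0 : E n)).2 zero_le_one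
  set θ₀ : S n := ⟨e, he⟩
  have := isFiniteMeasure_surf hc hp hρ
  have cb : Continuous fun θ : S n => inner ℝ e (bdry ρ θ) :=
    (continuous_const.inner (continuous_bdry hρ))
  have hd := continuous_surfDensity hc hp hρ
  have hk : (surf h ρ).real Set.univ ≠ 0 := by
    have h1 := integral_surf hc hp hρ fun _ => (1 : ℝ)
    rw [integral_const, smul_eq_mul, mul_one] at h1
    rw [h1]
    refine (Continuous.integral_pos_of_hasCompactSupport_nonneg_nonzero (x := θ₀)
      (hd.mul continuous_const) (HasCompactSupport.of_compactSpace _)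
      (fun θ => mul_nonneg (surfDensity_pos hp θ).le zero_le_one) ?_).ne'
    simpa using (surfDensity_pos hp θ₀).ne'
  set c := (∫ θ, inner ℝ e (bdry ρ θ) ∂(surf h ρ)) / (surf h ρ).real Set.univ with hcdef
  refine ⟨fun x => inner ℝ e x, (innerSL ℝ e).contDiff, c, ?_, ?_⟩
  · rw [integral_sub (integrable_surf hc hp hρ cb) (integrable_const _), integral_const,
      smul_eq_mul, hcdef, mul_div_cancel₀ _ hk, sub_self]
  · rw [integral_surf hc hp hρ]
    -- If `⟨e, ·⟩` were constant on the boundary, the points over `e` and `-e` would give `ρ(e) = c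
    -- = -ρ(-e)`, against positivity of `ρ`.
    have key : ∃ θ : S n, inner ℝ e (bdry ρ θ) - c ≠ 0 := by
      by_contra hcon
      push Not at hcon
      have h1 := hcon θ₀
      have h2 := hcon (-θ₀)
      have he1 : inner ℝ e e = (1 : ℝ) := by
        rw [real_inner_self_eq_norm_sq, mem_sphere_zero_iff_norm.1 he, one_pow]
      have hco : ((-θ₀ : S n) : E n) = -e := rfl
      rw [bdry, inner_smul_right] at h1 h2
      rw [hco, inner_neg_right, he1] at h2
      rw [show (θ₀ : E n) = e from rfl, he1] at h1
      have h3 := hρ.pos _ (sph_ne_zero θ₀)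
      have h4 := hρ.pos _ (sph_ne_zero (-θ₀))
      rw [hco] at h4
      rw [show (θ₀ : E n) = e from rfl] at h3
      linarith
    obtain ⟨θ, hθ⟩ := key
    refine Continuous.integral_pos_of_hasCompactSupport_nonneg_nonzero (x := θ)
      (hd.mul ((cb.sub continuous_const).pow 2)) (HasCompactSupport.of_compactSpace _)
      (fun θ => mul_nonneg (surfDensity_pos hp θ).le (sq_nonneg _)) ?_
    exact mul_ne_zero (surfDensity_pos hp θ).ne' (pow_ne_zero 2 hθ)

/-- The first eigenvalue of an annulus is at least `F(R) / h(R)^{n-1}`. -/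
theorem riccati_div_le_mu1 (hc : Continuous h) (hp : ∀ r, 0 < h r) (hn : 2 ≤ n) (hR : 0 < R₁)
    {R : ℝ} (hRR : R₁ ≤ R) {F : ℝ → ℝ} (hF : IsRiccati n h R₁ R F) :
    F R / h R ^ (n - 1) ≤ mu1 h (fun _ : E n => R) R₁ := by
  have hρ : IsRadialFunction (fun _ : E n => R) := .const (hR.trans_le hRR)
  have hH : 0 < h R ^ (n - 1) := pow_pos (hp R) _
  have hFR := hF.nonneg R (Set.right_mem_Icc.2 hRR)
  have hk := sph_univ_pos (n := n) (by omega)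
  refine le_mu1 hc hp hρ hR (div_nonneg hFR hH.le) ?_
    (exists_boundary_variance hc hp hρ (by omega))
  intro w hw c hmean
  rw [energy_eq_polar hc hp hρ hR (fun _ => hRR) (by omega) hw,
    integral_interval_swap (continuous_polarEnergy hc hp hw) hRR]
  refine le_trans (le_of_eq ?_) (riccati_mul_sliceVar_le hc hp hn hw hRR hF)
  have c0 : Continuous fun θ : S n => w (R • (θ : E n)) := hw.continuous.comp (by fun_prop)
  have i1 := integrable_of_compact (μ := sph n) c0
  rw [integral_surf hc hp hρ] at hmean ⊢
  simp only [surfDensity_const, integral_const_mul, bdry] at hmean ⊢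
  have h1 := (mul_eq_zero.1 hmean).resolve_left hH.ne'
  rw [integral_sub i1 (integrable_const _), integral_const, smul_eq_mul, sub_eq_zero] at h1
  have e : ∀ θ : S n, (w (R • (θ : E n)) - c) ^ 2 =
      w (R • (θ : E n)) ^ 2 + ((-2 * c) * w (R • (θ : E n)) + c ^ 2) := fun θ => by ring
  have i2 : Integrable (fun θ : S n => (-2 * c) * w (R • (θ : E n)) + c ^ 2) (sph n) :=
    (i1.const_mul _).add (integrable_const _)
  simp only [e]
  have i3 : Integrable (fun θ : S n => w (R • (θ : E n)) ^ 2) (sph n) :=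
    integrable_of_compact (c0.pow 2)
  rw [integral_add i3 i2,
    integral_add (i1.const_mul _) (integrable_const _), integral_const_mul, integral_const,
    smul_eq_mul, sliceVar, h1]
  field_simp
  ring

end annulus

/-! ### Trial functions and the upper bound -/

theorem exists_integral_sub_eq_zero {X : Type*} [MeasurableSpace X] {μ : Measure X}
    [IsFiniteMeasure μ] {f : X → ℝ} (hf : Integrable f μ) : ∃ c, ∫ x, (f x - c) ∂μ = 0 := by
  refine ⟨(∫ x, f x ∂μ) / μ.real Set.univ, ?_⟩
  by_cases h0 : μ.real Set.univ = 0
  · rw [measureReal_eq_zero_iff, Measure.measure_univ_eq_zero] at h0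
    rw [h0, integral_zero_measure]
  · rw [integral_sub hf (integrable_const _), integral_const, smul_eq_mul, mul_div_cancel₀ _ h0,
      sub_self]

theorem hasFDerivAt_norm_radial {x : E n} (hx : x ≠ 0) :
    HasFDerivAt (fun x : E n => ‖x‖) (innerSL ℝ (radial x)) x := by
  have hr : 0 < ‖x‖ := norm_pos_iff.2 hx
  have h1 : HasFDerivAt (fun x : E n => √(‖x‖ ^ 2)) _ x :=
    ((hasStrictFDerivAt_norm_sq x).hasFDerivAt).sqrt (by positivity)
  have h2 : (fun x : E n => √(‖x‖ ^ 2)) = fun x => ‖x‖ := by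
    funext x; exact Real.sqrt_sq (norm_nonneg x)
  rw [h2] at h1
  refine h1.congr_fderiv ?_
  refine ContinuousLinearMap.ext fun v => ?_
  rw [Real.sqrt_sq hr.le]
  simp only [_root_.smul_apply, innerSL_apply_apply, radial, inner_smul_left, RCLike.conj_to_real,
    smul_eq_mul, nsmul_eq_mul]
  field_simp
  norm_num

/-- The function `a(|x|) ⟨e, x / |x|⟩`, cut off near the pole. -/
def trial (a : ℝ → ℝ) (R₁ : ℝ) (e x : E n) : ℝ :=
  Real.smoothTransition (2 * ‖x‖ / R₁ - 1) * (a ‖x‖ / ‖x‖) * inner ℝ e x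

section trial

variable {a : ℝ → ℝ} {R₁ : ℝ}

theorem trial_of_le (hR : 0 < R₁) (e : E n) {x : E n} (hx : R₁ ≤ ‖x‖) :
    trial a R₁ e x = a ‖x‖ / ‖x‖ * inner ℝ e x := by
  have h1 : 1 ≤ 2 * ‖x‖ / R₁ - 1 := by
    rw [le_sub_iff_add_le, le_div_iff₀ hR]
    linarith
  rw [trial, Real.smoothTransition.one_of_one_le h1, one_mul]

/-- Competitors are approximated by functions that are `C¹` on the whole space, pole included. The
cutoff vanishes for `‖x‖ ≤ R₁/2` and is `1` for `‖x‖ ≥ R₁`, so the perforated domain does not see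
it. -/
theorem contDiff_trial (ha : ContDiff ℝ 1 a) (hR : 0 < R₁) (e : E n) :
    ContDiff ℝ 1 (trial a R₁ e) := by
  rw [contDiff_iff_contDiffAt]
  intro x
  rcases eq_or_ne x 0 with rfl | hx
  · have h1 : trial a R₁ e =ᶠ[𝓝 0] fun _ => 0 := by
      have h2 : ∀ᶠ x : E n in 𝓝 0, ‖x‖ < R₁ / 2 :=
        (continuous_norm.tendsto (0 : E n)).eventually_lt_const (by simpa using half_pos hR)
      filter_upwards [h2] with x hx
      have h3 : 2 * ‖x‖ / R₁ - 1 ≤ 0 := by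
        rw [sub_nonpos, div_le_one hR]
        linarith
      rw [trial, Real.smoothTransition.zero_of_nonpos h3, zero_mul, zero_mul]
    exact contDiffAt_const.congr_of_eventuallyEq h1
  · have hN : ContDiffAt ℝ 1 (fun x : E n => ‖x‖) x := contDiffAt_norm ℝ hx
    have h1 : ContDiffAt ℝ 1 (fun x : E n => a ‖x‖ / ‖x‖) x :=
      (ha.contDiffAt.comp x hN).div hN (norm_ne_zero_iff.2 hx)
    have h2 : ContDiffAt ℝ 1 (fun x : E n => Real.smoothTransition (2 * ‖x‖ / R₁ - 1)) x :=
      (Real.smoothTransition.contDiffAt (n := 1)).comp x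
        (((contDiffAt_const.mul hN).div_const _).sub contDiffAt_const)
    exact (h2.mul h1).mul (innerSL ℝ e).contDiff.contDiffAt

theorem gradient_trial (ha : ∀ r, HasDerivAt a (deriv a r) r) (hR : 0 < R₁) (e : E n) {x : E n}
    (hx : R₁ < ‖x‖) :
    gradient (trial a R₁ e) x = (a ‖x‖ / ‖x‖) • e +
      (inner ℝ e x * ((deriv a ‖x‖ * ‖x‖ - a ‖x‖) / ‖x‖ ^ 2)) • radial x := by
  have hr : 0 < ‖x‖ := hR.trans hx
  have h1 : trial a R₁ e =ᶠ[𝓝 x] fun x => a ‖x‖ / ‖x‖ * inner ℝ e x := by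
    filter_upwards [continuous_norm.continuousAt.eventually (lt_mem_nhds hx)] with y hy
    exact trial_of_le hR e (le_of_lt hy)
  have h2 : HasDerivAt (fun r => a r / r) ((deriv a ‖x‖ * ‖x‖ - a ‖x‖) / ‖x‖ ^ 2) ‖x‖ := by
    refine ((ha ‖x‖).fun_div (hasDerivAt_id' ‖x‖) hr.ne').congr_deriv ?_
    rw [mul_one]
  have h3 := h2.comp_hasFDerivAt x (hasFDerivAt_norm_radial (norm_pos_iff.1 hr))
  have h4 := (h3.mul (innerSL ℝ e).hasFDerivAt).congr_of_eventuallyEq h1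
  refine HasGradientAt.gradient ?_
  rw [hasGradientAt_iff_hasFDerivAt]
  refine h4.congr_fderiv ?_
  ext v
  simp only [InnerProductSpace.toDual_apply_apply, inner_add_left, inner_smul_left,
    RCLike.conj_to_real, _root_.add_apply, _root_.smul_apply, innerSL_apply_apply, smul_eq_mul,
    Function.comp]
  ring

theorem gradNormSq_trial {h : ℝ → ℝ} (hp : ∀ r, 0 < h r) (ha : ∀ r, HasDerivAt a (deriv a r) r)
    (hR : 0 < R₁) (e : E n) {x : E n} (hx : R₁ < ‖x‖) :
    gradNormSq h x (gradient (trial a R₁ e) x) = deriv a ‖x‖ ^ 2 * inner ℝ e (radial x) ^ 2 +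
      a ‖x‖ ^ 2 / h ‖x‖ ^ 2 * (‖e‖ ^ 2 - inner ℝ e (radial x) ^ 2) := by
  have hr : 0 < ‖x‖ := hR.trans hx
  have hx0 : x ≠ 0 := norm_pos_iff.1 hr
  have h1 := radial_inner_self hx0
  have h2 : inner ℝ e x = ‖x‖ * inner ℝ e (radial x) := by
    rw [radial, inner_smul_right, ← mul_assoc, mul_inv_cancel₀ hr.ne', one_mul]
  have hh := (hp ‖x‖).ne'
  rw [gradNormSq_eq h hx0 hh, gradient_trial ha hR e hx, ← real_inner_self_eq_norm_sq (_ + _)]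
  simp only [inner_add_left, inner_add_right, inner_smul_left, inner_smul_right,
    RCLike.conj_to_real, h1, h2, real_inner_self_eq_norm_sq e, real_inner_comm e (radial x)]
  field_simp
  ring

/-- The squares of the coordinates of `∂_r` sum to one. Hence the total energy density of the `n`
trial functions is radial even though the domain is not. -/
theorem sum_gradNormSq_trial {h : ℝ → ℝ} (hp : ∀ r, 0 < h r)
    (ha : ∀ r, HasDerivAt a (deriv a r) r) (hR : 0 < R₁) {x : E n} (hx : R₁ < ‖x‖) :
    ∑ i, gradNormSq h x (gradient (trial a R₁ (EuclideanSpace.single i 1)) x) =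
      deriv a ‖x‖ ^ 2 + ((n : ℝ) - 1) * (a ‖x‖ ^ 2 / h ‖x‖ ^ 2) := by
  have h1 : ∑ i, inner ℝ (EuclideanSpace.single i (1 : ℝ)) (radial x) ^ 2 = 1 := by
    simp only [inner_single_left']
    rw [← EuclideanSpace.real_norm_sq_eq, ← real_inner_self_eq_norm_sq,
      radial_inner_self (norm_pos_iff.1 (hR.trans hx))]
  simp only [gradNormSq_trial hp ha hR _ hx]
  rw [Finset.sum_add_distrib, ← Finset.mul_sum, ← Finset.mul_sum, Finset.sum_sub_distrib, h1]
  simp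
  ring

end trial

section profile

variable {h F : ℝ → ℝ} {R₁ RM : ℝ}

/-- The radial profile `exp ∫ F / h^{n-1}`. -/
def profile (n : ℕ) (h F : ℝ → ℝ) (R₁ r : ℝ) : ℝ := Real.exp (∫ s in R₁..r, F s / h s ^ (n - 1))

theorem profile_pos (r : ℝ) : 0 < profile n h F R₁ r := Real.exp_pos _

theorem hasDerivAt_profile (hc : Continuous h) (hp : ∀ r, 0 < h r) (hF : Continuous F) (r : ℝ) :
    HasDerivAt (profile n h F R₁) (F r / h r ^ (n - 1) * profile n h F R₁ r) r := by
  have hcont : Continuous fun s => F s / h s ^ (n - 1) :=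
    hF.div (hc.pow _) fun s => (pow_pos (hp s) _).ne'
  refine (intervalIntegral.integral_hasDerivAt_right (hcont.intervalIntegrable _ _)
    (hcont.stronglyMeasurableAtFilter _ _) hcont.continuousAt).exp.congr_deriv ?_
  rw [profile, mul_comm]

theorem contDiff_profile (hc : Continuous h) (hp : ∀ r, 0 < h r) (hF : Continuous F) :
    ContDiff ℝ 1 (profile n h F R₁) := by
  have hd : ∀ r, HasDerivAt (profile n h F R₁) _ r := hasDerivAt_profile (n := n) hc hp hF
  have hcont : Continuous (profile n h F R₁) :=
    continuous_iff_continuousAt.2 fun r => (hd r).continuousAt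
  rw [contDiff_one_iff_deriv]
  refine ⟨fun r => (hd r).differentiableAt, ?_⟩
  rw [show deriv (profile n h F R₁) = _ from funext fun r => (hd r).deriv]
  exact (hF.div (hc.pow _) fun s => (pow_pos (hp s) _).ne').mul hcont

/-- The relation `h^{n-1} a' = F a` and the Riccati equation make the integrand the derivative of
`a² F`, which vanishes at `R₁`. -/
theorem integral_profile_energy (hc : Continuous h) (hp : ∀ r, 0 < h r)
    (hF : IsRiccati n h R₁ RM F) {R : ℝ} (hR₁ : R₁ ≤ R) (hRM : R ≤ RM) :
    ∫ r in R₁..R, h r ^ (n - 1) * (deriv (profile n h F R₁) r ^ 2 +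
      ((n : ℝ) - 1) * (profile n h F R₁ r ^ 2 / h r ^ 2)) = profile n h F R₁ R ^ 2 * F R := by
  have hd := hasDerivAt_profile (n := n) (R₁ := R₁) hc hp hF.continuous
  have hcd := contDiff_profile (n := n) (R₁ := R₁) hc hp hF.continuous
  have hpow : ∀ s, h s ^ (n - 1) ≠ 0 := fun s => (pow_pos (hp s) _).ne'
  have key := intervalIntegral.integral_eq_sub_of_hasDerivAt_of_le hR₁
    (f := fun r => profile n h F R₁ r ^ 2 * F r)
    (f' := fun r => h r ^ (n - 1) * (deriv (profile n h F R₁) r ^ 2 +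
      ((n : ℝ) - 1) * (profile n h F R₁ r ^ 2 / h r ^ 2)))
    ((hcd.continuous.pow 2).mul hF.continuous).continuousOn
    (fun r hr => by
      refine (((hd r).fun_pow 2).mul (hF.deriv r ⟨hr.1, hr.2.trans_le hRM⟩)).congr_deriv ?_
      have h1 := hpow r
      have h2 := (hp r).ne'
      rw [(hd r).deriv]
      set H := h r ^ (n - 1)
      push_cast
      field_simp
      ring)
    (Continuous.intervalIntegrable ((hc.pow _).mul (((hcd.continuous_deriv le_rfl).pow 2).add
      (continuous_const.mul ((hcd.continuous.pow 2).div (hc.pow 2)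
        fun s => pow_ne_zero 2 (hp s).ne')))) _ _)
  rw [key, hF.initial, mul_zero, sub_zero]

end profile

section upper

variable {h F : ℝ → ℝ} {ρ : E n → ℝ} {R₁ Rm RM : ℝ}

theorem sum_energy_trial (hc : Continuous h) (hp : ∀ r, 0 < h r) (hρ : IsRadialFunction ρ)
    (hR : 0 < R₁) (hR₁ : ∀ θ : S n, R₁ ≤ ρ θ) (hRM : ∀ θ : S n, ρ θ ≤ RM) (hn : n ≠ 0)
    (hF : IsRiccati n h R₁ RM F) :
    ∑ i, energy h ρ R₁ (trial (profile n h F R₁) R₁ (EuclideanSpace.single i 1)) =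
      ∫ θ : S n, profile n h F R₁ (ρ θ) ^ 2 * F (ρ θ) ∂(sph n) := by
  have hcd := contDiff_profile (n := n) (R₁ := R₁) hc hp hF.continuous
  have hd : ∀ r, HasDerivAt (profile n h F R₁) (deriv (profile n h F R₁) r) r := fun r =>
    (hasDerivAt_profile (n := n) (R₁ := R₁) hc hp hF.continuous r).differentiableAt.hasDerivAt
  simp only [energy]
  rw [← integral_finsetSum _ fun i _ => integrable_gradNormSq hc hp hρ hR
    (memLp_vol hc hρ hR (continuous_gradient (contDiff_trial hcd hR _)).continuousOn)]
  have h1 : ∫ x, ∑ i, gradNormSq h x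
        (gradient (trial (profile n h F R₁) R₁ (EuclideanSpace.single i 1)) x) ∂(vol h ρ R₁) =
      ∫ x : E n, (deriv (profile n h F R₁) ‖x‖ ^ 2 +
        ((n : ℝ) - 1) * (profile n h F R₁ ‖x‖ ^ 2 / h ‖x‖ ^ 2)) ∂(vol h ρ R₁) := by
    refine integral_congr_ae ?_
    filter_upwards [ae_vol_mem hρ hR] with x hx
    exact sum_gradNormSq_trial hp hd hR hx.1
  have hcont : Continuous fun r => deriv (profile n h F R₁) r ^ 2 +
      ((n : ℝ) - 1) * (profile n h F R₁ r ^ 2 / h r ^ 2) :=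
    ((hcd.continuous_deriv le_rfl).pow 2).add
      (continuous_const.mul ((hcd.continuous.pow 2).div (hc.pow 2)
        fun s => pow_ne_zero 2 (hp s).ne'))
  have hcontE : Continuous fun x : E n => deriv (profile n h F R₁) ‖x‖ ^ 2 +
      ((n : ℝ) - 1) * (profile n h F R₁ ‖x‖ ^ 2 / h ‖x‖ ^ 2) := hcont.comp continuous_norm
  rw [h1, integral_vol hc hp hρ hR hR₁ hcontE.continuousOn hn]
  refine integral_congr_ae (Eventually.of_forall fun θ => ?_)
  simp only
  rw [← integral_profile_energy hc hp hF (hR₁ θ) (hRM θ)]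
  refine intervalIntegral.integral_congr fun r hr => ?_
  rw [Set.uIcc_of_le (hR₁ θ)] at hr
  simp only [norm_smul, sph_norm, mul_one, Real.norm_of_nonneg (hR.le.trans hr.1)]

theorem fderiv_profile_comp (hc : Continuous h) (hp : ∀ r, 0 < h r) (hF : Continuous F)
    (hρ : IsRadialFunction ρ) (θ : S n) :
    ‖fderiv ℝ (fun x => profile n h F R₁ (ρ x)) (θ : E n)‖ ^ 2 / profile n h F R₁ (ρ θ) ^ 2 =
      (F (ρ θ) / h (ρ θ) ^ (n - 1)) ^ 2 * ‖sphGrad ρ θ‖ ^ 2 := by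
  have h1 : HasFDerivAt ρ (fderiv ℝ ρ (θ : E n)) θ :=
    ((hρ.smooth.differentiableOn (by simp)).differentiableAt
      (isOpen_compl_singleton.mem_nhds (sph_ne_zero θ))).hasFDerivAt
  have h2 := (hasDerivAt_profile (n := n) (R₁ := R₁) hc hp hF (ρ θ)).comp_hasFDerivAt (θ : E n) h1
  have h3 : ‖sphGrad ρ θ‖ = ‖fderiv ℝ ρ (θ : E n)‖ := by
    rw [sphGrad, gradient, LinearIsometryEquiv.norm_map]
  rw [show fderiv ℝ (fun x => profile n h F R₁ (ρ x)) (θ : E n) = _ from h2.fderiv, h3, norm_smul,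
    mul_pow, Real.norm_eq_abs, sq_abs]
  have := (profile_pos (n := n) (h := h) (F := F) (R₁ := R₁) (ρ θ)).ne'
  field_simp

/-- This bound on the logarithmic derivative of the profile is used twice: it turns the factor
`1/(n-1)` in `sphere_key` into the tilt of the surface element, and it bounds the eigenvalue of the
inner annulus in the constant of the lower estimate. -/
theorem IsRiccati.quotient_le (hp : ∀ r, 0 < h r) (hn : 2 ≤ n) (hF : IsRiccati n h R₁ RM F)
    {t : ℝ} (ht : t ∈ Set.Icc R₁ RM) : F t / h t ^ (n - 1) ≤ √((n : ℝ) - 1) / h t := by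
  have e : h t ^ (n - 1) = h t ^ (n - 2) * h t := by rw [← pow_succ]; congr 1; omega
  have h0 := hp t
  have h1 : 0 < h t ^ (n - 2) := pow_pos h0 _
  rw [div_le_div_iff₀ (pow_pos h0 _) h0, e, ← mul_assoc]
  exact mul_le_mul_of_nonneg_right (hF.le t ht) h0.le

/-- The weighted isoperimetric-type estimate for the boundary values of the trial functions. -/
theorem integral_profile_sq_le (hc : Continuous h) (hp : ∀ r, 0 < h r) (hm : Monotone h)
    (hρ : IsRadialFunction ρ) (hR₁ : ∀ θ : S n, R₁ ≤ ρ θ) (hRm : ∀ θ : S n, Rm ≤ ρ θ)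
    (hRM : ∀ θ : S n, ρ θ ≤ RM) (hn : 2 ≤ n) (hF : IsRiccati n h R₁ RM F) (c : E n) :
    h Rm ^ (n - 1) * ∫ θ : S n, profile n h F R₁ (ρ θ) ^ 2 ∂(sph n) ≤
      ∫ θ : S n, ‖profile n h F R₁ (ρ θ) • (θ : E n) - c‖ ^ 2 ∂(surf h ρ) := by
  have hn1 : (0 : ℝ) < (n : ℝ) - 1 := by
    have : (2 : ℝ) ≤ n := by exact_mod_cast hn
    linarith
  have hcd := contDiff_profile (n := n) (R₁ := R₁) hc hp hF.continuous
  have hy : ContDiffOn ℝ 1 (fun x => profile n h F R₁ (ρ x)) {0}ᶜ :=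
    hcd.comp_contDiffOn (hρ.smooth.of_le (by exact_mod_cast le_top))
  have key := sphere_key hy (fun θ => profile_pos _) hn c
  have hH : 0 ≤ h Rm ^ (n - 1) := pow_nonneg (hp _).le _
  refine (mul_le_mul_of_nonneg_left key hH).trans ?_
  rw [integral_surf hc hp hρ, ← integral_const_mul]
  have c1 : Continuous fun θ : S n => profile n h F R₁ (ρ θ) :=
    hcd.continuous.comp hρ.continuous_sphere
  have c2 : Continuous fun θ : S n => ‖profile n h F R₁ (ρ θ) • (θ : E n) - c‖ ^ 2 :=
    ((c1.smul continuous_subtype_val).sub continuous_const).norm.pow 2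
  have c3 : Continuous fun θ : S n => √(1 + 1 / ((n : ℝ) - 1) *
      (‖fderiv ℝ (fun x => profile n h F R₁ (ρ x)) (θ : E n)‖ ^ 2 /
        profile n h F R₁ (ρ θ) ^ 2)) :=
    (continuous_const.add (continuous_const.mul (((continuous_sphere_fderiv isOpen_compl_singleton
      (fun θ => sph_ne_zero θ) hy).norm.pow 2).div (c1.pow 2)
        fun θ => pow_ne_zero 2 (profile_pos _).ne'))).sqrt
  refine integral_mono (integrable_of_compact (continuous_const.mul (c2.mul c3)))
    (integrable_of_compact ((continuous_surfDensity hc hp hρ).mul c2)) fun θ => ?_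
  have hq := hF.quotient_le hp hn ⟨hR₁ θ, hRM θ⟩
  have hq0 : 0 ≤ F (ρ θ) / h (ρ θ) ^ (n - 1) :=
    div_nonneg (hF.nonneg _ ⟨hR₁ θ, hRM θ⟩) (pow_nonneg (hp _).le _)
  have hq2 := pow_le_pow_left₀ hq0 hq 2
  rw [div_pow (√_), Real.sq_sqrt hn1.le] at hq2
  have h1 : √(1 + 1 / ((n : ℝ) - 1) * (‖fderiv ℝ (fun x => profile n h F R₁ (ρ x)) (θ : E n)‖ ^ 2 /
      profile n h F R₁ (ρ θ) ^ 2)) ≤ √(1 + ‖sphGrad ρ θ‖ ^ 2 / h (ρ θ) ^ 2) := by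
    refine Real.sqrt_le_sqrt ?_
    rw [fderiv_profile_comp hc hp hF.continuous hρ]
    refine add_le_add_right ?_ _
    calc _ ≤ 1 / ((n : ℝ) - 1) * (((n : ℝ) - 1) / h (ρ θ) ^ 2 * ‖sphGrad ρ θ‖ ^ 2) := by gcongr
      _ = ‖sphGrad ρ θ‖ ^ 2 / h (ρ θ) ^ 2 := by field_simp
  have h2 : h Rm ^ (n - 1) ≤ h (ρ θ) ^ (n - 1) := pow_le_pow_left₀ (hp _).le (hm (hRm θ)) _
  have h3 := mul_le_mul h2 h1 (Real.sqrt_nonneg _) (pow_nonneg (hp _).le _)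
  have h4 := mul_le_mul_of_nonneg_right h3
    (sq_nonneg ‖profile n h F R₁ (ρ θ) • (θ : E n) - c‖)
  simp only [surfDensity]
  linarith

theorem mu1_nonneg (hp : ∀ r, 0 < h r) (hρ : IsRadialFunction ρ) (hR : 0 < R₁) :
    0 ≤ mu1 h ρ R₁ := by
  refine Real.sInf_nonneg ?_
  rintro q ⟨v, G, φ, -, -, hφ, rfl⟩
  exact div_nonneg (integral_gradNormSq_nonneg hp hρ hR G) hφ.le

/-- The first eigenvalue of the perforated domain is at most `F(R_M) / h(R_m)^{n-1}`. -/
theorem mu1_le_riccati_div (hc : Continuous h) (hp : ∀ r, 0 < h r) (hm : Monotone h)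
    (hρ : IsRadialFunction ρ) (hR : 0 < R₁) (hR₁ : R₁ ≤ Rm) (hRm : ∀ θ : S n, Rm ≤ ρ θ)
    (hRM : ∀ θ : S n, ρ θ ≤ RM) (hn : 2 ≤ n) (hF : IsRiccati n h R₁ RM F) :
    mu1 h ρ R₁ ≤ F RM / h Rm ^ (n - 1) := by
  have fs := isFiniteMeasure_surf hc hp hρ
  have hn0 : n ≠ 0 := by omega
  have hRρ : ∀ θ : S n, R₁ ≤ ρ θ := fun θ => hR₁.trans (hRm θ)
  have hcd := contDiff_profile (n := n) (R₁ := R₁) hc hp hF.continuous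
  set u : Fin n → E n → ℝ := fun i => trial (profile n h F R₁) R₁ (EuclideanSpace.single i 1) with hu
  have hu1 : ∀ i, ContDiff ℝ 1 (u i) := fun i => contDiff_trial hcd hR _
  have cu : ∀ i, Continuous fun θ : S n => u i (bdry ρ θ) := fun i =>
    (hu1 i).continuous.comp (continuous_bdry hρ)
  -- The boundary means need not vanish. The constants subtracted are the coordinates of the vector
  -- `c` to which `integral_profile_sq_le` is applied.
  choose c hmean using fun i => exists_integral_sub_eq_zero (integrable_surf hc hp hρ (cu i))
  have h1 : mu1 h ρ R₁ * ∑ i, ∫ θ, (u i (bdry ρ θ) - c i) ^ 2 ∂(surf h ρ) ≤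
      ∑ i, energy h ρ R₁ (u i) := by
    rw [Finset.mul_sum]
    exact Finset.sum_le_sum fun i _ => mu1_mul_integral_sq_le hc hp hρ hR (hu1 i) (hmean i)
  have iu : ∀ i ∈ Finset.univ, Integrable (fun θ : S n => (u i (bdry ρ θ) - c i) ^ 2) (surf h ρ) :=
    fun i _ => integrable_surf hc hp hρ (((cu i).sub continuous_const).pow 2)
  rw [sum_energy_trial hc hp hρ hR hRρ hRM hn0 hF, ← integral_finsetSum _ iu] at h1
  have h2 : ∀ θ : S n, ∑ i, (u i (bdry ρ θ) - c i) ^ 2 =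
      ‖profile n h F R₁ (ρ θ) • (θ : E n) - WithLp.toLp 2 c‖ ^ 2 := fun θ => by
    rw [EuclideanSpace.real_norm_sq_eq]
    refine Finset.sum_congr rfl fun i _ => ?_
    have h0 : 0 < ρ θ := hρ.pos _ (sph_ne_zero θ)
    have hnorm : ‖bdry ρ θ‖ = ρ θ := by
      rw [bdry, norm_smul, sph_norm, mul_one, Real.norm_of_nonneg h0.le]
    have h3 : u i (bdry ρ θ) = profile n h F R₁ (ρ θ) * (θ : E n) i := by
      simp only [hu]
      rw [trial_of_le hR _ (by rw [hnorm]; exact hRρ θ), hnorm, bdry, inner_smul_right,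
        inner_single_left']
      field_simp
    simp [h3]
  simp only [h2] at h1
  have h3 := integral_profile_sq_le hc hp hm hρ hRρ hRm hRM hn hF (WithLp.toLp 2 c)
  have c1 : Continuous fun θ : S n => profile n h F R₁ (ρ θ) :=
    hcd.continuous.comp hρ.continuous_sphere
  -- Monotonicity of `F` replaces the flux at each boundary point by its value at the largest
  -- radius.
  have h4 : ∫ θ : S n, profile n h F R₁ (ρ θ) ^ 2 * F (ρ θ) ∂(sph n) ≤
      (∫ θ : S n, profile n h F R₁ (ρ θ) ^ 2 ∂(sph n)) * F RM := by
    rw [← integral_mul_const]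
    refine integral_mono (integrable_of_compact ((c1.pow 2).mul
      (hF.continuous.comp hρ.continuous_sphere)))
      (integrable_of_compact ((c1.pow 2).mul continuous_const)) fun θ => ?_
    exact mul_le_mul_of_nonneg_left (hF.mono ⟨hRρ θ, hRM θ⟩
      (Set.right_mem_Icc.2 ((hRρ θ).trans (hRM θ))) (hRM θ)) (sq_nonneg _)
  have h5 : 0 < ∫ θ : S n, profile n h F R₁ (ρ θ) ^ 2 ∂(sph n) := by
    have hk := sph_univ_pos hn0
    rw [integral_pos_iff_support_of_nonneg (fun θ => sq_nonneg _)
      (integrable_of_compact (c1.pow 2))]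
    have : Function.support (fun θ : S n => profile n h F R₁ (ρ θ) ^ 2) = Set.univ :=
      Set.eq_univ_of_forall fun θ => pow_ne_zero 2 (profile_pos _).ne'
    rw [this]
    exact (ENNReal.toReal_pos_iff.1 hk).1
  have h6 := mu1_nonneg hp hρ hR
  have hH : 0 < h Rm ^ (n - 1) := pow_pos (hp _) _
  rw [le_div_iff₀ hH]
  refine le_of_mul_le_mul_right ?_ h5
  calc mu1 h ρ R₁ * h Rm ^ (n - 1) * ∫ θ : S n, profile n h F R₁ (ρ θ) ^ 2 ∂(sph n)
      = mu1 h ρ R₁ * (h Rm ^ (n - 1) * ∫ θ : S n, profile n h F R₁ (ρ θ) ^ 2 ∂(sph n)) := by ring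
    _ ≤ _ := (mul_le_mul_of_nonneg_left h3 h6).trans (h1.trans h4)
    _ = _ := by ring

end upper

/-! ### The lower bound: transport along rays -/

theorem sq_intervalIntegral_le {f : ℝ → ℝ} (hf : Continuous f) {a b : ℝ} (hab : a ≤ b) :
    (∫ t in a..b, f t) ^ 2 ≤ (b - a) * ∫ t in a..b, f t ^ 2 := by
  rcases hab.eq_or_lt with rfl | hlt
  · simp
  have hd : 0 < b - a := sub_pos.2 hlt
  set I := ∫ t in a..b, f t with hI
  have h0 : 0 ≤ ∫ t in a..b, (f t - I / (b - a)) ^ 2 :=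
    intervalIntegral.integral_nonneg hab fun _ _ => sq_nonneg _
  have e : ∀ t, (f t - I / (b - a)) ^ 2 =
      f t ^ 2 + ((-2 * (I / (b - a))) * f t + (I / (b - a)) ^ 2) := fun t => by ring
  have i1 : IntervalIntegrable (fun t => f t ^ 2) volume a b := (hf.pow 2).intervalIntegrable _ _
  have i2 : IntervalIntegrable (fun t => (-2 * (I / (b - a))) * f t) volume a b :=
    (continuous_const.mul hf).intervalIntegrable _ _
  have i3 : IntervalIntegrable (fun _ : ℝ => (I / (b - a)) ^ 2) volume a b :=
    intervalIntegrable_const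
  simp only [e] at h0
  rw [intervalIntegral.integral_add i1 (i2.add i3), intervalIntegral.integral_add i2 i3,
    intervalIntegral.integral_const_mul, intervalIntegral.integral_const, smul_eq_mul, ← hI] at h0
  set Q := ∫ t in a..b, f t ^ 2
  have h1 := mul_nonneg hd.le h0
  have h2 : (b - a) * (Q + (-2 * (I / (b - a)) * I + (b - a) * (I / (b - a)) ^ 2)) =
      (b - a) * Q - I ^ 2 := by
    field_simp
    ring
  rw [h2] at h1
  linarith

/-- For `D > 0` the difference `(1 + mD)(m a² + b²/D) - m(a + b)²` is the square `(b - mDa)²/D`.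
This choice of Young's parameter produces the factor `1 + m(R_M - R_m)`. -/
theorem mul_add_sq_le {m D a b x : ℝ} (hm : 0 ≤ m) (hD : 0 ≤ D) (hx : 0 ≤ x)
    (hb : b ^ 2 ≤ D * x) : m * (a + b) ^ 2 ≤ (1 + m * D) * (m * a ^ 2 + x) := by
  rcases hD.eq_or_lt with rfl | hD
  · have : b = 0 := by
      rw [zero_mul] at hb
      exact pow_eq_zero_iff two_ne_zero |>.1 (le_antisymm hb (sq_nonneg _))
    subst this
    linarith
  · have h1 : 0 ≤ (b - m * D * a) ^ 2 / D := by positivity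
    have h2 : (b - m * D * a) ^ 2 / D = b ^ 2 / D - 2 * m * a * b + m ^ 2 * D * a ^ 2 := by
      field_simp
      ring
    have h3 : b ^ 2 / D ≤ x := by rw [div_le_iff₀ hD]; linarith
    have h4 := mul_le_mul_of_nonneg_left hb hm
    nlinarith

section lower

variable {h : ℝ → ℝ} {ρ w : E n → ℝ} {R₁ Rm RM : ℝ}

/-- The increment along a ray is the integral of the radial derivative over a length at most `RM -
Rm`. By Cauchy-Schwarz and `h Rm ≤ h s`, its square is controlled by the energy on that part of the
ray. -/
theorem boundary_value_sq_le (hc : Continuous h) (hp : ∀ r, 0 < h r) (hm : Monotone h)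
    (hw : ContDiff ℝ 1 w) {r : ℝ} (hr : Rm ≤ r) (hrM : r ≤ RM) {m : ℝ} (hm0 : 0 ≤ m) (c : ℝ)
    (θ : S n) :
    m * h Rm ^ (n - 1) * (w (r • (θ : E n)) - c) ^ 2 ≤ (1 + m * (RM - Rm)) *
      (m * h Rm ^ (n - 1) * (w (Rm • (θ : E n)) - c) ^ 2 + ∫ s in Rm..r, polarEnergy h w s θ) := by
  have hH : 0 < h Rm ^ (n - 1) := pow_pos (hp _) _
  have cd : Continuous fun s : ℝ => fderiv ℝ w (s • (θ : E n)) (θ : E n) :=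
    continuous_fderiv_apply hw (by fun_prop) (by fun_prop)
  have ce : Continuous fun s : ℝ => polarEnergy h w s θ :=
    (continuous_polarEnergy hc hp hw).comp (Continuous.prodMk_left θ)
  set X := ∫ s in Rm..r, polarEnergy h w s θ
  have hX : 0 ≤ X := intervalIntegral.integral_nonneg hr fun s _ => polarEnergy_nonneg hp w s θ
  set b := w (r • (θ : E n)) - w (Rm • (θ : E n)) with hb
  have h1 : b = ∫ s in Rm..r, fderiv ℝ w (s • (θ : E n)) θ :=
    (intervalIntegral.integral_eq_sub_of_hasDerivAt (fun s _ => hasDerivAt_radial hw θ s)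
      (cd.intervalIntegrable _ _)).symm
  have h2 : h Rm ^ (n - 1) * ∫ s in Rm..r, fderiv ℝ w (s • (θ : E n)) θ ^ 2 ≤ X := by
    rw [← intervalIntegral.integral_const_mul]
    refine intervalIntegral.integral_mono_on hr
      ((continuous_const.mul (cd.pow 2)).intervalIntegrable _ _) (ce.intervalIntegrable _ _)
      fun s hs => ?_
    refine le_trans ?_ (polarEnergy_ge hp w s θ)
    exact mul_le_mul_of_nonneg_right (pow_le_pow_left₀ (hp _).le (hm hs.1) _) (sq_nonneg _)
  have h3 : b ^ 2 ≤ (RM - Rm) * (X / h Rm ^ (n - 1)) := by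
    rw [h1]
    refine (sq_intervalIntegral_le cd hr).trans ?_
    have h4 : ∫ s in Rm..r, fderiv ℝ w (s • (θ : E n)) θ ^ 2 ≤ X / h Rm ^ (n - 1) := by
      rw [le_div_iff₀ hH, mul_comm]; exact h2
    exact mul_le_mul (by linarith) h4
      (intervalIntegral.integral_nonneg hr fun _ _ => sq_nonneg _) (by linarith)
  have h5 := mul_add_sq_le (a := w (Rm • (θ : E n)) - c) hm0 (by linarith : 0 ≤ RM - Rm)
    (div_nonneg hX hH.le) h3
  have h6 := mul_le_mul_of_nonneg_left h5 hH.le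
  rw [show w (Rm • (θ : E n)) - c + b = w (r • (θ : E n)) - c by rw [hb]; ring] at h6
  refine le_trans (le_of_eq (by ring)) (h6.trans (le_of_eq ?_))
  field_simp

/-- The energy splits at radius `Rm`: the inner part controls the variance on the sphere of radius
`Rm` through the annulus eigenvalue, the outer part pays for moving boundary values along rays. The
surface density is at most `T h(RM)^{n-1}`. -/
theorem le_mu1_of_annulus (hc : Continuous h) (hp : ∀ r, 0 < h r) (hm : Monotone h)
    (hρ : IsRadialFunction ρ) (hR : 0 < R₁) (hR₁ : R₁ ≤ Rm) (hRm : ∀ θ : S n, Rm ≤ ρ θ)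
    (hRM : ∀ θ : S n, ρ θ ≤ RM) (hn : 2 ≤ n) {T : ℝ} (hT0 : 0 < T)
    (hT : ∀ θ : S n, √(1 + ‖sphGrad ρ θ‖ ^ 2 / h (ρ θ) ^ 2) ≤ T) (hmM : Rm ≤ RM) :
    mu1 h (fun _ : E n => Rm) R₁ * h Rm ^ (n - 1) / (T * h RM ^ (n - 1) *
      (1 + mu1 h (fun _ : E n => Rm) R₁ * (RM - Rm))) ≤ mu1 h ρ R₁ := by
  have hn0 : n ≠ 0 := by omega
  have hρm : IsRadialFunction (fun _ : E n => Rm) := .const (hR.trans_le hR₁)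
  have hm1 := mu1_nonneg (n := n) hp hρm hR
  set m := mu1 h (fun _ : E n => Rm) R₁ with hmdef
  have hH : 0 < h Rm ^ (n - 1) := pow_pos (hp _) _
  have hM : 0 < h RM ^ (n - 1) := pow_pos (hp _) _
  have hD : 0 ≤ RM - Rm := sub_nonneg.2 hmM
  have hmD : 0 < 1 + m * (RM - Rm) := by positivity
  have fs := isFiniteMeasure_surf hc hp hρ
  have fm := isFiniteMeasure_surf (n := n) hc hp hρm
  refine le_mu1 hc hp hρ hR (by positivity) ?_ (exists_boundary_variance hc hp hρ hn0)
  intro w hw c' hmean'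
  have cw : Continuous fun θ : S n => w (bdry ρ θ) := hw.continuous.comp (continuous_bdry hρ)
  have cm : Continuous fun θ : S n => w (Rm • (θ : E n)) := hw.continuous.comp (by fun_prop)
  obtain ⟨c, hmean⟩ := exists_integral_sub_eq_zero (integrable_surf hc hp hρm cm)
  have cE : Continuous (Function.uncurry fun (θ : S n) (r : ℝ) => polarEnergy h w r θ) :=
    (continuous_polarEnergy hc hp hw).comp continuous_swap
  have cI : ∀ a, Continuous fun θ : S n => ∫ r in a..ρ θ, polarEnergy h w r θ := fun a =>
    intervalIntegral.continuous_parametric_intervalIntegral_of_continuous cE hρ.continuous_sphere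
  have cJ : Continuous fun θ : S n => ∫ r in R₁..Rm, polarEnergy h w r θ :=
    intervalIntegral.continuous_parametric_intervalIntegral_of_continuous cE continuous_const
  set X := ∫ θ : S n, (∫ r in Rm..ρ θ, polarEnergy h w r θ) ∂(sph n) with hX
  set V := ∫ θ : S n, (w (Rm • (θ : E n)) - c) ^ 2 ∂(sph n) with hV
  have e1 : energy h ρ R₁ w = energy h (fun _ : E n => Rm) R₁ w + X := by
    rw [energy_eq_polar hc hp hρ hR (fun θ => hR₁.trans (hRm θ)) hn0 hw,
      energy_eq_polar hc hp hρm hR (fun _ => hR₁) hn0 hw, hX,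
      ← integral_add (integrable_of_compact cJ) (integrable_of_compact (cI Rm))]
    refine integral_congr_ae (Eventually.of_forall fun θ => ?_)
    have ci : Continuous fun r => polarEnergy h w r θ :=
      (continuous_polarEnergy hc hp hw).comp (Continuous.prodMk_left θ)
    exact (intervalIntegral.integral_add_adjacent_intervals (ci.intervalIntegrable _ _)
      (ci.intervalIntegrable _ _)).symm
  have e2 : m * h Rm ^ (n - 1) * V ≤ energy h (fun _ : E n => Rm) R₁ w := by
    refine le_trans (le_of_eq ?_) (mu1_mul_integral_sq_le hc hp hρm hR hw hmean)
    rw [integral_surf hc hp hρm]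
    simp only [surfDensity_const, integral_const_mul, bdry]
    rw [← hmdef, hV, mul_assoc]
  have e3 : m * h Rm ^ (n - 1) * ∫ θ : S n, (w (bdry ρ θ) - c) ^ 2 ∂(sph n) ≤
      (1 + m * (RM - Rm)) * (m * h Rm ^ (n - 1) * V + X) := by
    have i1 : Integrable (fun θ : S n => m * h Rm ^ (n - 1) * (w (Rm • (θ : E n)) - c) ^ 2)
        (sph n) := integrable_of_compact (continuous_const.mul ((cm.sub continuous_const).pow 2))
    rw [hV, hX, ← integral_const_mul, ← integral_const_mul,
      ← integral_add i1 (integrable_of_compact (cI Rm)), ← integral_const_mul]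
    refine integral_mono
      (integrable_of_compact (continuous_const.mul ((cw.sub continuous_const).pow 2)))
      ((i1.add (integrable_of_compact (cI Rm))).const_mul _) fun θ => ?_
    exact boundary_value_sq_le hc hp hm hw (hRm θ) (hRM θ) hm1 c θ
  -- The constant `c'` is the mean on the true boundary, `c` the mean on the inner sphere;
  -- exchanging the former for the latter can only increase the integral.
  have e4 : ∫ θ, (w (bdry ρ θ) - c') ^ 2 ∂(surf h ρ) ≤
      T * h RM ^ (n - 1) * ∫ θ : S n, (w (bdry ρ θ) - c) ^ 2 ∂(sph n) := by
    refine (integral_sub_mean_sq_le (memLp_surf hc hp hρ cw) hmean' c).trans ?_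
    rw [integral_surf hc hp hρ, ← integral_const_mul]
    refine integral_mono (integrable_of_compact ((continuous_surfDensity hc hp hρ).mul
      ((cw.sub continuous_const).pow 2)))
      (integrable_of_compact (continuous_const.mul ((cw.sub continuous_const).pow 2))) fun θ => ?_
    refine mul_le_mul_of_nonneg_right ?_ (sq_nonneg _)
    rw [surfDensity, mul_comm]
    exact mul_le_mul (hT θ) (pow_le_pow_left₀ (hp _).le (hm (hRM θ)) _)
      (pow_nonneg (hp _).le _) hT0.le
  rw [div_mul_eq_mul_div, div_le_iff₀ (by positivity)]
  calc m * h Rm ^ (n - 1) * ∫ θ, (w (bdry ρ θ) - c') ^ 2 ∂(surf h ρ)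
      ≤ m * h Rm ^ (n - 1) * (T * h RM ^ (n - 1) *
          ∫ θ : S n, (w (bdry ρ θ) - c) ^ 2 ∂(sph n)) :=
        mul_le_mul_of_nonneg_left e4 (by positivity)
    _ = T * h RM ^ (n - 1) * (m * h Rm ^ (n - 1) *
          ∫ θ : S n, (w (bdry ρ θ) - c) ^ 2 ∂(sph n)) := by ring
    _ ≤ T * h RM ^ (n - 1) * ((1 + m * (RM - Rm)) * (m * h Rm ^ (n - 1) * V + X)) :=
        mul_le_mul_of_nonneg_left e3 (by positivity)
    _ ≤ T * h RM ^ (n - 1) * ((1 + m * (RM - Rm)) * energy h ρ R₁ w) := by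
        rw [e1]
        gcongr
    _ = _ := by ring

end lower

/-! ### Reduction to a positive monotone warping function and the conclusion -/

section warping

variable {h k : ℝ → ℝ} {ρ : E n → ℝ} {R₁ RM : ℝ}

/-- The eigenvalue depends only on the values of `h` on the range of radii of the domain. -/
theorem mu1_congr (hρ : IsRadialFunction ρ) (hR : 0 < R₁) (hRρ : ∀ θ : S n, R₁ ≤ ρ θ)
    (hRM : ∀ θ : S n, ρ θ ≤ RM) (hk : ∀ r ∈ Set.Icc R₁ RM, h r = k r) :
    mu1 h ρ R₁ = mu1 k ρ R₁ := by
  have hmem : ∀ x ∈ perforated ρ R₁, h ‖x‖ = k ‖x‖ := fun x hx =>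
    hk _ ⟨hx.1.le, hx.2.le.trans (hρ.le_of_sphere hRM (ne_zero_of_mem_perforated hR hx))⟩
  have hvol : vol h ρ R₁ = vol k ρ R₁ := by
    refine withDensity_congr_ae ?_
    filter_upwards [ae_restrict_mem (isOpen_perforated hρ hR).measurableSet] with x hx
    rw [hmem x hx]
  have hsurf : surf h ρ = surf k ρ := by
    simp only [surf, fun θ : S n => hk _ ⟨hRρ θ, hRM θ⟩]
  have hH1 : ∀ u G φ, IsH1 h ρ R₁ u G φ ↔ IsH1 k ρ R₁ u G φ := fun u G φ => by
    constructor
    · rintro ⟨h1, h2, h3, h4⟩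
      rw [hvol] at h1 h2 h4
      rw [hsurf] at h3 h4
      exact ⟨h1, h2, h3, h4⟩
    · rintro ⟨h1, h2, h3, h4⟩
      rw [← hvol] at h1 h2 h4
      rw [← hsurf] at h3 h4
      exact ⟨h1, h2, h3, h4⟩
  have hgrad : ∀ G : E n → E n, ∫ x, gradNormSq h x (G x) ∂(vol h ρ R₁) =
      ∫ x, gradNormSq k x (G x) ∂(vol k ρ R₁) := fun G => by
    rw [← hvol]
    refine integral_congr_ae ?_
    filter_upwards [ae_vol_mem hρ hR] with x hx
    simp only [gradNormSq, metric, riemGrad, hmem x hx]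
  simp only [mu1, hH1, hsurf, hgrad]

/-- If `h x ≤ 0`, monotonicity forces `h = 0` on `[0, x]`, which contradicts the derivative `1` at
`0`. -/
theorem warping_pos {L : ℝ} (h_zero : h 0 = 0) (h_deriv : HasDerivWithinAt h 1 (Set.Icc 0 L) 0)
    (h_mono : MonotoneOn h (Set.Icc 0 L)) {x : ℝ} (hx : 0 < x) (hxL : x ≤ L) : 0 < h x := by
  by_contra hcon
  push Not at hcon
  have hx0 : (0 : ℝ) ∈ Set.Icc 0 x := Set.left_mem_Icc.2 hx.le
  have h1 : ∀ t ∈ Set.Icc 0 x, h t = 0 := fun t ht => by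
    have htL : t ∈ Set.Icc 0 L := ⟨ht.1, ht.2.trans hxL⟩
    refine le_antisymm ((h_mono htL ⟨hx.le, hxL⟩ ht.2).trans hcon) ?_
    rw [← h_zero]
    exact h_mono ⟨le_rfl, hx.le.trans hxL⟩ htL ht.1
  have h2 : HasDerivWithinAt h 0 (Set.Icc 0 x) 0 :=
    (hasDerivWithinAt_const (0 : ℝ) (Set.Icc 0 x) (0 : ℝ)).congr h1 (h1 0 hx0)
  have h3 := h_deriv.mono (Set.Icc_subset_Icc_right hxL)
  exact one_ne_zero ((uniqueDiffOn_Icc hx 0 hx0).eq_deriv _ h3 h2)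

/-- By `angle_eq` the cosine of the angle is the inverse of the left side. Cosine decreases on `[0,
π]`, and `α < π/2` makes `1 / cos α = √(1 + tan² α)`. -/
theorem sqrt_le_of_angle_le (hρ : IsRadialFunction ρ) {θ : S n} (hh : h (ρ θ) ≠ 0) {α : ℝ}
    (hα : α < Real.pi / 2) (hθ : angle h ρ θ ≤ α) :
    √(1 + ‖sphGrad ρ θ‖ ^ 2 / h (ρ θ) ^ 2) ≤ √(1 + Real.tan α ^ 2) := by
  rw [angle_eq h hρ θ hh] at hθ
  set q := √(1 + ‖sphGrad ρ θ‖ ^ 2 / h (ρ θ) ^ 2)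
  have hα0 : 0 ≤ α := (Real.arccos_nonneg _).trans hθ
  have hq : 1 ≤ q := Real.one_le_sqrt.2 (le_add_of_nonneg_right (by positivity))
  have hq0 : 0 < q := by linarith
  have hcos : 0 < Real.cos α := Real.cos_pos_of_mem_Ioo ⟨by linarith [Real.pi_pos], hα⟩
  have h1 := Real.cos_le_cos_of_nonneg_of_le_pi (Real.arccos_nonneg q⁻¹)
    (by linarith [Real.pi_pos]) hθ
  rw [Real.cos_arccos (by linarith [inv_pos.2 hq0]) (inv_le_one_of_one_le₀ hq),
    ← Real.inv_sqrt_one_add_tan_sq hcos] at h1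
  exact (inv_le_inv₀ (by positivity) hq0).1 h1

end warping

/-- The comparison theorem for a warping function that is positive and monotone on the whole line. -/
theorem mu1_comparison {h : ℝ → ℝ} (hc : Continuous h) (hp : ∀ r, 0 < h r) (hm : Monotone h)
    {ρ : E n → ℝ} (hρ : IsRadialFunction ρ) {R₁ Rm RM α : ℝ} (hR : 0 < R₁) (hR₁ : R₁ ≤ Rm)
    (hmM : Rm ≤ RM) (hRm : ∀ θ : S n, Rm ≤ ρ θ) (hRM : ∀ θ : S n, ρ θ ≤ RM) (hn : 2 ≤ n)
    (hT : ∀ θ : S n, √(1 + ‖sphGrad ρ θ‖ ^ 2 / h (ρ θ) ^ 2) ≤ √(1 + Real.tan α ^ 2)) :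
    lowerConst n h Rm RM α * mu1 h (fun _ : E n => Rm) R₁ ≤ mu1 h ρ R₁ ∧
      mu1 h ρ R₁ ≤ upperConst n h Rm RM * mu1 h (fun _ : E n => RM) R₁ := by
  have hH : 0 < h Rm ^ (n - 1) := pow_pos (hp _) _
  have hM : 0 < h RM ^ (n - 1) := pow_pos (hp _) _
  have hD : 0 ≤ RM - Rm := sub_nonneg.2 hmM
  constructor
  · have hT0 : 0 < √(1 + Real.tan α ^ 2) := by positivity
    have h1 := le_mu1_of_annulus hc hp hm hρ hR hR₁ hRm hRM hn hT0 hT hmM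
    have hρm : IsRadialFunction (fun _ : E n => Rm) := .const (hR.trans_le hR₁)
    obtain ⟨F, hF⟩ := exists_isRiccati hc hp hm hn hR₁
    -- The upper estimate for the constant radial function `Rm`, combined with the bound on `F /
    -- h^{n-1}`.
    have h2 : mu1 h (fun _ : E n => Rm) R₁ ≤ √((n : ℝ) - 1) / h Rm :=
      (mu1_le_riccati_div hc hp hm hρm hR hR₁ (fun _ => le_rfl) (fun _ => le_rfl) hn hF).trans
        (hF.quotient_le hp hn (Set.right_mem_Icc.2 hR₁))
    have h3 := mu1_nonneg (n := n) hp hρm hR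
    refine le_trans ?_ h1
    set m := mu1 h (fun _ : E n => Rm) R₁
    set T := √(1 + Real.tan α ^ 2)
    have h4 : 1 + m * (RM - Rm) ≤ 1 + √((n : ℝ) - 1) * (RM - Rm) / h Rm := by
      have := mul_le_mul_of_nonneg_right h2 hD
      rw [div_mul_eq_mul_div] at this
      linarith
    have h5 : 0 < 1 + m * (RM - Rm) := by positivity
    calc lowerConst n h Rm RM α * m
        = h Rm ^ (n - 1) / (T * h RM ^ (n - 1)) *
            (1 + √((n : ℝ) - 1) * (RM - Rm) / h Rm)⁻¹ * m := rfl
      _ ≤ h Rm ^ (n - 1) / (T * h RM ^ (n - 1)) * (1 + m * (RM - Rm))⁻¹ * m := by gcongr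
      _ = m * h Rm ^ (n - 1) / (T * h RM ^ (n - 1) * (1 + m * (RM - Rm))) := by
        field_simp
  -- One solution on `[R₁, RM]` serves the domain and the outer annulus, so `F RM` is common to both
  -- estimates and only the powers of `h` remain.
  · obtain ⟨F, hF⟩ := exists_isRiccati hc hp hm hn (hR₁.trans hmM)
    have h1 := riccati_div_le_mu1 hc hp hn hR (hR₁.trans hmM) hF
    have h2 := mu1_le_riccati_div hc hp hm hρ hR hR₁ hRm hRM hn hF
    refine h2.trans (le_trans (le_of_eq ?_) (mul_le_mul_of_nonneg_left h1 (div_pos hM hH).le))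
    rw [upperConst]
    field_simp

end SteklovNeumann

end

theorem theorem1p2 (n : ℕ) (hn : 2 ≤ n)
    (L : ℝ) (hL : 0 < L) (h : ℝ → ℝ)
    (h_smooth : ContDiffOn ℝ ∞ h (Set.Icc 0 L))
    (h_zero : h 0 = 0) (h_deriv : HasDerivWithinAt h 1 (Set.Icc 0 L) 0)
    (h_mono : MonotoneOn h (Set.Icc 0 L))
    (ρ : SteklovNeumann.E n → ℝ) (hρ : SteklovNeumann.IsRadialFunction ρ)
    (R₁ Rm RM α : ℝ)
    (hRm : IsLeast (ρ '' Metric.sphere 0 1) Rm)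
    (hRM : IsGreatest (ρ '' Metric.sphere 0 1) RM)
    (hRML : RM ≤ L) (hR₁ : 0 < R₁) (hR₁m : R₁ < Rm)
    (hα : α < Real.pi / 2) (h_angle : ∀ u, SteklovNeumann.angle h ρ u ≤ α) :
    0 < SteklovNeumann.lowerConst n h Rm RM α ∧
    0 < SteklovNeumann.upperConst n h Rm RM ∧
    SteklovNeumann.lowerConst n h Rm RM α * SteklovNeumann.mu1 h (fun _ : SteklovNeumann.E n => Rm) R₁ ≤
      SteklovNeumann.mu1 h ρ R₁ ∧
    SteklovNeumann.mu1 h ρ R₁ ≤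
      SteklovNeumann.upperConst n h Rm RM * SteklovNeumann.mu1 h (fun _ : SteklovNeumann.E n => RM) R₁ := by
  have hmem : ∀ θ : SteklovNeumann.S n, ρ θ ∈ ρ '' Metric.sphere 0 1 := fun θ => ⟨θ, θ.2, rfl⟩
  have hρm : ∀ θ : SteklovNeumann.S n, Rm ≤ ρ θ := fun θ => hRm.2 (hmem θ)
  have hρM : ∀ θ : SteklovNeumann.S n, ρ θ ≤ RM := fun θ => hRM.2 (hmem θ)
  have hmM : Rm ≤ RM := hRM.2 hRm.1
  have hRm0 : 0 < Rm := hR₁.trans hR₁m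
  have hRM0 : 0 < RM := hRm0.trans_le hmM
  have hpos : ∀ x, 0 < x → x ≤ L → 0 < h x := fun x hx hxL =>
    SteklovNeumann.warping_pos h_zero h_deriv h_mono hx hxL
  have hRm' := hpos Rm hRm0 (hmM.trans hRML)
  have hRM' := hpos RM hRM0 hRML
  have hD : 0 ≤ RM - Rm := sub_nonneg.2 hmM
  -- only the values of `h` on `[R₁, RM]` matter
  set k : ℝ → ℝ := fun r => h (max R₁ (min RM r)) with hk
  have hclamp : ∀ r, max R₁ (min RM r) ∈ Set.Icc R₁ RM := fun r =>
    ⟨le_max_left _ _, max_le (hR₁m.le.trans hmM) (min_le_left _ _)⟩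
  have hsub : ∀ r ∈ Set.Icc R₁ RM, r ∈ Set.Icc 0 L := fun r hr =>
    ⟨hR₁.le.trans hr.1, hr.2.trans hRML⟩
  have hkh : ∀ r ∈ Set.Icc R₁ RM, h r = k r := fun r hr => by
    simp only [hk, min_eq_right hr.2, max_eq_right hr.1]
  have hkc : Continuous k := h_smooth.continuousOn.comp_continuous (by fun_prop)
    fun r => hsub _ (hclamp r)
  have hkp : ∀ r, 0 < k r := fun r =>
    hpos _ (hR₁.trans_le (hclamp r).1) ((hclamp r).2.trans hRML)
  have hkm : Monotone k := fun r s hrs => h_mono (hsub _ (hclamp r)) (hsub _ (hclamp s))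
    (max_le_max le_rfl (min_le_min le_rfl hrs))
  have hT : ∀ θ : SteklovNeumann.S n,
      √(1 + ‖SteklovNeumann.sphGrad ρ θ‖ ^ 2 / k (ρ θ) ^ 2) ≤ √(1 + Real.tan α ^ 2) := fun θ => by
    have hθ : ρ θ ∈ Set.Icc R₁ RM := ⟨hR₁m.le.trans (hρm θ), hρM θ⟩
    rw [← hkh _ hθ]
    exact SteklovNeumann.sqrt_le_of_angle_le hρ
      (hpos _ (hR₁.trans_le hθ.1) (hθ.2.trans hRML)).ne' hα (h_angle θ)
  have key := SteklovNeumann.mu1_comparison hkc hkp hkm hρ hR₁ hR₁m.le hmM hρm hρM hn hT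
  have ek : k Rm = h Rm := (hkh _ ⟨hR₁m.le, hmM⟩).symm
  have eK : k RM = h RM := (hkh _ ⟨hR₁m.le.trans hmM, le_rfl⟩).symm
  simp only [SteklovNeumann.lowerConst, SteklovNeumann.upperConst, ek, eK] at key ⊢
  rw [SteklovNeumann.mu1_congr hρ hR₁ (fun θ => hR₁m.le.trans (hρm θ)) hρM hkh,
    SteklovNeumann.mu1_congr (.const hRm0) hR₁ (fun _ => hR₁m.le) (fun _ => hmM) hkh,
    SteklovNeumann.mu1_congr (.const hRM0) hR₁ (fun _ => hR₁m.le.trans hmM) (fun _ => le_rfl) hkh]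
  exact ⟨by positivity, by positivity, key.1, key.2⟩
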